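/- For irrational $\alpha$ and real $\gamma$ put $M(\alpha,\gamma)=\liminf_{|n|\to\infty}|n|\,\|n\alpha-\gamma\|$ ($n\in\mathbb Z$, $\|x\|$ the distance from $x$ to the nearest integer) and $\rho(\alpha)=\sup_{\gamma\notin\mathbb Z+\alpha\mathbb Z}M(\alpha,\gamma)$. Let $\alpha=[a_0;\varepsilon_1a_1,\varepsilon_2a_2,\dots]=a_0+\cfrac{\varepsilon_1}{a_1+\cfrac{\varepsilon_2}{a_2+\cdots}}$ with $a_i\in\mathbb Z$, $\varepsilon_i=\pm1$ and $|\alpha-a_0|<\tfrac12$, let $p_i/q_i=[a_0;\varepsilon_1a_1,\dots,\varepsilon_ia_i]$ be its convergents, $D_i=|q_i\alpha-p_i|$, $\alpha_i=[0;a_{i+1},\varepsilon_{i+2}a_{i+2},\dots]$ and $\bar\alpha_i=[0;a_i,\varepsilon_ia_{i-1},\dots,\varepsilon_2a_1]$. The expansion is called an adjusted nearest integer expansion if (i) for all $i\ge1$: $a_i\ge2$, and $a_i=2$ implies $\varepsilon_i=1$ or $\varepsilon_{i+1}=1$; (ii) if $i\ge2$, $a_i=2$, $\varepsilon_i=-1$,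 then $1/\bar\alpha_{i-1}-1/\alpha_i\ge1$; (iii) if $i\ge2$, $a_i=2$, $\varepsilon_{i+1}=-1$, then $1/\alpha_i-1/\bar\alpha_{i-1}>1$; (iv) the sequence $(\varepsilon_ia_i)_{i\ge1}$ contains no block $2,-3,\dots,-3,-2$ with $k\ge0$ entries $-3$. Put $$\gamma_*=\sum_{i\ge1}\tfrac12(a_i-1+\varepsilon_i+\lambda_i)D_{i-1},$$ where $\lambda_i=0$ if $a_i$ is even, and $\lambda_i=(-1)^j$ if $a_i$ is the $j$-th odd term of $a_1,a_2,\dots$. Let $$C=\frac{(\sqrt{10}-3)(7-\sqrt{13})}{31-2\sqrt{10}-3\sqrt{13}}=\frac1{25.159\ldots}.$$ Theorem. For every adjusted nearest integer expansion of an irrational $\alpha$, the series $\gamma_*$ converges, $\gamma_*\notin\mathbb Z+\alpha\mathbb Z$, and $M(\alpha,\gamma_*)\ge C$. Hence $\rho(\alpha)\ge C$ for every irrational $\alpha$. The bound is approached: for every $k\ge1$ there is an adjusted nearest integer expansion in which $\varepsilon_1a_1,\varepsilon_2a_2,\dots$ is periodic with period $$\underbrace{3,\dots,3}_{k},\,-2,\,2,\,-3,\,\underbrace{-4,-2,2,2,\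 \dots,\ -4,-2,2,2}_{k\text{ blocks}},$$ and for every $\delta>0$ there is a $K$ such that $M(\alpha,\gamma_*)<C+\delta$ for every adjusted nearest integer expansion that is eventually periodic with this period for some $k\ge K$. -/

import Mathlib

open Filter Topology

noncomputable section

namespace Inhom

/-- Distance `‖x‖` from `x` to the nearest integer. -/
def distInt (x : ℝ) : ℝ := |x - round x|

/-- `M(α, γ) = liminf_{|n| → ∞} |n| ‖n α - γ‖`, over all integers `n`, as an extended real.
(On `ℤ` the cofinite filter is the filter `|n| → ∞`.) -/
def M (α γ : ℝ) : EReal :=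
  liminf (fun n : ℤ => ((|(n : ℝ)| * distInt (n * α - γ) : ℝ) : EReal)) cofinite

/-- The set `ℤ + α ℤ`. -/
def lattice (α : ℝ) : Set ℝ := {x | ∃ m n : ℤ, x = m + n * α}

/-- `ρ(α) = sup { M(α, γ) : γ ∉ ℤ + α ℤ }`, as an extended real. -/
def rho (α : ℝ) : EReal := ⨆ γ ∈ (lattice α)ᶜ, M α γ

/-! A semi-regular continued fraction `[a 0; ε 1 * a 1, ε 2 * a 2, …]`, that is
`a 0 + ε 1 / (a 1 + ε 2 / (a 2 + ⋯))`, is given by two sequences `a`, `ε` (the value `ε 0` plays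
no role). -/

/-- Numerators `p i` of the convergents `p i / q i = [a 0; ε 1 * a 1, …, ε i * a i]`. -/
def num (a ε : ℕ → ℤ) : ℕ → ℤ
  | 0 => a 0
  | 1 => a 1 * a 0 + ε 1
  | n + 2 => a (n + 2) * num a ε (n + 1) + ε (n + 2) * num a ε n

/-- Denominators `q i` of the convergents. -/
def den (a ε : ℕ → ℤ) : ℕ → ℤ
  | 0 => 1
  | 1 => a 1
  | n + 2 => a (n + 2) * den a ε (n + 1) + ε (n + 2) * den a ε n

/-- The tail `α_i = [0; a (i+1), ε (i+2) * a (i+2), …]` of the expansion of `α`: since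
`α = a 0 + ε 1 * α_0`, `1 / α_i = a (i+1) + ε (i+2) * α_{i+1}` and `ε = ±1`, it is computed
from `α` by solving for the next tail. -/
def tail (α : ℝ) (a ε : ℕ → ℤ) : ℕ → ℝ
  | 0 => ε 1 * (α - a 0)
  | i + 1 => ε (i + 2) * (1 / tail α a ε i - a (i + 1))

/-- The reversed expansion `[0; a i, ε i * a (i-1), …, ε 2 * a 1]` (and `0` for `i = 0`). -/
def back (a ε : ℕ → ℤ) : ℕ → ℝ
  | 0 => 0
  | i + 1 => 1 / (a (i + 1) + ε (i + 1) * back a ε i)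

/-- `[a 0; ε 1 * a 1, ε 2 * a 2, …]` is an adjusted nearest integer expansion of the irrational
number `α`, where `a 0` is the integer nearest to `α`. In `two_neg` and `neg_two` the index starts
at `2`: for `i = 1` the reversed expansion is the empty one, and `half` already excludes
`a 1 = 2`, `ε 2 = -1`. -/
structure IsAdjusted (α : ℝ) (a ε : ℕ → ℤ) : Prop where
  irrational : Irrational α
  sign : ∀ i, 1 ≤ i → ε i = 1 ∨ ε i = -1
  two_le : ∀ i, 1 ≤ i → 2 ≤ a i
  expansion : Tendsto (fun i => (num a ε i : ℝ) / (den a ε i : ℝ)) atTop (𝓝 α)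
  half : |α - a 0| < 1 / 2
  two_sign : ∀ i, 1 ≤ i → a i = 2 → ε i = 1 ∨ ε (i + 1) = 1
  two_neg : ∀ i, 2 ≤ i → a i = 2 → ε i = -1 →
    1 ≤ 1 / back a ε (i - 1) - 1 / tail α a ε i
  neg_two : ∀ i, 2 ≤ i → a i = 2 → ε (i + 1) = -1 →
    1 < 1 / tail α a ε i - 1 / back a ε (i - 1)
  /-- no block `2, -3, …, -3, -2` with `k ≥ 0` entries `-3` -/
  no_block : ∀ i k, 1 ≤ i →
    ¬ (ε i * a i = 2 ∧ (∀ j, i < j → j ≤ i + k → ε j * a j = -3) ∧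
      ε (i + k + 1) * a (i + k + 1) = -2)

/-- `λ i` is `0` if `a i` is even and `(-1) ^ j` if `a i` is the `j`-th odd partial quotient among
`a 1, a 2, …`. -/
def lam (a : ℕ → ℤ) (i : ℕ) : ℤ :=
  if Even (a i) then 0 else (-1) ^ ((Finset.Icc 1 i).filter (fun k => Odd (a k))).card

/-- The term `(1/2) (a i - 1 + ε i + λ i) D_{i-1}` with `D_j = |q j * α - p j|` and `i = j + 1`. -/
def gammaTerm (α : ℝ) (a ε : ℕ → ℤ) (j : ℕ) : ℝ :=
  1 / 2 * ((a (j + 1) : ℝ) - 1 + ε (j + 1) + lam a (j + 1)) * |den a ε j * α - num a ε j|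

/-- `γ_* = ∑_{i ≥ 1} (1/2) (a i - 1 + ε i + λ i) D_{i-1}`. -/
def gammaStar (α : ℝ) (a ε : ℕ → ℤ) : ℝ := ∑' j, gammaTerm α a ε j

/-- The constant `(√10 - 3)(7 - √13) / (31 - 2√10 - 3√13)`. -/
def bound : ℝ :=
  (√10 - 3) * (7 - √13) / (31 - 2 * √10 - 3 * √13)

/-- The finite sequence `(3,)^k -2, 2, -3, (-4, -2, 2, 2,)^k`. -/
def block (k : ℕ) : List ℤ :=
  List.replicate k 3 ++ [-2, 2, -3] ++ (List.replicate k [-4, -2, 2, 2]).flatten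

/-- The signed partial quotients `ε i * a i`, from the index `N + 1` on, repeat the sequence `w`
(so `N = 0` means that the expansion is purely periodic after `a 0`). -/
def PeriodicFrom (N : ℕ) (w : List ℤ) (a ε : ℕ → ℤ) : Prop :=
  ∀ j, ε (N + 1 + j) * a (N + 1 + j) = w.getD (j % w.length) 0

end Inhom

end

/-! Telescoping the series with D_{i-2} = a_i D_{i-1} + ε_{i+1} D_i gives 2γ_* = 1 + (α - a_0) -
η_0, where η_0 = -∑ λ_i D_{i-1}. With u = 2n - 1 the number 2‖nα - γ_*‖ is therefore the least value
of |w - (α - a_0)u - η_0| over odd w. Hence |n| ‖nα - γ_*‖ is asymptotically a quarter of a product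
x y, where x = |u| and y are the distances of a point with odd coordinates (u, w) from two fixed
axes. What has to be shown is x y ≥ 4C for the points that are close to the second axis.

The continued fraction supplies a chain of bases of this grid (`coord`). In the k-th basis the four
points with coordinates ±1 form a cell, and `coord_abs` expresses the two distances through four
numbers: `back` and `xi` depend only on the partial quotients up to k, `tail` and `eta` only on the
later ones. The parity-dependent λ_i is what keeps the coordinates odd and the offsets `xi`, `eta`
small. A point that violates the bound must be a vertex of one of two consecutive cells
(`le_of_vertexBound`), so everything reduces to `VertexBound`, an inequality in the four numbers and
one sign.

A finite branch and bound over windows of partial quotients (`search_sound`) proves this inequality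
with the constant 0.15899, slightly more than 4C, except for one grid point, which is a vertex of
three consecutive cells around the signed digits 3, -2, 2, -3, -4. For that point `critical_forms`
and `critical_product` reduce the claim to two extremal problems, one on each side. On the left, a
region for (`back`, `xi`) bounded by two lines is invariant under a further digit 3 and has its
corner at the limit of 3, 3, 3, … (`beforeThree`). On the right, any excess of `tail - eta` over its
value for -4, -2, 2, 2, -4, … would force another such block and grow tenfold (`tail_sub_eta_le`).
The two limits together determine `bound`. The periods that contain long runs of both kinds come
close to both limits, so continuity shows that the constant is approached.

For arbitrary irrational α an adjusted expansion is produced by rounding to the nearest integer,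
with a correction that compares the tail with the reversed expansion and with the golden ratio
(`IsRounded`). -/

noncomputable section

namespace Inhom

/-! ### Convergents, their distances from α, and tails -/

/-- The distances `D_{k-1}`, shifted by one so that `gap 0 = 1` stands for `D_{-1}`. -/
def gap (α : ℝ) (a ε : ℕ → ℤ) : ℕ → ℝ
  | 0 => 1
  | k + 1 => |(den a ε k : ℝ) * α - num a ε k|

/-- The sign of `q_{k-1} α - p_{k-1}`. -/
def sgn (ε : ℕ → ℤ) : ℕ → ℤ
  | 0 => -1
  | k + 1 => -ε (k + 1) * sgn ε k

lemma mul_self_sign {x : ℤ} (h : x = 1 ∨ x = -1) : x * x = 1 := by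
  rcases h with h | h <;> simp [h]

lemma sgn_sign {ε : ℕ → ℤ} (hs : ∀ i, 1 ≤ i → ε i = 1 ∨ ε i = -1) :
    ∀ k, sgn ε k = 1 ∨ sgn ε k = -1
  | 0 => Or.inr rfl
  | k + 1 => by
    rcases hs (k + 1) (by omega) with h | h <;> rcases sgn_sign hs k with h' | h' <;>
      simp [sgn, h, h']

/-- A solution of the recurrence of the convergents that starts off monotone stays so. -/
lemma rec_mono {a ε : ℕ → ℤ} (hs : ∀ i, 1 ≤ i → ε i = 1 ∨ ε i = -1) (ha : ∀ i, 1 ≤ i → 2 ≤ a i)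
    {X : ℕ → ℤ} {k : ℕ} (h0 : 0 ≤ X k) (h1 : X k ≤ X (k + 1))
    (hX : ∀ n, k ≤ n → X (n + 2) = a (n + 2) * X (n + 1) + ε (n + 2) * X n) :
    ∀ n, k ≤ n → 0 ≤ X n ∧ X n ≤ X (n + 1) := by
  intro n hn
  induction n, hn using Nat.le_induction with
  | base => exact ⟨h0, h1⟩
  | succ n hn ih =>
    refine ⟨ih.1.trans ih.2, ?_⟩
    rw [hX n hn]
    have h2 := ha (n + 2) (by omega)
    rcases hs (n + 2) (by omega) with h | h <;> rw [h] <;> nlinarith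

lemma den_pos_lt {a ε : ℕ → ℤ} (hs : ∀ i, 1 ≤ i → ε i = 1 ∨ ε i = -1)
    (ha : ∀ i, 1 ≤ i → 2 ≤ a i) : ∀ k, 0 < den a ε k ∧ den a ε k < den a ε (k + 1)
  | 0 => by have := ha 1 le_rfl; simp only [den]; omega
  | k + 1 => by
    obtain ⟨h0, h1⟩ := den_pos_lt hs ha k
    refine ⟨h0.trans h1, ?_⟩
    have h2 := ha (k + 2) (by omega)
    simp only [den]
    rcases hs (k + 2) (by omega) with h | h <;> rw [h] <;> nlinarith

lemma le_den {a ε : ℕ → ℤ} (hs : ∀ i, 1 ≤ i → ε i = 1 ∨ ε i = -1)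
    (ha : ∀ i, 1 ≤ i → 2 ≤ a i) : ∀ k : ℕ, (k : ℤ) + 1 ≤ den a ε k
  | 0 => by simp [den]
  | k + 1 => by
    have h1 := (den_pos_lt hs ha k).2
    have h2 := le_den hs ha k
    push_cast; omega

lemma tendsto_den {a ε : ℕ → ℤ} (hs : ∀ i, 1 ≤ i → ε i = 1 ∨ ε i = -1)
    (ha : ∀ i, 1 ≤ i → 2 ≤ a i) : Tendsto (fun k => (den a ε k : ℝ)) atTop atTop := by
  refine tendsto_atTop_mono (fun k => ?_) tendsto_natCast_atTop_atTop
  have := le_den hs ha k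
  have h : ((k : ℤ) : ℝ) + 1 ≤ (den a ε k : ℝ) := by exact_mod_cast this
  push_cast at h; linarith

lemma det_succ {a ε : ℕ → ℤ} : ∀ k,
    den a ε k * num a ε (k + 1) - num a ε k * den a ε (k + 1) = sgn ε (k + 1)
  | 0 => by simp [den, num, sgn]; ring
  | k + 1 => by
    have h := det_succ (a := a) (ε := ε) k
    rw [sgn, ← h]
    simp only [den, num]; ring

/-- Facts about the tails of a semi-regular continued fraction with partial quotients `≥ 2`. -/
structure IsTails (a ε : ℕ → ℤ) (A : ℕ → ℝ) : Prop where
  sign : ∀ i, 1 ≤ i → ε i = 1 ∨ ε i = -1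
  two_le : ∀ i, 1 ≤ i → 2 ≤ a i
  pos : ∀ k, 0 < A k
  le_one : ∀ k, A k ≤ 1
  eqn : ∀ k, A k * (a (k + 1) + ε (k + 2) * A (k + 1)) = 1

lemma IsTails.tail_eq {a ε : ℕ → ℤ} {A : ℕ → ℝ} (h : IsTails a ε A) {α : ℝ}
    (h0 : α = a 0 + ε 1 * A 0) : ∀ k, tail α a ε k = A k
  | 0 => by
    rw [tail, h0]
    have := mul_self_sign (h.sign 1 le_rfl)
    have h1 : (ε 1 : ℝ) * ε 1 = 1 := by exact_mod_cast this
    linear_combination A 0 * h1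
  | k + 1 => by
    rw [tail, h.tail_eq h0 k]
    have := mul_self_sign (h.sign (k + 2) (by omega))
    have h1 : (ε (k + 2) : ℝ) * ε (k + 2) = 1 := by exact_mod_cast this
    have h2 : 1 / A k = a (k + 1) + ε (k + 2) * A (k + 1) := by
      rw [div_eq_iff (h.pos k).ne']; linarith [h.eqn k]
    rw [h2]
    linear_combination A (k + 1) * h1

/-- `q_{k} α - p_{k}` in terms of the tails. -/
lemma IsTails.delta {a ε : ℕ → ℤ} {A : ℕ → ℝ} (h : IsTails a ε A) {α : ℝ}
    (h0 : α = a 0 + ε 1 * A 0) : ∀ k,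
    (den a ε k : ℝ) * α - num a ε k = sgn ε (k + 1) * ∏ i ∈ Finset.range (k + 1), A i
  | 0 => by simp [den, num, sgn, h0]
  | 1 => by
    have e := h.eqn 0
    simp only [den, num, sgn, Finset.prod_range_succ, Finset.prod_range_zero, h0]
    push_cast
    norm_num at e ⊢
    have := mul_self_sign (h.sign 2 (by omega))
    have h1 : (ε 2 : ℝ) * ε 2 = 1 := by exact_mod_cast this
    linear_combination (ε 1 : ℝ) * e
  | k + 2 => by
    have e := h.eqn (k + 1)
    have i0 := h.delta h0 k
    have i1 := h.delta h0 (k + 1)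
    have h1 : (ε (k + 2) : ℝ) * ε (k + 2) = 1 := by
      exact_mod_cast mul_self_sign (h.sign (k + 2) (by omega))
    rw [Finset.prod_range_succ] at i1
    rw [Finset.prod_range_succ, Finset.prod_range_succ]
    have e1 : (sgn ε (k + 2) : ℝ) = -ε (k + 2) * sgn ε (k + 1) := by rw [sgn]; push_cast; ring
    have e2 : (sgn ε (k + 3) : ℝ) = -ε (k + 3) * (-ε (k + 2) * sgn ε (k + 1)) := by
      rw [sgn, sgn]; push_cast; ring
    rw [e1] at i1
    rw [e2]
    simp only [den, num]
    push_cast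
    set P := ∏ i ∈ Finset.range (k + 1), A i
    linear_combination (a (k + 2) : ℝ) * i1 + (ε (k + 2) : ℝ) * i0
      + (-(ε (k + 2) : ℝ) * sgn ε (k + 1) * P) * e

/-- `q_k p_n - p_k q_n`, the quantity `q_k α - p_k` with `α` replaced by a convergent. -/
def cross (a ε : ℕ → ℤ) (k n : ℕ) : ℤ := den a ε k * num a ε n - num a ε k * den a ε n

lemma cross_rec (a ε : ℕ → ℤ) (k n : ℕ) :
    cross a ε k (n + 2) = a (n + 2) * cross a ε k (n + 1) + ε (n + 2) * cross a ε k n := by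
  simp only [cross, num, den]; ring

lemma cross_self (a ε : ℕ → ℤ) (k : ℕ) : cross a ε k k = 0 := by simp only [cross]; ring

lemma cross_succ (a ε : ℕ → ℤ) (k : ℕ) : cross a ε k (k + 1) = sgn ε (k + 1) := det_succ k

lemma sgn_mul_self {ε : ℕ → ℤ} (hs : ∀ i, 1 ≤ i → ε i = 1 ∨ ε i = -1) (k : ℕ) :
    sgn ε k * sgn ε k = 1 := mul_self_sign (sgn_sign hs k)

/-- As a sequence in n this solves the recurrence of the convergents and starts with 0, 1, so
`rec_mono` keeps it nonnegative. Divided by q_n, in the limit it gives the sign of q_k α - p_k. -/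
lemma sgn_cross_nonneg {a ε : ℕ → ℤ} (hs : ∀ i, 1 ≤ i → ε i = 1 ∨ ε i = -1)
    (ha : ∀ i, 1 ≤ i → 2 ≤ a i) (k n : ℕ) (hn : k ≤ n) :
    0 ≤ sgn ε (k + 1) * cross a ε k n := by
  refine (rec_mono (X := fun n => sgn ε (k + 1) * cross a ε k n) hs ha ?_ ?_ ?_ n hn).1
  · simp [cross_self]
  · simp [cross_self, cross_succ, sgn_mul_self hs]
  · intro n _
    simp only [cross_rec]; ring

/-- The difference of the two sides solves the same recurrence and starts with 1, a_{k+2} - 1. In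
the limit this becomes D_{k+1} ≤ D_k. -/
lemma sgn_cross_anti {a ε : ℕ → ℤ} (hs : ∀ i, 1 ≤ i → ε i = 1 ∨ ε i = -1)
    (ha : ∀ i, 1 ≤ i → 2 ≤ a i) (k n : ℕ) (hn : k + 1 ≤ n) :
    sgn ε (k + 2) * cross a ε (k + 1) n ≤ sgn ε (k + 1) * cross a ε k n := by
  have := (rec_mono
    (X := fun n => sgn ε (k + 1) * cross a ε k n - sgn ε (k + 2) * cross a ε (k + 1) n)
    hs ha ?_ ?_ ?_ n hn).1
  · simpa using this
  · simp [cross_self, cross_succ, sgn_mul_self hs]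
  · have h2 := ha (k + 2) (by omega)
    have e1 := sgn_mul_self hs (k + 1)
    have e2 := sgn_mul_self hs (k + 2)
    have c1 : cross a ε k (k + 1 + 1) = a (k + 2) * sgn ε (k + 1) := by
      rw [cross_rec, cross_self, cross_succ]; ring
    have c2 : cross a ε (k + 1) (k + 1 + 1) = sgn ε (k + 2) := cross_succ a ε (k + 1)
    simp only [c1, c2, cross_self, cross_succ]
    have : sgn ε (k + 1) * (a (k + 2) * sgn ε (k + 1)) - sgn ε (k + 2) * sgn ε (k + 2)
        = a (k + 2) - 1 := by
      linear_combination (a (k + 2)) * e1 - e2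
    rw [this, e1]
    omega
  · intro n _
    simp only [cross_rec]; ring

namespace IsAdjusted

variable {α : ℝ} {a ε : ℕ → ℤ}

lemma tendsto_cross (h : IsAdjusted α a ε) (k : ℕ) :
    Tendsto (fun n => (cross a ε k n : ℝ) / den a ε n) atTop
      (𝓝 (den a ε k * α - num a ε k)) := by
  have := (h.expansion.const_mul (den a ε k : ℝ)).sub_const (num a ε k : ℝ)
  refine this.congr fun n => ?_
  have hd : (den a ε n : ℝ) ≠ 0 := by exact_mod_cast (den_pos_lt h.sign h.two_le n).1.ne'
  simp only [cross]
  push_cast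
  field_simp

lemma sgn_delta_pos (h : IsAdjusted α a ε) (k : ℕ) :
    0 < (sgn ε (k + 1) : ℝ) * (den a ε k * α - num a ε k) := by
  have h1 : 0 ≤ (sgn ε (k + 1) : ℝ) * (den a ε k * α - num a ε k) := by
    refine ge_of_tendsto ((h.tendsto_cross k).const_mul _) ?_
    filter_upwards [eventually_ge_atTop k] with n hn
    rw [← mul_div_assoc]
    have hd : (0 : ℝ) < den a ε n := by exact_mod_cast (den_pos_lt h.sign h.two_le n).1
    refine div_nonneg ?_ hd.le
    exact_mod_cast sgn_cross_nonneg h.sign h.two_le k n hn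
  -- The limit gives only a weak inequality; irrationality of α makes it strict.
  refine lt_of_le_of_ne h1 (Ne.symm (mul_ne_zero ?_ ?_))
  · rcases sgn_sign h.sign (k + 1) with e | e <;> simp [e]
  · have hd : den a ε k ≠ 0 := (den_pos_lt h.sign h.two_le k).1.ne'
    exact ((h.irrational.intCast_mul hd).sub_intCast _).ne_zero

lemma gap_succ (h : IsAdjusted α a ε) (k : ℕ) :
    gap α a ε (k + 1) = sgn ε (k + 1) * (den a ε k * α - num a ε k) := by
  have h1 := h.sgn_delta_pos k
  rw [gap]
  rcases sgn_sign h.sign (k + 1) with e | e <;> rw [e] at h1 ⊢ <;> push_cast at h1 ⊢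
  · rw [abs_of_pos (by linarith)]; ring
  · rw [abs_of_neg (by linarith)]; ring

lemma gap_pos (h : IsAdjusted α a ε) : ∀ k, 0 < gap α a ε k
  | 0 => one_pos
  | k + 1 => by rw [h.gap_succ]; exact h.sgn_delta_pos k

lemma gap_anti (h : IsAdjusted α a ε) : ∀ k, gap α a ε (k + 1) ≤ gap α a ε k
  | 0 => by
    simp only [gap, den, num]
    have := h.half
    norm_num; linarith
  | k + 1 => by
    rw [h.gap_succ, h.gap_succ]
    refine le_of_tendsto_of_tendsto ((h.tendsto_cross (k + 1)).const_mul _)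
      ((h.tendsto_cross k).const_mul _) ?_
    filter_upwards [eventually_ge_atTop (k + 1)] with n hn
    have hd : (0 : ℝ) < den a ε n := by exact_mod_cast (den_pos_lt h.sign h.two_le n).1
    rw [← mul_div_assoc, ← mul_div_assoc]
    refine div_le_div_of_nonneg_right ?_ hd.le
    exact_mod_cast sgn_cross_anti h.sign h.two_le k n hn

lemma gap_rec (h : IsAdjusted α a ε) (k : ℕ) :
    gap α a ε k = a (k + 1) * gap α a ε (k + 1) + ε (k + 2) * gap α a ε (k + 2) := by
  have e2 : (ε (k + 2) : ℝ) * ε (k + 2) = 1 := by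
    exact_mod_cast mul_self_sign (h.sign (k + 2) (by omega))
  have e1 : (ε (k + 1) : ℝ) * ε (k + 1) = 1 := by
    exact_mod_cast mul_self_sign (h.sign (k + 1) (by omega))
  rw [h.gap_succ, h.gap_succ]
  have s2 : (sgn ε (k + 2) : ℝ) = -ε (k + 2) * sgn ε (k + 1) := by rw [sgn]; push_cast; ring
  rw [show k + 1 + 1 = k + 2 by rfl, s2]
  rcases k with _ | k
  · simp only [gap, den, num, sgn]
    push_cast
    norm_num at e1 ⊢
    linear_combination (-1 : ℝ) * e1 + ((ε 1 : ℝ) * (a 1 * α - (a 1 * a 0 + ε 1))) * e2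
  · rw [h.gap_succ]
    have s1 : (sgn ε (k + 2) : ℝ) = -ε (k + 2) * sgn ε (k + 1) := by rw [sgn]; push_cast; ring
    rw [show k + 1 + 1 = k + 2 by rfl, s1]
    simp only [den, num]
    push_cast
    set d0 := (den a ε k : ℝ)
    set d1 := (den a ε (k + 1) : ℝ)
    set n0 := (num a ε k : ℝ)
    set n1 := (num a ε (k + 1) : ℝ)
    set s := (sgn ε (k + 1) : ℝ)
    have e3 : (ε (k + 3) : ℝ) * ε (k + 3) = 1 := by
      exact_mod_cast mul_self_sign (h.sign (k + 3) (by omega))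
    rw [show k + 1 + 2 = k + 3 by rfl] at *
    simp only [show k + 1 + 1 = k + 2 by rfl] at *
    linear_combination (-s * (d0 * α - n0)) * e1 - (ε (k + 2) * s * (
      (a (k + 2) * d1 + ε (k + 2) * d0) * α - (a (k + 2) * n1 + ε (k + 2) * n0))) * e2

/-- `tail` is defined by solving formally for the next tail. As a quotient of consecutive distances
it is seen to lie in (0, 1]. -/
lemma tail_eq (h : IsAdjusted α a ε) : ∀ k,
    tail α a ε k = gap α a ε (k + 1) / gap α a ε k
  | 0 => by
    rw [h.gap_succ]; simp [tail, gap, den, num, sgn]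
  | k + 1 => by
    rw [tail, h.tail_eq k]
    have h0 := (h.gap_pos k).ne'
    have h1 := (h.gap_pos (k + 1)).ne'
    have e2 : (ε (k + 2) : ℝ) * ε (k + 2) = 1 := by
      exact_mod_cast mul_self_sign (h.sign (k + 2) (by omega))
    have := h.gap_rec k
    field_simp
    rw [show k + 1 + 1 = k + 2 by rfl]
    linear_combination (ε (k + 2) : ℝ) * this + gap α a ε (k + 2) * e2

lemma isTails (h : IsAdjusted α a ε) : IsTails a ε (tail α a ε) where
  sign := h.sign
  two_le := h.two_le
  pos k := by rw [h.tail_eq]; exact div_pos (h.gap_pos _) (h.gap_pos _)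
  le_one k := by rw [h.tail_eq]; exact div_le_one_of_le₀ (h.gap_anti k) (h.gap_pos _).le
  eqn k := by
    rw [h.tail_eq, h.tail_eq]
    have h0 := (h.gap_pos k).ne'
    have h1 := (h.gap_pos (k + 1)).ne'
    have := h.gap_rec k
    field_simp
    rw [show k + 1 + 1 = k + 2 by rfl]
    linarith

end IsAdjusted

/-! ### Bounds for tails, reversed expansions and the offsets `xi` -/

/-- The normalised offset of the centre of the `k`-th cell in the direction of the denominators. -/
def xi (a ε : ℕ → ℤ) : ℕ → ℝ
  | 0 => 0
  | k + 1 => if Even (a (k + 1)) then -(ε (k + 1) * back a ε (k + 1) * xi a ε k)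
      else -(back a ε (k + 1) * (1 - ε (k + 1) * xi a ε k))

lemma xi_even {a ε : ℕ → ℤ} {k : ℕ} (h : Even (a (k + 1))) :
    xi a ε (k + 1) = -(ε (k + 1) * back a ε (k + 1) * xi a ε k) := by rw [xi, if_pos h]

lemma xi_odd {a ε : ℕ → ℤ} {k : ℕ} (h : ¬ Even (a (k + 1))) :
    xi a ε (k + 1) = -(back a ε (k + 1) * (1 - ε (k + 1) * xi a ε k)) := by rw [xi, if_neg h]

namespace IsAdjusted

variable {α : ℝ} {a ε : ℕ → ℤ}

lemma tail_pos (h : IsAdjusted α a ε) (k : ℕ) : 0 < tail α a ε k := h.isTails.pos k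

lemma tail_mul (h : IsAdjusted α a ε) (k : ℕ) :
    tail α a ε k * (a (k + 1) + ε (k + 2) * tail α a ε (k + 1)) = 1 := h.isTails.eqn k

lemma first (h : IsAdjusted α a ε) (h2 : a 1 = 2) : ε 2 = 1 := by
  rcases h.sign 2 (by omega) with e | e
  · exact e
  · exfalso
    have h1 := h.tail_mul 0
    have h3 := h.tail_pos 0
    have h4 := h.tail_pos 1
    have h5 : tail α a ε 0 < 1 / 2 := by
      refine lt_of_le_of_lt (le_abs_self _) ?_
      rw [tail, abs_mul]
      have : |(ε 1 : ℝ)| = 1 := by rcases h.sign 1 le_rfl with e | e <;> simp [e]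
      rw [this, one_mul]; exact h.half
    rw [zero_add, zero_add, h2, e] at h1
    push_cast at h1
    nlinarith

lemma two_sign' (h : IsAdjusted α a ε) {i : ℕ} (hi : 1 ≤ i) (h2 : a i = 2) (h1 : ε (i + 1) = -1) :
    ε i = 1 := by
  rcases h.two_sign i hi h2 with e | e
  · exact e
  · omega

lemma tail_lt_one (h : IsAdjusted α a ε) (k : ℕ) : tail α a ε k ≤ 1 := h.isTails.le_one k

/-- A digit 2 preceded by a minus sign is followed by a plus sign, so the denominator is at least 2;
for a digit ≥ 3 it is at least 3 - 1. -/
lemma tail_le_half (h : IsAdjusted α a ε) {k : ℕ} (h1 : ε (k + 1) = -1) : tail α a ε k ≤ 1 / 2 := by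
  have e := h.tail_mul k
  have p := h.tail_pos k
  have p' := h.tail_pos (k + 1)
  have l' := h.tail_lt_one (k + 1)
  have h2 := h.two_le (k + 1) (by omega)
  rcases eq_or_lt_of_le h2 with h2 | h2
  · have h3 : ε (k + 2) = 1 := by
      rcases h.two_sign (k + 1) (by omega) h2.symm with e | e
      · omega
      · exact e
    rw [h3, ← h2] at e
    push_cast at e
    nlinarith
  · have h3 : (3 : ℝ) ≤ a (k + 1) := by exact_mod_cast h2
    have h4 : 2 ≤ (a (k + 1) : ℝ) + ε (k + 2) * tail α a ε (k + 1) := by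
      rcases h.sign (k + 2) (by omega) with e | e <;> rw [e] <;> push_cast <;> linarith
    nlinarith

/-- The bound for a tail in terms of its first partial quotient. -/
lemma tail_mul_le (h : IsAdjusted α a ε) (k : ℕ) : tail α a ε k * (2 * a (k + 1) - 1) ≤ 2 := by
  have e := h.tail_mul k
  have p := h.tail_pos k
  have p' := h.tail_pos (k + 1)
  rcases h.sign (k + 2) (by omega) with s | s
  · rw [s] at e; push_cast at e; nlinarith
  · have := h.tail_le_half s
    rw [s] at e; push_cast at e; nlinarith

lemma tail_le (h : IsAdjusted α a ε) (k : ℕ) : tail α a ε k ≤ 2 / 3 := by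
  have e := h.tail_mul_le k
  have p := h.tail_pos k
  have h2 : (2 : ℝ) ≤ a (k + 1) := by exact_mod_cast h.two_le (k + 1) (by omega)
  nlinarith

lemma back_nonneg_le_one (h : IsAdjusted α a ε) : ∀ k, 0 ≤ back a ε k ∧ back a ε k ≤ 1
  | 0 => by simp [back]
  | k + 1 => by
    obtain ⟨h0, h1⟩ := h.back_nonneg_le_one k
    have h2 : (2 : ℝ) ≤ a (k + 1) := by exact_mod_cast h.two_le (k + 1) (by omega)
    have h4 : 1 ≤ (a (k + 1) : ℝ) + ε (k + 1) * back a ε k := by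
      rcases h.sign (k + 1) (by omega) with e | e <;> rw [e] <;> push_cast <;> linarith
    rw [back]
    exact ⟨by positivity, by rw [div_le_one (by linarith)]; exact h4⟩

lemma back_nonneg (h : IsAdjusted α a ε) (k : ℕ) : 0 ≤ back a ε k := (h.back_nonneg_le_one k).1

lemma back_mul (h : IsAdjusted α a ε) (k : ℕ) :
    back a ε (k + 1) * (a (k + 1) + ε (k + 1) * back a ε k) = 1 := by
  obtain ⟨h0, h1⟩ := h.back_nonneg_le_one k
  have h2 : (2 : ℝ) ≤ a (k + 1) := by exact_mod_cast h.two_le (k + 1) (by omega)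
  have h4 : 1 ≤ (a (k + 1) : ℝ) + ε (k + 1) * back a ε k := by
    rcases h.sign (k + 1) (by omega) with e | e <;> rw [e] <;> push_cast <;> linarith
  rw [back, one_div, inv_mul_cancel₀ (by linarith)]

lemma back_pos (h : IsAdjusted α a ε) (k : ℕ) : 0 < back a ε (k + 1) := by
  refine lt_of_le_of_ne (h.back_nonneg _) fun e => ?_
  have := h.back_mul k
  rw [← e, zero_mul] at this
  exact zero_ne_one this

/-- Mirror image of `tail_le_half`: condition (i) on the digits 2 reads the same backwards. -/
lemma back_le_half (h : IsAdjusted α a ε) : ∀ {k : ℕ}, ε (k + 1) = -1 → back a ε k ≤ 1 / 2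
  | 0, _ => by norm_num [back]
  | k + 1, h1 => by
    have e := h.back_mul k
    have p := h.back_pos k
    obtain ⟨p', l'⟩ := h.back_nonneg_le_one k
    have h2 := h.two_le (k + 1) (by omega)
    rcases eq_or_lt_of_le h2 with h2 | h2
    · have h3 := h.two_sign' (by omega) h2.symm h1
      rw [h3, ← h2] at e
      push_cast at e
      nlinarith
    · have h3 : (3 : ℝ) ≤ a (k + 1) := by exact_mod_cast h2
      have h4 : 2 ≤ (a (k + 1) : ℝ) + ε (k + 1) * back a ε k := by
        rcases h.sign (k + 1) (by omega) with e | e <;> rw [e] <;> push_cast <;> linarith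
      nlinarith

lemma back_mul_le (h : IsAdjusted α a ε) (k : ℕ) : back a ε (k + 1) * (2 * a (k + 1) - 1) ≤ 2 := by
  have e := h.back_mul k
  have p := h.back_pos k
  have p' := h.back_nonneg k
  rcases h.sign (k + 1) (by omega) with s | s
  · rw [s] at e; push_cast at e; nlinarith
  · have := h.back_le_half s
    rw [s] at e; push_cast at e; nlinarith

lemma back_le (h : IsAdjusted α a ε) : ∀ k, back a ε k ≤ 2 / 3
  | 0 => by norm_num [back]
  | k + 1 => by
    have e := h.back_mul_le k
    have p := h.back_pos k
    have h2 : (2 : ℝ) ≤ a (k + 1) := by exact_mod_cast h.two_le (k + 1) (by omega)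
    nlinarith

lemma three_le_of_odd (h : IsAdjusted α a ε) {k : ℕ} (hk : 1 ≤ k) (ho : ¬ Even (a k)) :
    3 ≤ a k := by
  have h2 := h.two_le k hk
  rcases eq_or_lt_of_le h2 with h2 | h2
  · exact absurd (h2 ▸ even_two) ho
  · exact h2

/-- The asymmetric upper bound `back / 2` is needed to close the induction for |ξ| ≤ 1/2: for an odd
digit after a minus sign, 1 + ξ ≤ (3 - back)/2 follows from ξ ≤ back/2 and back ≤ 1/2. The lower
bound is the worst case of an odd digit. -/
lemma xi_bounds (h : IsAdjusted α a ε) : ∀ k, |xi a ε k| ≤ 1 / 2 ∧ xi a ε k ≤ back a ε k / 2 ∧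
    -(3 / 2 * back a ε k) ≤ xi a ε k
  | 0 => by norm_num [xi, back]
  | k + 1 => by
    obtain ⟨h1, h2, -⟩ := h.xi_bounds k
    obtain ⟨h3, h4⟩ := abs_le.1 h1
    have p := h.back_pos k
    have p' := h.back_nonneg k
    have l := h.back_le (k + 1)
    have e := h.back_mul k
    set B := back a ε (k + 1)
    by_cases he : Even (a (k + 1))
    · rw [xi_even he]
      rcases h.sign (k + 1) (by omega) with s | s <;> rw [s] <;> push_cast <;>
        refine ⟨abs_le.2 ⟨?_, ?_⟩, ?_, ?_⟩ <;> nlinarith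
    · rw [xi_odd he]
      have ha := h.back_mul_le k
      have h5 : (3 : ℝ) ≤ a (k + 1) := by exact_mod_cast h.three_le_of_odd (by omega) he
      rcases h.sign (k + 1) (by omega) with s | s <;> rw [s] at e ⊢ <;> push_cast at e ⊢
      · refine ⟨abs_le.2 ⟨?_, ?_⟩, ?_, ?_⟩ <;> nlinarith
      · have := h.back_le_half s
        refine ⟨abs_le.2 ⟨?_, ?_⟩, ?_, ?_⟩ <;> nlinarith

lemma abs_xi_le (h : IsAdjusted α a ε) (k : ℕ) : |xi a ε k| ≤ 1 / 2 := (h.xi_bounds k).1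

lemma xi_even_bounds (h : IsAdjusted α a ε) {k : ℕ} (he : Even (a (k + 1))) :
    |xi a ε (k + 1)| ≤ back a ε (k + 1) / 2 := by
  obtain ⟨h3, h4⟩ := abs_le.1 (h.abs_xi_le k)
  have p := h.back_pos k
  rw [xi_even he]
  rcases h.sign (k + 1) (by omega) with s | s <;> rw [s] <;> push_cast <;>
    refine abs_le.2 ⟨?_, ?_⟩ <;> nlinarith

lemma xi_odd_bounds (h : IsAdjusted α a ε) {k : ℕ} (ho : ¬ Even (a (k + 1))) :
    -(3 / 2 * back a ε (k + 1)) ≤ xi a ε (k + 1) ∧ xi a ε (k + 1) ≤ -(back a ε (k + 1) / 2) := by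
  obtain ⟨h3, h4⟩ := abs_le.1 (h.abs_xi_le k)
  have p := h.back_pos k
  rw [xi_odd ho]
  rcases h.sign (k + 1) (by omega) with s | s <;> rw [s] <;> push_cast <;>
    constructor <;> nlinarith

end IsAdjusted

/-! ### The offsets `eta` and the value of γ_* -/

/-- The sign `(-1) ^ j`, where `j` is the number of odd terms among `a 1, …, a k`. -/
def par (a : ℕ → ℤ) (k : ℕ) : ℤ := (-1) ^ ((Finset.Icc 1 k).filter (fun k => Odd (a k))).card

lemma par_zero (a : ℕ → ℤ) : par a 0 = 1 := by simp [par]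

lemma par_succ (a : ℕ → ℤ) (k : ℕ) :
    par a (k + 1) = if Even (a (k + 1)) then par a k else -par a k := by
  have hI : Finset.Icc 1 (k + 1) = insert (k + 1) (Finset.Icc 1 k) := by
    ext x; simp only [Finset.mem_Icc, Finset.mem_insert]; omega
  rw [par, par, hI, Finset.filter_insert]
  split_ifs with h1 h2 h2
  · exact absurd h2 (Int.not_even_iff_odd.2 h1)
  · rw [Finset.card_insert_of_notMem (by simp), pow_succ]; ring
  · rfl
  · exact absurd (Int.not_even_iff_odd.1 h2) h1

lemma lam_succ (a : ℕ → ℤ) (k : ℕ) :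
    lam a (k + 1) = if Even (a (k + 1)) then 0 else -par a k := by
  rw [lam]
  split_ifs with h
  · rfl
  · have := par_succ a k
    rw [if_neg h] at this
    exact this

lemma par_sign (a : ℕ → ℤ) (k : ℕ) : par a k = 1 ∨ par a k = -1 := neg_one_pow_eq_or ℤ _

lemma abs_lam_le (a : ℕ → ℤ) (k : ℕ) : |(lam a k : ℝ)| ≤ 1 := by
  rw [lam]
  split_ifs
  · simp
  · push_cast; rw [abs_pow]; simp

/-- The remainders of the series `∑ λ_i D_{i-1}`. -/
def lamTail (α : ℝ) (a ε : ℕ → ℤ) (k : ℕ) : ℝ :=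
  ∑' j, (lam a (j + (k + 1)) : ℝ) * gap α a ε (j + (k + 1))

/-- The normalised offset of the centre of the `k`-th cell in the direction of the remainders. -/
def eta (α : ℝ) (a ε : ℕ → ℤ) (k : ℕ) : ℝ := -par a k * lamTail α a ε k / gap α a ε k

namespace IsAdjusted

variable {α : ℝ} {a ε : ℕ → ℤ}

lemma gap_succ' (h : IsAdjusted α a ε) (k : ℕ) :
    gap α a ε (k + 1) = tail α a ε k * gap α a ε k := by
  rw [h.tail_eq, div_mul_cancel₀ _ (h.gap_pos k).ne']

lemma gap_add_le (h : IsAdjusted α a ε) (k : ℕ) : ∀ j, gap α a ε (j + k) ≤ (2 / 3) ^ j * gap α a ε k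
  | 0 => by simp
  | j + 1 => by
    have h1 := h.gap_add_le k j
    have h2 := h.tail_le (j + k)
    have h3 := h.gap_pos (j + k)
    rw [show j + 1 + k = j + k + 1 by ring, h.gap_succ', pow_succ]
    nlinarith

lemma gap_le (h : IsAdjusted α a ε) (k : ℕ) : gap α a ε k ≤ (2 / 3) ^ k := by
  simpa [gap] using h.gap_add_le 0 k

lemma tendsto_gap (h : IsAdjusted α a ε) : Tendsto (gap α a ε) atTop (𝓝 0) :=
  squeeze_zero (fun k => (h.gap_pos k).le) h.gap_le
    (tendsto_pow_atTop_nhds_zero_of_lt_one (by norm_num) (by norm_num))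

lemma summable_gap (h : IsAdjusted α a ε) : Summable (gap α a ε) :=
  Summable.of_nonneg_of_le (fun k => (h.gap_pos k).le) h.gap_le
    (summable_geometric_of_lt_one (by norm_num) (by norm_num))

lemma summable_lam (h : IsAdjusted α a ε) :
    Summable (fun j => (lam a j : ℝ) * gap α a ε j) := by
  refine Summable.of_norm_bounded h.summable_gap fun j => ?_
  have := abs_lam_le a j
  have := h.gap_pos j
  rw [Real.norm_eq_abs, abs_mul, abs_of_pos this]
  nlinarith

lemma lamTail_eq (h : IsAdjusted α a ε) (k : ℕ) : lamTail α a ε k =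
    lam a (k + 1) * gap α a ε (k + 1) + lamTail α a ε (k + 1) := by
  have hs := (summable_nat_add_iff (k + 1)).2 h.summable_lam
  rw [lamTail, hs.tsum_eq_zero_add, lamTail, zero_add]
  congr 1
  refine tsum_congr fun j => ?_
  rw [show j + 1 + (k + 1) = j + (k + 1 + 1) by ring]

lemma abs_lamTail_le (h : IsAdjusted α a ε) (k : ℕ) : |lamTail α a ε k| ≤ 3 * gap α a ε k := by
  have hg : HasSum (fun j : ℕ => (2 / 3 : ℝ) ^ j * gap α a ε k) (3 * gap α a ε k) := by
    have := (hasSum_geometric_of_lt_one (r := (2 / 3 : ℝ)) (by norm_num) (by norm_num)).mul_right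
      (gap α a ε k)
    norm_num at this ⊢
    exact this
  rw [← Real.norm_eq_abs]
  refine tsum_of_norm_bounded hg fun j => ?_
  have h1 := abs_lam_le a (j + (k + 1))
  have h2 := h.gap_pos (j + (k + 1))
  have h3 := h.gap_add_le (k + 1) j
  have h4 := h.gap_anti k
  have h5 : (0 : ℝ) ≤ (2 / 3) ^ j := by positivity
  rw [Real.norm_eq_abs, abs_mul, abs_of_pos h2]
  nlinarith

/-- The factor `-par` in `eta` absorbs the alternating sign in λ, so that the recurrence depends on
the position only through the tail and the parity of the digit. -/
lemma eta_even (h : IsAdjusted α a ε) {k : ℕ} (he : Even (a (k + 1))) :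
    eta α a ε k = tail α a ε k * eta α a ε (k + 1) := by
  have h0 := (h.gap_pos k).ne'
  have h1 := (h.gap_pos (k + 1)).ne'
  rw [eta, eta, h.lamTail_eq, lam_succ, par_succ, if_pos he, if_pos he, h.tail_eq]
  push_cast
  field_simp
  ring

lemma eta_odd (h : IsAdjusted α a ε) {k : ℕ} (ho : ¬ Even (a (k + 1))) :
    eta α a ε k = tail α a ε k * (1 - eta α a ε (k + 1)) := by
  have h0 := (h.gap_pos k).ne'
  have h1 := (h.gap_pos (k + 1)).ne'
  have e : (par a k : ℝ) * par a k = 1 := by exact_mod_cast mul_self_sign (par_sign a k)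
  rw [eta, eta, h.lamTail_eq, lam_succ, par_succ, if_neg ho, if_neg ho, h.tail_eq]
  push_cast
  field_simp
  linear_combination gap α a ε (k + 1) * e

lemma abs_eta_le (h : IsAdjusted α a ε) (k : ℕ) : |eta α a ε k| ≤ 3 := by
  have h0 := h.gap_pos k
  have e : |(par a k : ℝ)| = 1 := by rcases par_sign a k with e | e <;> simp [e]
  rw [eta, abs_div, abs_mul, abs_neg, e, one_mul, abs_of_pos h0, div_le_iff₀ h0]
  exact h.abs_lamTail_le k

/-- Both forms of the recurrence would map [0, 1] into itself, and they contract with a factor of at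
most 2/3; the crude bound 3 is improved geometrically. -/
lemma eta_almost_mem (h : IsAdjusted α a ε) : ∀ n k : ℕ,
    -(3 * (2 / 3) ^ n) ≤ eta α a ε k ∧ eta α a ε k ≤ 1 + 3 * (2 / 3) ^ n
  | 0, k => by have := abs_le.1 (h.abs_eta_le k); constructor <;> norm_num <;> linarith
  | n + 1, k => by
    obtain ⟨h1, h2⟩ := h.eta_almost_mem n (k + 1)
    have p := h.tail_pos k
    have l := h.tail_le k
    have q : (0 : ℝ) < (2 / 3) ^ n := by positivity
    have r : tail α a ε k * (2 / 3) ^ n ≤ (2 / 3) * (2 / 3) ^ n :=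
      mul_le_mul_of_nonneg_right l q.le
    rw [pow_succ]
    by_cases he : Even (a (k + 1))
    · rw [h.eta_even he]; constructor <;> nlinarith
    · rw [h.eta_odd he]; constructor <;> nlinarith

lemma eta_mem (h : IsAdjusted α a ε) (k : ℕ) : 0 ≤ eta α a ε k ∧ eta α a ε k ≤ 1 := by
  have ht : Tendsto (fun n : ℕ => 3 * (2 / 3 : ℝ) ^ n) atTop (𝓝 0) := by
    simpa using (tendsto_pow_atTop_nhds_zero_of_lt_one (r := (2 / 3 : ℝ))
      (by norm_num) (by norm_num)).const_mul 3
  constructor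
  · have : Tendsto (fun n : ℕ => -(3 * (2 / 3 : ℝ) ^ n)) atTop (𝓝 0) := by simpa using ht.neg
    exact le_of_tendsto' this fun n => (h.eta_almost_mem n k).1
  · have : Tendsto (fun n : ℕ => 1 + 3 * (2 / 3 : ℝ) ^ n) atTop (𝓝 1) := by
      simpa using ht.const_add 1
    exact ge_of_tendsto' this fun n => (h.eta_almost_mem n k).2

lemma eta_nonneg (h : IsAdjusted α a ε) (k : ℕ) : 0 ≤ eta α a ε k := (h.eta_mem k).1

lemma eta_le_tail (h : IsAdjusted α a ε) (k : ℕ) : eta α a ε k ≤ tail α a ε k := by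
  obtain ⟨h1, h2⟩ := h.eta_mem (k + 1)
  have p := h.tail_pos k
  by_cases he : Even (a (k + 1))
  · rw [h.eta_even he]; nlinarith
  · rw [h.eta_odd he]; nlinarith

lemma eta_le_of_odd (h : IsAdjusted α a ε) {k : ℕ} (ho : ¬ Even (a (k + 1))) :
    eta α a ε k ≤ 3 / 7 := by
  have p := h.tail_pos k
  have h1 := h.eta_nonneg (k + 1)
  have h5 : (3 : ℝ) ≤ a (k + 1) := by exact_mod_cast h.three_le_of_odd (by omega) ho
  have h6 := h.tail_mul k
  have h7 := h.tail_le (k + 1)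
  have h8 := h.tail_pos (k + 1)
  have h9 : (7 / 3 : ℝ) ≤ a (k + 1) + ε (k + 2) * tail α a ε (k + 1) := by
    rcases h.sign (k + 2) (by omega) with e | e <;> rw [e] <;> push_cast <;> linarith
  rw [h.eta_odd ho]; nlinarith

/-- An odd digit is at least 3, which gives 3/7 at once. An even digit multiplies the next offset by
at most 2/3, so the excess over 3/7 decays. -/
lemma eta_le_add (h : IsAdjusted α a ε) : ∀ n k : ℕ, eta α a ε k ≤ 3 / 7 + (2 / 3) ^ n
  | 0, k => by have := (h.eta_mem k).2; norm_num; linarith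
  | n + 1, k => by
    have q : (0 : ℝ) < (2 / 3) ^ n := by positivity
    have i1 := h.eta_le_add n (k + 1)
    rw [pow_succ]
    by_cases he : Even (a (k + 1))
    · have p := h.tail_pos k
      have l := h.tail_le k
      have h1 := h.eta_nonneg (k + 1)
      rw [h.eta_even he]; nlinarith
    · have := h.eta_le_of_odd he
      linarith

lemma eta_le (h : IsAdjusted α a ε) (k : ℕ) : eta α a ε k ≤ 3 / 7 := by
  have ht : Tendsto (fun n : ℕ => 3 / 7 + (2 / 3 : ℝ) ^ n) atTop (𝓝 (3 / 7)) := by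
    simpa using (tendsto_pow_atTop_nhds_zero_of_lt_one (r := (2 / 3 : ℝ))
      (by norm_num) (by norm_num)).const_add (3 / 7)
  exact ge_of_tendsto' ht fun n => h.eta_le_add n k

lemma eta_even_le (h : IsAdjusted α a ε) {k : ℕ} (he : Even (a (k + 1))) :
    eta α a ε k ≤ 3 / 7 * tail α a ε k := by
  have := h.eta_le (k + 1)
  have p := h.tail_pos k
  rw [h.eta_even he]; nlinarith

lemma le_eta_odd (h : IsAdjusted α a ε) {k : ℕ} (ho : ¬ Even (a (k + 1))) :
    4 / 7 * tail α a ε k ≤ eta α a ε k := by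
  have := h.eta_le (k + 1)
  have p := h.tail_pos k
  rw [h.eta_odd ho]; nlinarith

/-- Substituting for a_i D_{i-1} from the three-term recurrence leaves two telescoping parts and the
series with λ. -/
lemma gammaTerm_eq (h : IsAdjusted α a ε) (j : ℕ) : gammaTerm α a ε j =
    1 / 2 * (gap α a ε j - gap α a ε (j + 1)) +
    1 / 2 * (ε (j + 1) * gap α a ε (j + 1) - ε (j + 2) * gap α a ε (j + 2)) +
    1 / 2 * (lam a (j + 1) * gap α a ε (j + 1)) := by
  have := h.gap_rec j
  rw [gammaTerm, this]
  simp only [gap]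
  ring

lemma hasSum_gammaTerm (h : IsAdjusted α a ε) : HasSum (gammaTerm α a ε)
    (1 / 2 * (1 + (α - a 0) + lamTail α a ε 0)) := by
  have hs1 := (summable_nat_add_iff 1).2 h.summable_gap
  have t1 : HasSum (fun j => gap α a ε j - gap α a ε (j + 1)) 1 := by
    rw [(h.summable_gap.sub hs1).hasSum_iff_tendsto_nat]
    simp only [Finset.sum_range_sub']
    simpa [gap] using h.tendsto_gap.const_sub (gap α a ε 0)
  have hse : Summable (fun j => (ε (j + 1) : ℝ) * gap α a ε (j + 1)) := by
    refine Summable.of_norm_bounded hs1 fun j => ?_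
    have := h.gap_pos (j + 1)
    have e : |(ε (j + 1) : ℝ)| = 1 := by rcases h.sign (j + 1) (by omega) with e | e <;> simp [e]
    rw [Real.norm_eq_abs, abs_mul, abs_of_pos this, e, one_mul]
  have t2 : HasSum (fun j => (ε (j + 1) : ℝ) * gap α a ε (j + 1)
      - ε (j + 2) * gap α a ε (j + 2)) (α - a 0) := by
    rw [(hse.sub ((summable_nat_add_iff 1).2 hse)).hasSum_iff_tendsto_nat]
    simp only [Finset.sum_range_sub' (fun j => (ε (j + 1) : ℝ) * gap α a ε (j + 1))]
    have e1 : (ε (0 + 1) : ℝ) * gap α a ε (0 + 1) = α - a 0 := by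
      have e : (ε 1 : ℝ) * ε 1 = 1 := by exact_mod_cast mul_self_sign (h.sign 1 le_rfl)
      rw [h.gap_succ]
      simp [den, num, sgn]
      linear_combination (α - a 0) * e
    rw [e1]
    simpa using hse.tendsto_atTop_zero.const_sub (α - a 0)
  have t3 : HasSum (fun j => (lam a (j + 1) : ℝ) * gap α a ε (j + 1)) (lamTail α a ε 0) :=
    ((summable_nat_add_iff 1).2 h.summable_lam).hasSum
  have := ((t1.mul_left (1 / 2)).add (t2.mul_left (1 / 2))).add (t3.mul_left (1 / 2))
  rw [funext h.gammaTerm_eq, show 1 / 2 * (1 + (α - a 0) + lamTail α a ε 0) =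
    1 / 2 * 1 + 1 / 2 * (α - a 0) + 1 / 2 * lamTail α a ε 0 by ring]
  exact this

lemma gammaStar_eq (h : IsAdjusted α a ε) :
    gammaStar α a ε = 1 / 2 * (1 + (α - a 0) - eta α a ε 0) := by
  rw [gammaStar, h.hasSum_gammaTerm.tsum_eq, eta]
  simp [par_zero, gap]

end IsAdjusted

/-! ### Divided cells: the grid in the coordinates of each cell -/

/-- The coordinates `(u, w)` of a point of the grid with respect to the `k`-th cell. -/
def coord (a ε : ℕ → ℤ) (u w : ℤ) : ℕ → ℤ × ℤ
  | 0 => (u, w)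
  | k + 1 =>
    let c := coord a ε u w k
    if Even (a (k + 1)) then (-c.2, -ε (k + 1) * c.1 + a (k + 1) * c.2)
    else (c.2, ε (k + 1) * c.1 + 1 - a (k + 1) * c.2)

namespace IsAdjusted

variable {α : ℝ} {a ε : ℕ → ℤ}

/-- The shift by 1 for odd digits is there to preserve oddness, so that the cells always have
vertices with coordinates ±1. -/
lemma coord_odd (h : IsAdjusted α a ε) {u w : ℤ} (hu : Odd u) (hw : Odd w) :
    ∀ k, Odd (coord a ε u w k).1 ∧ Odd (coord a ε u w k).2
  | 0 => ⟨hu, hw⟩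
  | k + 1 => by
    obtain ⟨h1, h2⟩ := h.coord_odd hu hw k
    have he : Odd (ε (k + 1)) := by
      rcases h.sign (k + 1) (by omega) with e | e <;> rw [e] <;> decide
    rw [coord]
    split_ifs with hev
    · exact ⟨h2.neg, (he.neg.mul h1).add_even (hev.mul_right _)⟩
    · have ho := Int.not_even_iff_odd.1 hev
      exact ⟨h2, ((he.mul h1).add_odd odd_one).sub_odd (ho.mul h2)⟩

/-- The product of the two distances of the `k`-th cell. -/
lemma den_mul_gap (h : IsAdjusted α a ε) : ∀ k, (den a ε k : ℝ) * gap α a ε k *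
    (1 + ε (k + 1) * tail α a ε k * back a ε k) = 1 ∧
    back a ε (k + 1) * den a ε (k + 1) = den a ε k
  | 0 => by
    have := h.two_le 1 le_rfl
    have h0 : (a 1 : ℝ) ≠ 0 := by
      have : a 1 ≠ 0 := by omega
      exact_mod_cast this
    simp [den, gap, back, h0]
  | k + 1 => by
    obtain ⟨h1, h2⟩ := h.den_mul_gap k
    have e1 := h.back_mul k
    have e2 := h.back_mul (k + 1)
    have e3 := h.tail_mul k
    have p := h.tail_pos k
    constructor
    · rw [h.gap_succ']
      have hq : (den a ε (k + 1) : ℝ) = den a ε k * (a (k + 1) + ε (k + 1) * back a ε k) := by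
        rw [← h2]; linear_combination -(den a ε (k + 1) : ℝ) * e1
      rw [hq, show k + 1 + 1 = k + 2 by rfl]
      linear_combination h1 + (den a ε k : ℝ) * gap α a ε k * e3 +
        (den a ε k * tail α a ε k * gap α a ε k * ε (k + 2) * tail α a ε (k + 1)) * e1
    · have hq : (den a ε (k + 2) : ℝ) = a (k + 2) * den a ε (k + 1)
          + ε (k + 2) * den a ε k := by simp [den]
      rw [show k + 1 + 1 = k + 2 by rfl] at *
      rw [hq, ← h2]
      linear_combination (den a ε (k + 1) : ℝ) * e2

lemma den_pos (h : IsAdjusted α a ε) (k : ℕ) : (0 : ℝ) < den a ε k := by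
  exact_mod_cast (den_pos_lt h.sign h.two_le k).1

/-- The distances of a grid point from the axes, in terms of its coordinates in any cell. -/
lemma coord_abs (h : IsAdjusted α a ε) (u w : ℤ) : ∀ k,
    den a ε k * |(coord a ε u w k).1 + (coord a ε u w k).2 * back a ε k + xi a ε k| = |(u : ℝ)| ∧
    gap α a ε k * |(coord a ε u w k).2 - ε (k + 1) * tail α a ε k * (coord a ε u w k).1
      - eta α a ε k| = |w - ε 1 * tail α a ε 0 * u - eta α a ε 0|
  | 0 => by simp [coord, den, back, xi, gap]
  | k + 1 => by
    obtain ⟨h1, h2⟩ := h.coord_abs u w k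
    have e1 := h.back_mul k
    have e3 := h.tail_mul k
    have p := h.tail_pos k
    have pb := h.back_pos k
    have hq := (h.den_mul_gap k).2
    have ee : (ε (k + 1) : ℝ) * ε (k + 1) = 1 := by
      exact_mod_cast mul_self_sign (h.sign (k + 1) (by omega))
    have ea : |(ε (k + 1) : ℝ)| = 1 := by rcases h.sign (k + 1) (by omega) with e | e <;> simp [e]
    rw [← h1, ← h2, ← hq, h.gap_succ', coord]
    set c := coord a ε u w k
    set B := back a ε (k + 1)
    set b := back a ε k
    set q := (den a ε (k + 1) : ℝ)
    rw [show k + 1 + 1 = k + 2 by rfl]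
    set A := tail α a ε k
    set A' := tail α a ε (k + 1)
    split_ifs with hev
    · rw [xi_even hev, h.eta_even hev]
      push_cast
      constructor
      · have : (-(c.2 : ℝ) + (-ε (k + 1) * c.1 + a (k + 1) * c.2) * B +
            -(ε (k + 1) * B * xi a ε k)) = -ε (k + 1) * (B * (c.1 + c.2 * b + xi a ε k)) := by
          linear_combination (c.2 : ℝ) * e1
        rw [this, abs_mul, abs_neg, ea, one_mul, abs_mul, abs_of_pos pb]; ring
      · have : (c.2 : ℝ) - ε (k + 1) * A * c.1 - A * eta α a ε (k + 1) =
          A * ((-ε (k + 1) * c.1 + a (k + 1) * c.2) - ε (k + 2) * A' * -c.2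
            - eta α a ε (k + 1)) := by
          linear_combination -(c.2 : ℝ) * e3
        rw [this, abs_mul, abs_of_pos p]; ring
    · rw [xi_odd hev, h.eta_odd hev]
      push_cast
      constructor
      · have : ((c.2 : ℝ) + (ε (k + 1) * c.1 + 1 - a (k + 1) * c.2) * B +
            -(B * (1 - ε (k + 1) * xi a ε k))) = ε (k + 1) * (B * (c.1 + c.2 * b + xi a ε k)) := by
          linear_combination -(c.2 : ℝ) * e1
        rw [this, abs_mul, ea, one_mul, abs_mul, abs_of_pos pb]; ring
      · have : (c.2 : ℝ) - ε (k + 1) * A * c.1 - A * (1 - eta α a ε (k + 1)) =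
          -(A * ((ε (k + 1) * c.1 + 1 - a (k + 1) * c.2) - ε (k + 2) * A' * c.2
            - eta α a ε (k + 1))) := by
          linear_combination -(c.2 : ℝ) * e3
        rw [this, abs_neg, abs_mul, abs_of_pos p]; ring

end IsAdjusted

/-- The four vertices of the `k`-th cell lie in different quadrants, and the product of the
distances of each of them from the axes is at least `κ`. -/
def VertexBound (α : ℝ) (a ε : ℕ → ℤ) (κ : ℝ) (k : ℕ) : Prop :=
  ∀ u w : ℤ, (u = 1 ∨ u = -1) → (w = 1 ∨ w = -1) →
    0 ≤ 1 + u * w * back a ε k + u * xi a ε k ∧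
    0 ≤ 1 - ε (k + 1) * u * w * tail α a ε k - w * eta α a ε k ∧
    κ * (1 + ε (k + 1) * tail α a ε k * back a ε k) ≤
      (1 + u * w * back a ε k + u * xi a ε k) *
        (1 - ε (k + 1) * u * w * tail α a ε k - w * eta α a ε k)

lemma odd_cases {u : ℤ} (h : Odd u) : u = 1 ∨ u = -1 ∨ 3 ≤ |u| := by
  obtain ⟨m, rfl⟩ := h
  rcases abs_cases (2 * m + 1) with ⟨h1, h2⟩ | ⟨h1, h2⟩ <;> omega

namespace IsAdjusted

variable {α : ℝ} {a ε : ℕ → ℤ}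

lemma tail_mul_back_le (h : IsAdjusted α a ε) (k : ℕ) :
    0 ≤ tail α a ε k * back a ε k ∧ tail α a ε k * back a ε k ≤ 4 / 9 := by
  have h1 := h.tail_pos k
  have h2 := h.tail_le k
  have h3 := h.back_nonneg k
  have h4 := h.back_le k
  exact ⟨by positivity, by nlinarith⟩

lemma cell_area_bounds (h : IsAdjusted α a ε) (k : ℕ) :
    5 / 9 ≤ 1 + ε (k + 1) * tail α a ε k * back a ε k ∧
    1 + ε (k + 1) * tail α a ε k * back a ε k ≤ 13 / 9 ∧
    1 - tail α a ε k * back a ε k ≤ 1 + ε (k + 1) * tail α a ε k * back a ε k := by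
  obtain ⟨h1, h2⟩ := h.tail_mul_back_le k
  rcases h.sign (k + 1) (by omega) with e | e <;> rw [e] <;> push_cast <;>
    refine ⟨?_, ?_, ?_⟩ <;> linarith

/-- The vertices on either side of the horizontal axis confine the centre of the cell. -/
lemma abs_xi_le_of_vertexBound (h : IsAdjusted α a ε) {κ : ℝ} (hκ : 0 < κ) {k : ℕ}
    (hv : VertexBound α a ε κ k) : |xi a ε k| ≤ 1 - back a ε k - κ / 6 := by
  have hA := (h.cell_area_bounds k).1
  -- From 5κ/9 ≤ x y and y ≤ 3 one gets x ≥ 5κ/27, which exceeds κ/6. The factor 5/9 is the lower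
  -- bound for the normalised area.
  have key : ∀ x : ℝ, ∀ y : ℝ, 0 ≤ x → 0 ≤ y → y ≤ 3 → κ * (5 / 9) ≤ x * y → κ / 6 ≤ x := by
    intro x y hx hy h3 hxy
    nlinarith
  have hA' : κ * (5 / 9) ≤ κ * (1 + ε (k + 1) * tail α a ε k * back a ε k) :=
    mul_le_mul_of_nonneg_left hA hκ.le
  have t0 := h.tail_pos k
  have t1 := h.tail_le k
  have n0 := h.eta_nonneg k
  have n1 := h.eta_le k
  have hs : -(tail α a ε k) ≤ ε (k + 1) * tail α a ε k ∧
      ε (k + 1) * tail α a ε k ≤ tail α a ε k := by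
    rcases h.sign (k + 1) (by omega) with e | e <;> rw [e] <;> push_cast <;> constructor <;>
      linarith
  obtain ⟨a1, b1, c1⟩ := hv 1 (-1) (Or.inl rfl) (Or.inr rfl)
  obtain ⟨a2, b2, c2⟩ := hv (-1) 1 (Or.inr rfl) (Or.inl rfl)
  push_cast at a1 b1 c1 a2 b2 c2
  have k1 := key _ _ a1 b1 (by nlinarith) (hA'.trans c1)
  have k2 := key _ _ a2 b2 (by nlinarith) (hA'.trans c2)
  rw [abs_le]
  constructor <;> linarith

/-- With S = 1 + ε·tail·back, the intersection of the two axes has first cell coordinate -(back·eta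
+ xi)/S. The bound places it strictly inside the strip |c₁| < 1, uniformly in the cell. -/
lemma abs_center_le (h : IsAdjusted α a ε) {κ : ℝ} (hκ : 0 < κ) {k : ℕ}
    (hv : VertexBound α a ε κ k) : |back a ε k * eta α a ε k + xi a ε k| ≤
      1 + ε (k + 1) * tail α a ε k * back a ε k - κ / 6 := by
  have h1 := abs_le.1 (h.abs_xi_le_of_vertexBound hκ hv)
  have h2 := (h.cell_area_bounds k).2.2
  have b0 := h.back_nonneg k
  have n0 := h.eta_nonneg k
  have t0 := h.tail_pos k
  have t1 := h.tail_le k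
  have n1 := h.eta_le k
  have hp : 0 ≤ back a ε k * eta α a ε k := by positivity
  have hq : back a ε k * (eta α a ε k + tail α a ε k) ≤ back a ε k * 2 :=
    mul_le_mul_of_nonneg_left (by linarith) b0
  obtain ⟨a1, b1, c1⟩ := hv 1 (-1) (Or.inl rfl) (Or.inr rfl)
  obtain ⟨a2, b2, c2⟩ := hv (-1) 1 (Or.inr rfl) (Or.inl rfl)
  have hη : eta α a ε k + tail α a ε k ≤ 1 ∨ ε (k + 1) = 1 := by
    rcases h.sign (k + 1) (by omega) with e | e
    · exact Or.inr e
    · left; rw [e] at b2; push_cast at b2; have := h.tail_le_half e; linarith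
  rw [abs_le]
  have hη' : eta α a ε k + tail α a ε k ≤ 2 := by linarith
  rcases hη with hη | e
  · have : back a ε k * (eta α a ε k + tail α a ε k) ≤ back a ε k * 1 :=
      mul_le_mul_of_nonneg_left hη b0
    constructor <;> nlinarith
  · rw [e] at h2 ⊢
    push_cast at h2 ⊢
    have : back a ε k * eta α a ε k ≤ back a ε k * 1 :=
      mul_le_mul_of_nonneg_left (by linarith) b0
    have : 0 ≤ back a ε k * tail α a ε k := by positivity
    constructor <;> nlinarith

/-- A cell of which a point is a vertex bounds the product of the distances of the point. -/
lemma le_of_vertex (h : IsAdjusted α a ε) {κ : ℝ} {k : ℕ} (hv : VertexBound α a ε κ k)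
    {u w : ℤ} (hu : (coord a ε u w k).1 = 1 ∨ (coord a ε u w k).1 = -1)
    (hw : (coord a ε u w k).2 = 1 ∨ (coord a ε u w k).2 = -1) :
    κ ≤ |(u : ℝ)| * |w - ε 1 * tail α a ε 0 * u - eta α a ε 0| := by
  obtain ⟨h1, h2⟩ := h.coord_abs u w k
  obtain ⟨h3, h4, h5⟩ := hv _ _ hu hw
  set c := coord a ε u w k
  have e1 : |(c.1 + c.2 * back a ε k + xi a ε k : ℝ)| =
      1 + c.1 * c.2 * back a ε k + c.1 * xi a ε k := by
    rw [← abs_of_nonneg h3]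
    rcases hu with hu | hu <;> rw [hu] <;> push_cast
    · congr 1; ring
    · rw [← abs_neg]; congr 1; ring
  have e2 : |(c.2 - ε (k + 1) * tail α a ε k * c.1 - eta α a ε k : ℝ)| =
      1 - ε (k + 1) * c.1 * c.2 * tail α a ε k - c.2 * eta α a ε k := by
    rw [← abs_of_nonneg h4]
    rcases hw with hw | hw <;> rw [hw] <;> push_cast
    · congr 1; ring
    · rw [← abs_neg]; congr 1; ring
  rw [← h1, ← h2, e1, e2]
  have hd := (h.den_mul_gap k).1
  have hpos : 0 < (den a ε k : ℝ) * gap α a ε k := mul_pos (h.den_pos k) (h.gap_pos k)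
  calc κ = (den a ε k : ℝ) * gap α a ε k *
      (κ * (1 + ε (k + 1) * tail α a ε k * back a ε k)) := by linear_combination (-κ) * hd
    _ ≤ (den a ε k : ℝ) * gap α a ε k * _ := mul_le_mul_of_nonneg_left h5 hpos.le
    _ = _ := by ring

/-- A point with `|w| = 1` in the `k`-th cell that is a vertex neither of this cell nor of the next
one is far from the axes. -/
lemma big_of_not_vertex (h : IsAdjusted α a ε) {k : ℕ} {u w u' w' : ℤ}
    (hw : w = 1 ∨ w = -1) (hu : 3 ≤ |u|) (hw' : 3 ≤ |w'|)
    (hn : (Even (a (k + 1)) ∧ u' = -w ∧ w' = -ε (k + 1) * u + a (k + 1) * w) ∨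
      (¬ Even (a (k + 1)) ∧ u' = w ∧ w' = ε (k + 1) * u + 1 - a (k + 1) * w))
    (hy : |w - ε (k + 1) * tail α a ε k * u - eta α a ε k| < 3 / 10) :
    1 / 4 ≤ |u + w * back a ε k + xi a ε k| *
      |w - ε (k + 1) * tail α a ε k * u - eta α a ε k| := by
  have t0 := h.tail_pos k
  have t1 := h.tail_le (k + 1)
  have t1' := h.tail_pos (k + 1)
  have n0 := h.eta_nonneg k
  have n1 := h.eta_le_tail k
  have n2 := h.eta_le (k + 1)
  have n3 := h.eta_nonneg (k + 1)
  have b0 := h.back_nonneg k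
  have b1 := h.back_le k
  have e3 := h.tail_mul k
  obtain ⟨x0, x1⟩ := abs_le.1 (h.abs_xi_le k)
  have ee : (ε (k + 1) : ℝ) * ε (k + 1) = 1 := by
    exact_mod_cast mul_self_sign (h.sign (k + 1) (by omega))
  have ea : |(ε (k + 1) : ℝ)| = 1 := by rcases h.sign (k + 1) (by omega) with e | e <;> simp [e]
  set A := tail α a ε k
  set A' := tail α a ε (k + 1)
  set η := eta α a ε k
  set η' := eta α a ε (k + 1)
  have hu3 : (3 : ℝ) ≤ |(u : ℝ)| := by exact_mod_cast hu
  have hw1 : |(w : ℝ)| = 1 := by rcases hw with e | e <;> simp [e]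
  -- the first factor
  have f1 : |(u : ℝ)| - 7 / 6 ≤ |u + w * back a ε k + xi a ε k| := by
    have : |(u : ℝ)| ≤ |u + w * back a ε k + xi a ε k| + |w * back a ε k| + |xi a ε k| := by
      calc |(u : ℝ)| = |(u + w * back a ε k + xi a ε k) - w * back a ε k - xi a ε k| := by
            congr 1; ring
        _ ≤ _ := (abs_sub _ _).trans (add_le_add_left (abs_sub _ _) _)
    rw [abs_mul, hw1, one_mul, abs_of_nonneg b0] at this
    have := h.abs_xi_le k
    linarith
  -- `A |u|` is not small
  have f2 : 7 / 10 - A ≤ A * |(u : ℝ)| := by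
    have : |(w : ℝ)| ≤ |w - ε (k + 1) * A * u - η| + |ε (k + 1) * A * u| + |η| := by
      calc |(w : ℝ)| = |(w - ε (k + 1) * A * u - η) + ε (k + 1) * A * u + η| := by
            congr 1; ring
        _ ≤ _ := (abs_add_le _ _).trans (add_le_add_left (abs_add_le _ _) _)
    rw [hw1, abs_mul, abs_mul, ea, one_mul, abs_of_pos t0, abs_of_nonneg n0] at this
    linarith
  -- the second factor
  have f3 : 19 / 10 * A ≤ |w - ε (k + 1) * A * u - η| := by
    have hw3 : (3 : ℝ) ≤ |(w' : ℝ)| := by exact_mod_cast hw'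
    -- The constant comes from 3 - 2/3 - 3/7 > 19/10, with the bounds for `tail` and `eta` in the
    -- next cell.
    have key : ∀ u'' : ℝ, |u''| = 1 →
        19 / 10 ≤ |w' - ε (k + 2) * A' * u'' - η'| := by
      intro u'' hu''
      have ea' : |(ε (k + 2) : ℝ)| = 1 := by
        rcases h.sign (k + 2) (by omega) with e | e <;> simp [e]
      have : |(w' : ℝ)| ≤ |w' - ε (k + 2) * A' * u'' - η'| + |ε (k + 2) * A' * u''| + |η'| := by
        calc |(w' : ℝ)| = |(w' - ε (k + 2) * A' * u'' - η') + ε (k + 2) * A' * u'' + η'| := by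
              congr 1; ring
          _ ≤ _ := (abs_add_le _ _).trans (add_le_add_left (abs_add_le _ _) _)
      rw [abs_mul, abs_mul, ea', one_mul, hu'', mul_one, abs_of_pos t1', abs_of_nonneg n3] at this
      linarith
    rcases hn with ⟨he, -, hw2⟩ | ⟨ho, -, hw2⟩
    · have k1 := key (-w) (by rw [abs_neg]; exact hw1)
      have : (w : ℝ) - ε (k + 1) * A * u - η = A * (w' - ε (k + 2) * A' * -w - η') := by
        rw [show η = A * η' from h.eta_even he, hw2]
        push_cast
        linear_combination -(w : ℝ) * e3
      rw [this, abs_mul, abs_of_pos t0]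
      nlinarith
    · have k1 := key w hw1
      have : (w : ℝ) - ε (k + 1) * A * u - η = -(A * (w' - ε (k + 2) * A' * w - η')) := by
        rw [show η = A * (1 - η') from h.eta_odd ho, hw2]
        push_cast
        linear_combination -(w : ℝ) * e3
      rw [this, abs_neg, abs_mul, abs_of_pos t0]
      nlinarith
  have f4 : 11 / 24 * (|(u : ℝ)| + 1) ≤ |(u : ℝ)| - 7 / 6 := by linarith
  have f5 : 7 / 10 ≤ A * (|(u : ℝ)| + 1) := by linarith
  calc (1 / 4 : ℝ) ≤ (11 / 24 * (|(u : ℝ)| + 1)) * (19 / 10 * A) := by nlinarith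
    _ ≤ _ := mul_le_mul (f4.trans f1) f3 (by positivity) (abs_nonneg _)

lemma coord_succ (u w : ℤ) (k : ℕ) :
    (Even (a (k + 1)) ∧ (coord a ε u w (k + 1)).1 = -(coord a ε u w k).2 ∧
      (coord a ε u w (k + 1)).2 =
        -ε (k + 1) * (coord a ε u w k).1 + a (k + 1) * (coord a ε u w k).2) ∨
    (¬ Even (a (k + 1)) ∧ (coord a ε u w (k + 1)).1 = (coord a ε u w k).2 ∧
      (coord a ε u w (k + 1)).2 =
        ε (k + 1) * (coord a ε u w k).1 + 1 - a (k + 1) * (coord a ε u w k).2) := by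
  rw [coord]
  split_ifs with he
  · exact Or.inl ⟨he, rfl, rfl⟩
  · exact Or.inr ⟨he, rfl, rfl⟩

end IsAdjusted

lemma one_le_abs_of_odd {u : ℤ} (h : Odd u) : (1 : ℝ) ≤ |(u : ℝ)| := by
  have : u ≠ 0 := by rintro rfl; exact absurd h (by decide)
  exact_mod_cast Int.one_le_abs this

namespace IsAdjusted

variable {α : ℝ} {a ε : ℕ → ℤ}

/-- For a point on the axis the other cell distance |u|/q_k tends to 0, so in a late cell the point
is close to the intersection of the axes. By `abs_center_le` its first coordinate is then less than
1 in absolute value, which is impossible for an odd integer. -/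
lemma dist_ne_zero (h : IsAdjusted α a ε) {κ : ℝ} (hκ : 0 < κ) {K : ℕ}
    (hv : ∀ k, K ≤ k → VertexBound α a ε κ k) {u w : ℤ} (hu : Odd u) (hw : Odd w) :
    w - ε 1 * tail α a ε 0 * u - eta α a ε 0 ≠ 0 := by
  intro h0
  have ht : Tendsto (fun k => |(u : ℝ)| / den a ε k) atTop (𝓝 0) :=
    (tendsto_den h.sign h.two_le).const_div_atTop _
  obtain ⟨k, hk, hlt⟩ := ((eventually_ge_atTop K).and
    (ht.eventually (gt_mem_nhds (show 0 < κ / 6 by positivity)))).exists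
  obtain ⟨h1, h2⟩ := h.coord_abs u w k
  have hodd := one_le_abs_of_odd (h.coord_odd hu hw k).1
  set c := coord a ε u w k
  rw [h0, abs_zero, mul_eq_zero, abs_eq_zero] at h2
  have h3 := h2.resolve_left (h.gap_pos k).ne'
  have hx : |(c.1 + c.2 * back a ε k + xi a ε k : ℝ)| < κ / 6 := by
    rw [div_lt_iff₀ (h.den_pos k)] at hlt
    have hd := h.den_pos k
    by_contra hc
    rw [not_lt] at hc
    have := mul_le_mul_of_nonneg_left hc hd.le
    linarith
  have hc := h.abs_center_le hκ (hv k hk)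
  have hS := (h.cell_area_bounds k).1
  set S := 1 + ε (k + 1) * tail α a ε k * back a ε k with hSdef
  have e : (c.1 : ℝ) * S = (c.1 + c.2 * back a ε k + xi a ε k) -
      (back a ε k * eta α a ε k + xi a ε k) := by
    rw [hSdef]; linear_combination (-back a ε k) * h3
  have h4 : |(c.1 : ℝ)| * S < S := by
    have h5 := abs_sub ((c.1 : ℝ) + c.2 * back a ε k + xi a ε k)
      (back a ε k * eta α a ε k + xi a ε k)
    rw [← e, abs_mul, abs_of_pos (show 0 < S by linarith)] at h5
    linarith
  nlinarith

/-- If all cells from some point on satisfy the vertex bound, so do all points near the axis. -/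
lemma le_of_vertexBound (h : IsAdjusted α a ε) {κ : ℝ} (hκ : 0 < κ) (hκ' : κ ≤ 16 / 100) {K : ℕ}
    (hv : ∀ k, K ≤ k → VertexBound α a ε κ k) {u w : ℤ} (hu : Odd u) (hw : Odd w)
    (hlt : |w - ε 1 * tail α a ε 0 * u - eta α a ε 0| < 3 / 10 * gap α a ε K) :
    κ ≤ |(u : ℝ)| * |w - ε 1 * tail α a ε 0 * u - eta α a ε 0| := by
  have hY := abs_pos.2 (h.dist_ne_zero hκ hv hu hw)
  set Y := |w - ε 1 * tail α a ε 0 * u - eta α a ε 0| with hYdef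
  have hex : ∃ j, 3 / 10 * gap α a ε (K + j) ≤ Y := by
    have ht : Tendsto (fun j => 3 / 10 * gap α a ε (K + j)) atTop (𝓝 0) := by
      have := (h.tendsto_gap.comp (tendsto_add_atTop_nat K)).const_mul (3 / 10)
      simpa [Function.comp_def, add_comm] using this
    obtain ⟨j, hj⟩ := (ht.eventually (gt_mem_nhds hY)).exists
    exact ⟨j, hj.le⟩
  classical
  -- The cell is chosen by the size of Y: relative to the distances D, the point passes the
  -- threshold 3/10 between the cells k and k + 1.
  obtain ⟨k, hk, hk1, hk2⟩ : ∃ k, K ≤ k ∧ Y < 3 / 10 * gap α a ε k ∧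
      3 / 10 * gap α a ε (k + 1) ≤ Y := by
    have hf := Nat.find_spec hex
    have hm := fun m => Nat.find_min hex (m := m)
    rcases hn : Nat.find hex with _ | n
    · rw [hn] at hf; exact absurd hlt (not_lt.2 hf)
    · rw [hn] at hf
      exact ⟨K + n, by omega, not_le.1 (hm n (by omega)), hf⟩
  clear hex
  by_contra hcon
  rw [not_le] at hcon
  obtain ⟨x0, y0⟩ := h.coord_abs u w k
  obtain ⟨x1, y1⟩ := h.coord_abs u w (k + 1)
  obtain ⟨o1, o2⟩ := h.coord_odd hu hw k
  obtain ⟨o1', o2'⟩ := h.coord_odd hu hw (k + 1)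
  have hstep := coord_succ (a := a) (ε := ε) u w k
  have g0 := h.gap_pos k
  have g1 := h.gap_pos (k + 1)
  have hg := h.gap_succ' k
  have hvk := fun A B => h.le_of_vertex (hv k hk) (u := u) (w := w) A B
  have hvk' := fun A B => h.le_of_vertex (hv (k + 1) (by omega)) (u := u) (w := w) A B
  rw [← hYdef] at y0 y1 hvk hvk'
  set c := coord a ε u w k
  set c' := coord a ε u w (k + 1)
  set y := |(c.2 - ε (k + 1) * tail α a ε k * c.1 - eta α a ε k : ℝ)| with hy
  set y' := |(c'.2 - ε (k + 1 + 1) * tail α a ε (k + 1) * c'.1 - eta α a ε (k + 1) : ℝ)| with hy'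
  set x' := |(c'.1 + c'.2 * back a ε (k + 1) + xi a ε (k + 1) : ℝ)| with hx'
  have hyl : y < 3 / 10 := by
    by_contra hc
    rw [not_lt] at hc
    have := mul_le_mul_of_nonneg_left hc g0.le
    linarith
  have hyl' : 3 / 10 ≤ y' := by
    by_contra hc
    rw [not_le] at hc
    have := mul_lt_mul_of_pos_left hc g1
    linarith
  have hyy : tail α a ε k * y' = y := by
    rw [hg] at y1
    have : gap α a ε k * (tail α a ε k * y' - y) = 0 := by linear_combination y1 - y0
    have := (mul_eq_zero.1 this).resolve_left g0.ne'
    linarith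
  have hS := h.cell_area_bounds k
  have hS' := h.cell_area_bounds (k + 1)
  have hd := (h.den_mul_gap (k + 1)).1
  have hc := h.abs_center_le hκ (hv (k + 1) (by omega))
  have e1 := h.back_mul k
  have e3 := h.tail_mul k
  have b0 := h.back_pos k
  have t0 := h.tail_pos k
  have hSS : back a ε (k + 1) * (1 + ε (k + 1) * tail α a ε k * back a ε k) = tail α a ε k *
      (1 + ε (k + 1 + 1) * tail α a ε (k + 1) * back a ε (k + 1)) := by
    rw [show k + 1 + 1 = k + 2 by rfl]
    linear_combination tail α a ε k * e1 - back a ε (k + 1) * e3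
  set S := 1 + ε (k + 1) * tail α a ε k * back a ε k with hSd
  set S' := 1 + ε (k + 1 + 1) * tail α a ε (k + 1) * back a ε (k + 1) with hSd'
  set B' := back a ε (k + 1)
  set T := tail α a ε k
  have hxl : x' * (3 / 10) < 16 / 100 * S' := by
    have q0 := h.den_pos (k + 1)
    have hx0 : 0 ≤ x' := abs_nonneg _
    have hp : 0 < (den a ε (k + 1) : ℝ) * gap α a ε (k + 1) := mul_pos q0 g1
    have e5 : (den a ε (k + 1) : ℝ) * gap α a ε (k + 1) * (x' * y') = |(u : ℝ)| * Y := by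
      rw [← x1, ← y1]; ring
    have h6 : (den a ε (k + 1) : ℝ) * gap α a ε (k + 1) * (x' * y') <
        (den a ε (k + 1) : ℝ) * gap α a ε (k + 1) * (16 / 100 * S') := by
      rw [e5]
      calc |(u : ℝ)| * Y < κ := hcon
        _ ≤ 16 / 100 := hκ'
        _ = _ := by linear_combination (-(16 / 100 : ℝ)) * hd
    have h7 := lt_of_mul_lt_mul_left h6 hp.le
    exact (mul_le_mul_of_nonneg_left hyl' hx0).trans_lt h7
  have hBy : B' * y' * S < 3 / 10 * S' := by
    have : B' * y' * S = y * S' := by rw [← hyy]; linear_combination y' * hSS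
    rw [this]
    exact mul_lt_mul_of_pos_right hyl (by linarith)
  -- Relative to S', the three contributions are below 0.16/0.3, at most 0.54, and below 1; their
  -- sum stays below 3.
  have hu' : |(c'.1 : ℝ)| < 3 := by
    have e : (c'.1 : ℝ) * S' = (c'.1 + c'.2 * B' + xi a ε (k + 1)) -
      (B' * (c'.2 - ε (k + 1 + 1) * tail α a ε (k + 1) * c'.1 - eta α a ε (k + 1))) -
      (B' * eta α a ε (k + 1) + xi a ε (k + 1)) := by
      rw [hSd']; ring
    have h4 : |(c'.1 : ℝ)| * S' ≤ x' + B' * y' + (S' - κ / 6) := by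
      have h5 := abs_sub ((c'.1 : ℝ) + c'.2 * B' + xi a ε (k + 1) -
        (B' * (c'.2 - ε (k + 1 + 1) * tail α a ε (k + 1) * c'.1 - eta α a ε (k + 1))))
        (B' * eta α a ε (k + 1) + xi a ε (k + 1))
      have h6 := abs_sub ((c'.1 : ℝ) + c'.2 * B' + xi a ε (k + 1))
        (B' * (c'.2 - ε (k + 1 + 1) * tail α a ε (k + 1) * c'.1 - eta α a ε (k + 1)))
      rw [← e, abs_mul, abs_of_pos (show 0 < S' by linarith)] at h5
      rw [abs_mul B', abs_of_pos b0] at h6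
      linarith
    have hBy2 : B' * y' ≤ 54 / 100 * S' := by
      have h7 : 0 ≤ B' * y' := mul_nonneg b0.le (abs_nonneg _)
      have h8 := mul_le_mul_of_nonneg_left hS.1 h7
      linarith
    by_contra hc3
    rw [not_lt] at hc3
    have := mul_le_mul_of_nonneg_right hc3 (show 0 ≤ S' by linarith)
    linarith
  have hu1 : c'.1 = 1 ∨ c'.1 = -1 := by
    rcases odd_cases o1' with e | e | e
    · exact Or.inl e
    · exact Or.inr e
    · have : (3 : ℝ) ≤ |(c'.1 : ℝ)| := by exact_mod_cast e
      linarith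
  -- The second coordinate in cell k is, up to sign, the first coordinate in cell k + 1.
  have hw1 : c.2 = 1 ∨ c.2 = -1 := by
    rcases hstep with ⟨-, e, -⟩ | ⟨-, e, -⟩ <;> omega
  rcases odd_cases o1 with e | e | e
  · exact absurd hcon (not_lt.2 (hvk (Or.inl e) hw1))
  · exact absurd hcon (not_lt.2 (hvk (Or.inr e) hw1))
  rcases odd_cases o2' with e' | e' | e'
  · exact absurd hcon (not_lt.2 (hvk' hu1 (Or.inl e')))
  · exact absurd hcon (not_lt.2 (hvk' hu1 (Or.inr e')))
  have hbig := h.big_of_not_vertex hw1 e e' hstep hyl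
  rw [← hy] at hbig
  have hd0 := (h.den_mul_gap k).1
  have e5 : (den a ε k : ℝ) * gap α a ε k * (|(c.1 + c.2 * back a ε k + xi a ε k : ℝ)| * y)
      = |(u : ℝ)| * Y := by
    rw [← x0, ← y0]; ring
  have hp : 0 < (den a ε k : ℝ) * gap α a ε k := mul_pos (h.den_pos k) g0
  have h6 := mul_le_mul_of_nonneg_left hbig hp.le
  rw [e5] at h6
  have h7 : (den a ε k : ℝ) * gap α a ε k * (13 / 9) ≥ 1 := by
    rw [← hd0]; exact mul_le_mul_of_nonneg_left hS.2.1 hp.le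
  linarith

/-- The lower bound for `M`, and the irrationality of the target, follow from the vertex bounds. -/
theorem main_of_vertexBound (h : IsAdjusted α a ε) {C : ℝ} (hC : 0 < C) (hC' : C ≤ 4 / 100) {K : ℕ}
    (hv : ∀ k, K ≤ k → VertexBound α a ε (4 * C) k) :
    gammaStar α a ε ∉ lattice α ∧ (C : EReal) ≤ M α (gammaStar α a ε) := by
  have hα : (ε 1 : ℝ) * tail α a ε 0 = α - a 0 := by
    have e : (ε 1 : ℝ) * ε 1 = 1 := by exact_mod_cast mul_self_sign (h.sign 1 le_rfl)
    rw [tail]; linear_combination (α - a 0) * e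
  constructor
  · rintro ⟨m, n, hmn⟩
    rw [h.gammaStar_eq] at hmn
    refine h.dist_ne_zero (by positivity) hv (u := 2 * n - 1) (w := 1 - 2 * m - 2 * n * a 0)
      ⟨n - 1, by ring⟩ ⟨-m - n * a 0, by ring⟩ ?_
    rw [hα]
    push_cast
    linear_combination 2 * hmn
  · have hpt : ∀ n : ℤ, ∃ w : ℤ, Odd w ∧ 2 * distInt (n * α - gammaStar α a ε) =
        |(w : ℝ) - ε 1 * tail α a ε 0 * (2 * n - 1 : ℤ) - eta α a ε 0| := by
      intro n
      refine ⟨1 + 2 * round (n * α - gammaStar α a ε) - 2 * n * a 0,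
        ⟨round (n * α - gammaStar α a ε) - n * a 0, by ring⟩, ?_⟩
      rw [distInt, hα, ← abs_neg (_ - eta α a ε 0)]
      have : (2 : ℝ) = |2| := by norm_num
      nth_rewrite 1 [this]
      rw [← abs_mul]
      congr 1
      push_cast
      rw [h.gammaStar_eq]
      ring
    have hg := h.gap_pos K
    refine le_of_forall_lt fun c hc => ?_
    obtain ⟨r, hr1, hr2⟩ := EReal.lt_iff_exists_real_btwn.1 hc
    rw [EReal.coe_lt_coe_iff] at hr2
    refine hr1.trans_le (le_liminf_of_le (by isBoundedDefault) ?_)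
    -- all but finitely many `n` are large
    have hlarge : ∀ N : ℝ, ∀ᶠ n : ℤ in cofinite, N < |(n : ℝ)| := by
      intro N
      have hf : Set.Finite {n : ℤ | ¬ N < |(n : ℝ)|} := by
        refine (Set.finite_Icc (-⌈N⌉) ⌈N⌉).subset fun n hn => ?_
        simp only [Set.mem_ofPred_eq, not_lt] at hn
        have h1 : |(n : ℝ)| ≤ ⌈N⌉ := hn.trans (Int.le_ceil N)
        have h2 : |n| ≤ ⌈N⌉ := by exact_mod_cast h1
        exact abs_le.1 h2
      exact hf
    -- The first threshold settles the n whose distance from the target is not small. The second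
    -- absorbs the loss in replacing |2n - 1| by 2|n|, using the slack C - r.
    filter_upwards [hlarge (1 + 4 * C / (3 / 10 * gap α a ε K)),
      hlarge (1 + C / (C - r))] with n hn1 hn2
    rw [EReal.coe_le_coe_iff]
    obtain ⟨w, hw, hd⟩ := hpt n
    have hlb : |(2 * n - 1 : ℤ)| = |(2 * (n : ℝ) - 1)| := by push_cast; rfl
    have hn : 2 * |(n : ℝ)| - 1 ≤ |(2 * (n : ℝ) - 1)| ∧
        |(2 * (n : ℝ) - 1)| ≤ 2 * |(n : ℝ)| + 1 := by
      have := abs_sub_abs_le_abs_sub (2 * (n : ℝ)) 1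
      have := abs_sub (2 * (n : ℝ)) 1
      rw [abs_mul, abs_one, abs_two] at *
      constructor <;> linarith
    have hdn : 0 ≤ distInt (n * α - gammaStar α a ε) := abs_nonneg _
    set d := distInt (n * α - gammaStar α a ε)
    have hC1 : 0 < 4 * C / (3 / 10 * gap α a ε K) := by positivity
    have hmain : 4 * C ≤ |(2 * (n : ℝ) - 1)| * (2 * d) := by
      by_cases hlt : 2 * d < 3 / 10 * gap α a ε K
      · have := h.le_of_vertexBound (by positivity) (by linarith) hv (u := 2 * n - 1) (w := w)
          ⟨n - 1, by ring⟩ hw (by rw [← hd]; exact hlt)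
        rw [← hd] at this
        push_cast at this
        exact this
      · rw [not_lt] at hlt
        have h1 : 4 * C / (3 / 10 * gap α a ε K) ≤ |(2 * (n : ℝ) - 1)| := by linarith
        rw [div_le_iff₀ (by positivity)] at h1
        exact h1.trans (mul_le_mul_of_nonneg_left hlt (abs_nonneg _))
    have hr0 : 0 < C - r := by linarith
    have h1 : C < (|(n : ℝ)| - 1) * (C - r) := by
      rw [← div_lt_iff₀ hr0]; linarith
    have h0 : 0 < C / (C - r) := by positivity
    have h2 : 4 * C ≤ (2 * |(n : ℝ)| + 1) * (2 * d) :=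
      hmain.trans (mul_le_mul_of_nonneg_right hn.2 (by linarith))
    by_contra hcon
    rw [not_le] at hcon
    nlinarith

end IsAdjusted

/-! ### A branch and bound procedure for windows of partial quotients

A window is a list of pairs `(a, e)`, read outwards from a fixed position, where `e` is the sign
between the partial quotient `a` and the next one. What lies beyond the window is described by an
integer `m`: nothing is known for `m = 0`, and otherwise the next partial quotient is at least `m`
and has the parity of `m`. -/

/-- A point `(p / q, x / q)` of the plane, in homogeneous integral coordinates. -/
structure HPoint where
  q : ℤ
  p : ℤ
  x : ℤ

/-- The triangle that contains `(back, xi)` beyond a window. -/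
def leftTri (m : ℤ) : List HPoint :=
  if m = 0 then [⟨1, 0, 0⟩, ⟨3, 2, -3⟩, ⟨3, 2, 1⟩]
  else if m % 2 = 0 then [⟨1, 0, 0⟩, ⟨2 * m - 1, 2, -1⟩, ⟨2 * m - 1, 2, 1⟩]
  else [⟨1, 0, 0⟩, ⟨2 * m - 1, 2, -3⟩, ⟨2 * m - 1, 2, -1⟩]

/-- The triangle that contains `(tail, eta)` beyond a window. -/
def rightTri (m : ℤ) : List HPoint :=
  if m = 0 then [⟨1, 0, 0⟩, ⟨3, 2, 0⟩, ⟨3, 2, 2⟩]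
  else if m % 2 = 0 then [⟨1, 0, 0⟩, ⟨7 * (2 * m - 1), 14, 0⟩, ⟨7 * (2 * m - 1), 14, 6⟩]
  else [⟨1, 0, 0⟩, ⟨7 * (2 * m - 1), 14, 8⟩, ⟨7 * (2 * m - 1), 14, 14⟩]

/-- In homogeneous coordinates the recurrence for (`back`, `xi`) is linear, so a triangle is carried
to a triangle and it suffices to follow its corners. `rightStep` does the same for (`tail`, `eta`).
-/
def leftStep (d : ℤ × ℤ) (v : HPoint) : HPoint :=
  ⟨d.1 * v.q + d.2 * v.p, v.q, if d.1 % 2 = 0 then -(d.2 * v.x) else -(v.q - d.2 * v.x)⟩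

def rightStep (d : ℤ × ℤ) (v : HPoint) : HPoint :=
  ⟨d.1 * v.q + d.2 * v.p, v.q, if d.1 % 2 = 0 then v.x else v.q - v.x⟩

/-- The triangle that contains `(back, xi)` at the inner end of a window. -/
def leftHull (L : List (ℤ × ℤ)) (m : ℤ) : List HPoint :=
  match L with
  | [] => leftTri m
  | d :: L => (leftHull L m).map (leftStep d)

/-- The triangle that contains `(tail, eta)` at the inner end of a window. -/
def rightHull (R : List (ℤ × ℤ)) (m : ℤ) : List HPoint :=
  match R with
  | [] => rightTri m
  | d :: R => (rightHull R m).map (rightStep d)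

/-- Does the list of partial quotients, each preceded by a minus sign, start with `3, …, 3, 2`? -/
def threesTwo : List (ℤ × ℤ) → Bool
  | [] => false
  | d :: R => d.1 = 2 || (d.1 = 3 && d.2 = -1 && threesTwo R)

/-- A window that cannot occur, because of the first partial quotient on the right. -/
def illegalHere (L : List (ℤ × ℤ)) (m e : ℤ) (R : List (ℤ × ℤ)) (n : ℤ) : Bool :=
  match R with
  | [] => false
  | d :: R => d.1 = 2 && ((e = -1 && d.2 = -1) || (e = 1 && d.2 = -1 && threesTwo R) ||
      -- Conditions (ii) and (iii), multiplied by the product of the two continued fractions, fail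
      -- here by a margin of 1/1000 at all pairs of corners. The margin makes it irrelevant which of
      -- the two conditions is strict.
      (e + d.2 = 0 && (leftHull L m).all fun s => (rightHull R n).all fun t =>
        1000 * (e * (s.p * t.q - t.p * s.q) - s.p * t.p) + s.q * t.q ≤ 0))

/-- The conditions apply at every digit of the window, so its centre is moved outwards, one digit at
a time; `illegalRight` moves it the other way. -/
def illegalLeft (L : List (ℤ × ℤ)) (m e : ℤ) (R : List (ℤ × ℤ)) (n : ℤ) : Bool :=
  illegalHere L m e R n || match L with
  | [] => false
  | d :: L => illegalLeft L m d.2 ((d.1, e) :: R) n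

def illegalRight (L : List (ℤ × ℤ)) (m e : ℤ) (R : List (ℤ × ℤ)) (n : ℤ) : Bool :=
  match R with
  | [] => false
  | d :: R' => illegalHere L m e R n || illegalRight ((d.1, e) :: L) m d.2 R' n

/-- The three windows and vertices that come close to the bound; these are the same point. -/
def isCritical (L : List (ℤ × ℤ)) (e : ℤ) (R : List (ℤ × ℤ)) (v : ℤ × ℤ) : Bool :=
  match L, R with
  | (3, -1) :: (2, 1) :: (2, -1) :: (3, 1) :: _, (4, _) :: _ => e = -1 && v = (1, -1)
  | (2, 1) :: (2, -1) :: (3, 1) :: _, (3, -1) :: (4, _) :: _ => e = -1 && v = (-1, 1)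
  | (2, -1) :: (3, 1) :: _, (2, -1) :: (3, -1) :: (4, _) :: _ => e = 1 && v = (1, 1)
  | _, _ => false

def leftForm (v : ℤ × ℤ) (s : HPoint) : ℤ := s.q + v.1 * v.2 * s.p + v.1 * s.x

def rightForm (e : ℤ) (v : ℤ × ℤ) (t : HPoint) : ℤ := t.q - e * v.1 * v.2 * t.p - v.2 * t.x

/-- The vertex bound with the constant `0.15899` at the corners of two triangles. -/
def vertexCheck (l : List HPoint) (e : ℤ) (r : List HPoint) (v : ℤ × ℤ) : Bool :=
  l.all (fun s => 0 ≤ leftForm v s) && r.all (fun t => 0 ≤ rightForm e v t) &&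
    l.all fun s => r.all fun t =>
      15899 * (s.q * t.q + e * s.p * t.p) ≤ 100000 * (leftForm v s * rightForm e v t)

/-- The relative variation of a linear form on a triangle, as a fraction. -/
def spread (l : List HPoint) (f : HPoint → ℤ) : ℤ × ℤ :=
  let z := l.map fun s => 1000 * f s / s.q
  let b := z.foldr max 0
  let c := z.foldr min b
  (b - c, b + c)

/-- A window is discarded if it is illegal or if all remaining vertices pass. Otherwise it is
refined on the side where the linear form of the first failing vertex varies more. Refinement first
fixes the parity of the next digit (continuation 2 or 3), and then separates the smallest admissible
digit, with either sign behind it, from the larger digits of that parity. The choice of side affects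
only the size of the tree, not its validity. -/
def search : ℕ → List (ℤ × ℤ) → ℤ → ℤ → List (ℤ × ℤ) → ℤ → List (ℤ × ℤ) → Bool
  | 0, _, _, _, _, _, _ => false
  | fuel + 1, L, m, e, R, n, vs =>
    illegalLeft L m e R n || illegalRight L m e R n ||
    let l := leftHull L m
    let r := rightHull R n
    match vs.filter (fun v => !(isCritical L e R v || vertexCheck l e r v)) with
    | [] => true
    | v :: vs =>
      let sl := spread l (leftForm v)
      let sr := spread r (rightForm e v)
      if sr.1 * sl.2 ≤ sl.1 * sr.2 then
        if m = 0 then search fuel L 2 e R n (v :: vs) && search fuel L 3 e R n (v :: vs)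
        else search fuel (L ++ [(m, 1)]) 0 e R n (v :: vs) &&
          search fuel (L ++ [(m, -1)]) 0 e R n (v :: vs) &&
          search fuel L (m + 2) e R n (v :: vs)
      else
        if n = 0 then search fuel L m e R 2 (v :: vs) && search fuel L m e R 3 (v :: vs)
        else search fuel L m e (R ++ [(n, 1)]) 0 (v :: vs) &&
          search fuel L m e (R ++ [(n, -1)]) 0 (v :: vs) &&
          search fuel L m e R (n + 2) (v :: vs)

theorem search_neg : search 40 [] 0 (-1) [] 0 [(1, 1), (1, -1), (-1, 1), (-1, -1)] = true := by
  decide +kernel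

theorem search_pos : search 40 [] 0 1 [] 0 [(1, 1), (1, -1), (-1, 1), (-1, -1)] = true := by
  decide +kernel

/-! ### Soundness of the branch and bound procedure -/

/-- The convex cone generated by a list of points. -/
def InCone : List HPoint → ℝ → ℝ → ℝ → Prop
  | [], Q, P, X => Q = 0 ∧ P = 0 ∧ X = 0
  | v :: t, Q, P, X => ∃ c : ℝ, 0 ≤ c ∧ InCone t (Q - c * v.q) (P - c * v.p) (X - c * v.x)

lemma InCone.nonneg {A B C : ℝ} : ∀ {t : List HPoint} {Q P X : ℝ}, InCone t Q P X →
    (∀ v ∈ t, 0 ≤ A * v.q + B * v.p + C * v.x) → 0 ≤ A * Q + B * P + C * X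
  | [], Q, P, X, h, _ => by obtain ⟨h1, h2, h3⟩ := h; simp [h1, h2, h3]
  | v :: t, Q, P, X, h, hf => by
    obtain ⟨c, hc, h⟩ := h
    have h1 := h.nonneg (A := A) (B := B) (C := C) fun v hv => hf v (List.mem_cons_of_mem _ hv)
    have h2 := mul_nonneg hc (hf v List.mem_cons_self)
    linarith

lemma InCone.leftStep (d : ℤ × ℤ) : ∀ {t : List HPoint} {Q P X : ℝ}, InCone t Q P X →
    InCone (t.map (leftStep d)) (d.1 * Q + d.2 * P) Q
      (if d.1 % 2 = 0 then -(d.2 * X) else -(Q - d.2 * X))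
  | [], Q, P, X, h => by
    obtain ⟨h1, h2, h3⟩ := h
    simp [InCone, h1, h2, h3]
  | v :: t, Q, P, X, h => by
    obtain ⟨c, hc, h⟩ := h
    refine ⟨c, hc, ?_⟩
    convert h.leftStep d using 1
    · simp only [Inhom.leftStep]; push_cast; ring
    · simp only [Inhom.leftStep]
    · simp only [Inhom.leftStep]; split_ifs <;> push_cast <;> ring

lemma InCone.rightStep (d : ℤ × ℤ) : ∀ {t : List HPoint} {Q P X : ℝ}, InCone t Q P X →
    InCone (t.map (rightStep d)) (d.1 * Q + d.2 * P) Q (if d.1 % 2 = 0 then X else Q - X)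
  | [], Q, P, X, h => by
    obtain ⟨h1, h2, h3⟩ := h
    simp [InCone, h1, h2, h3]
  | v :: t, Q, P, X, h => by
    obtain ⟨c, hc, h⟩ := h
    refine ⟨c, hc, ?_⟩
    convert h.rightStep d using 1
    · simp only [Inhom.rightStep]; push_cast; ring
    · simp only [Inhom.rightStep]
    · simp only [Inhom.rightStep]; split_ifs <;> push_cast <;> ring

lemma inCone_triangle {q p y z : ℤ} {b x : ℝ} (hp : 0 < p) (hyz : y < z) (h1 : q * b ≤ p)
    (h2 : y * b ≤ p * x) (h3 : p * x ≤ z * b) :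
    InCone [⟨1, 0, 0⟩, ⟨q, p, y⟩, ⟨q, p, z⟩] 1 b x := by
  have hp' : (0 : ℝ) < p := by exact_mod_cast hp
  have hyz' : (0 : ℝ) < z - y := by rw [sub_pos]; exact_mod_cast hyz
  refine ⟨1 - q * b / p, ?_, (z * b / p - x) / (z - y), ?_, (x - y * b / p) / (z - y), ?_, ?_⟩
  · rw [sub_nonneg, div_le_one hp']; exact h1
  · refine div_nonneg ?_ hyz'.le
    rw [sub_nonneg, le_div_iff₀ hp']; linarith
  · refine div_nonneg ?_ hyz'.le
    rw [sub_nonneg, div_le_iff₀ hp']; linarith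
  · have := hp'.ne'
    have := hyz'.ne'
    refine ⟨?_, ?_, ?_⟩ <;> push_cast <;> field_simp <;> ring

/-- The window `L` with continuation `m` occurs to the left of position `k`. -/
def MatchL (a ε : ℕ → ℤ) : ℕ → List (ℤ × ℤ) → ℤ → Prop
  | k, [], m => m = 0 ∨ (2 ≤ m ∧ m ≤ a k ∧ a k % 2 = m % 2)
  | 0, _ :: _, _ => False
  | k + 1, d :: L, m => d = (a (k + 1), ε (k + 1)) ∧ MatchL a ε k L m

/-- The window `R` with continuation `n` occurs to the right of position `k`. -/
def MatchR (a ε : ℕ → ℤ) : ℕ → List (ℤ × ℤ) → ℤ → Prop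
  | k, [], n => n = 0 ∨ (2 ≤ n ∧ n ≤ a (k + 1) ∧ a (k + 1) % 2 = n % 2)
  | k, d :: R, n => d = (a (k + 1), ε (k + 2)) ∧ MatchR a ε (k + 1) R n

/-- The convex hull of a list of points. -/
def InHull (t : List HPoint) (b x : ℝ) : Prop := ∃ Q : ℝ, 0 < Q ∧ InCone t Q (Q * b) (Q * x)

/-- A form that is affine in each of the two points is nonnegative on a product of hulls once it is
so at pairs of corners. Both the vertex bound and the conditions (ii), (iii) have this shape after
clearing denominators. -/
lemma InHull.bilinear {l r : List HPoint} {b x α y : ℝ} (hl : InHull l b x) (hr : InHull r α y)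
    (c : Fin 3 → Fin 3 → ℝ)
    (h : ∀ s ∈ l, ∀ t ∈ r, 0 ≤ ∑ i, ∑ j, c i j * ![(s.q : ℝ), s.p, s.x] i *
      ![(t.q : ℝ), t.p, t.x] j) :
    0 ≤ ∑ i, ∑ j, c i j * ![1, b, x] i * ![1, α, y] j := by
  obtain ⟨Q, hQ, hl⟩ := hl
  obtain ⟨Q', hQ', hr⟩ := hr
  have key : 0 ≤ (∑ j, c 0 j * ![1, α, y] j) * Q + (∑ j, c 1 j * ![1, α, y] j) * (Q * b) +
      (∑ j, c 2 j * ![1, α, y] j) * (Q * x) := by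
    refine hl.nonneg fun s hs => ?_
    have := hr.nonneg (A := ∑ i, c i 0 * ![(s.q : ℝ), s.p, s.x] i)
      (B := ∑ i, c i 1 * ![(s.q : ℝ), s.p, s.x] i)
      (C := ∑ i, c i 2 * ![(s.q : ℝ), s.p, s.x] i) fun t ht => by
        have := h s hs t ht
        simp [Fin.sum_univ_three] at this ⊢
        linarith
    simp [Fin.sum_univ_three] at this ⊢
    refine le_of_mul_le_mul_left (a := Q') ?_ hQ'
    linarith
  simp [Fin.sum_univ_three] at key ⊢
  refine le_of_mul_le_mul_left (a := Q) ?_ hQ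
  linarith

namespace IsAdjusted

variable {α : ℝ} {a ε : ℕ → ℤ}

/-- The condition on the length keeps the end of the window at a positive index, where the a priori
bounds for `back` and `xi` in terms of a digit are available. -/
lemma hull_left (h : IsAdjusted α a ε) : ∀ {L : List (ℤ × ℤ)} {k : ℕ} {m : ℤ},
    MatchL a ε k L m → L.length < k → InHull (leftHull L m) (back a ε k) (xi a ε k)
  | [], k, m, hm, hk => by
    obtain ⟨k, rfl⟩ : ∃ j, k = j + 1 := ⟨k - 1, by simp at hk; omega⟩
    obtain ⟨h1, h2, h3⟩ := h.xi_bounds (k + 1)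
    have hb := h.back_le (k + 1)
    have hb0 := h.back_pos k
    refine ⟨1, one_pos, ?_⟩
    rw [one_mul, one_mul, leftHull, leftTri]
    rcases hm with rfl | ⟨hm0, hm1, hm2⟩
    · rw [if_pos rfl]
      exact inCone_triangle (by norm_num) (by norm_num) (by push_cast; linarith)
        (by push_cast; linarith) (by push_cast; linarith)
    · rw [if_neg (by omega)]
      have hmb : back a ε (k + 1) * (2 * m - 1) ≤ 2 := by
        refine le_trans ?_ (h.back_mul_le k)
        have : (m : ℝ) ≤ a (k + 1) := by exact_mod_cast hm1
        exact mul_le_mul_of_nonneg_left (by linarith) hb0.le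
      by_cases he : Even (a (k + 1))
      · rw [if_pos (by rw [← hm2]; exact Int.even_iff.1 he)]
        obtain ⟨h4, h5⟩ := abs_le.1 (h.xi_even_bounds he)
        exact inCone_triangle (by norm_num) (by norm_num) (by push_cast; linarith)
          (by push_cast; linarith) (by push_cast; linarith)
      · rw [if_neg (by rw [← hm2]; exact fun e => he (Int.even_iff.2 e))]
        obtain ⟨h4, h5⟩ := h.xi_odd_bounds he
        exact inCone_triangle (by norm_num) (by norm_num) (by push_cast; linarith)
          (by push_cast; linarith) (by push_cast; linarith)
  | d :: L, 0, m, hm, hk => by simp at hk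
  | d :: L, k + 1, m, hm, hk => by
    obtain ⟨rfl, hm⟩ := hm
    obtain ⟨Q, hQ, hc⟩ := h.hull_left hm (by simpa using hk)
    have e1 := h.back_mul k
    have b0 := h.back_pos k
    have hpos : 0 < (a (k + 1) : ℝ) + ε (k + 1) * back a ε k := by
      by_contra hn
      rw [not_lt] at hn
      nlinarith
    refine ⟨Q * (a (k + 1) + ε (k + 1) * back a ε k), by positivity, ?_⟩
    have := hc.leftStep (a (k + 1), ε (k + 1))
    rw [leftHull]
    convert this using 1
    · dsimp only; ring
    · linear_combination Q * e1
    · dsimp only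
      split_ifs with he
      · rw [xi_even (Int.even_iff.2 he)]
        linear_combination (-Q * ε (k + 1) * xi a ε k) * e1
      · rw [xi_odd (fun e => he (Int.even_iff.1 e))]
        linear_combination (-Q * (1 - ε (k + 1) * xi a ε k)) * e1

lemma hull_right (h : IsAdjusted α a ε) : ∀ {R : List (ℤ × ℤ)} {k : ℕ} {n : ℤ},
    MatchR a ε k R n → InHull (rightHull R n) (tail α a ε k) (eta α a ε k)
  | [], k, n, hm => by
    have h1 := h.eta_nonneg k
    have h2 := h.eta_le_tail k
    have hb := h.tail_le k
    have hb0 := h.tail_pos k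
    refine ⟨1, one_pos, ?_⟩
    rw [one_mul, one_mul, rightHull, rightTri]
    rcases hm with rfl | ⟨hm0, hm1, hm2⟩
    · rw [if_pos rfl]
      exact inCone_triangle (by norm_num) (by norm_num) (by push_cast; linarith)
        (by push_cast; linarith) (by push_cast; linarith)
    · rw [if_neg (by omega)]
      have hmb : tail α a ε k * (2 * n - 1) ≤ 2 := by
        refine le_trans ?_ (h.tail_mul_le k)
        have : (n : ℝ) ≤ a (k + 1) := by exact_mod_cast hm1
        exact mul_le_mul_of_nonneg_left (by linarith) hb0.le
      by_cases he : Even (a (k + 1))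
      · rw [if_pos (by rw [← hm2]; exact Int.even_iff.1 he)]
        have := h.eta_even_le he
        exact inCone_triangle (by norm_num) (by norm_num) (by push_cast; linarith)
          (by push_cast; linarith) (by push_cast; linarith)
      · rw [if_neg (by rw [← hm2]; exact fun e => he (Int.even_iff.2 e))]
        have := h.le_eta_odd he
        exact inCone_triangle (by norm_num) (by norm_num) (by push_cast; linarith)
          (by push_cast; linarith) (by push_cast; linarith)
  | d :: R, k, n, hm => by
    obtain ⟨rfl, hm⟩ := hm
    obtain ⟨Q, hQ, hc⟩ := h.hull_right hm
    have e1 := h.tail_mul k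
    have b0 := h.tail_pos k
    have hpos : 0 < (a (k + 1) : ℝ) + ε (k + 2) * tail α a ε (k + 1) := by
      by_contra hn
      rw [not_lt] at hn
      nlinarith
    refine ⟨Q * (a (k + 1) + ε (k + 2) * tail α a ε (k + 1)), by positivity, ?_⟩
    have := hc.rightStep (a (k + 1), ε (k + 2))
    rw [rightHull]
    convert this using 1
    · dsimp only; ring
    · linear_combination Q * e1
    · dsimp only
      split_ifs with he
      · rw [h.eta_even (Int.even_iff.2 he)]
        linear_combination (Q * eta α a ε (k + 1)) * e1
      · rw [h.eta_odd (fun e => he (Int.even_iff.1 e))]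
        linear_combination (Q * (1 - eta α a ε (k + 1))) * e1

lemma exists_block {R : List (ℤ × ℤ)} : ∀ {k : ℕ} {n : ℤ}, MatchR a ε k R n →
    threesTwo R = true → ε (k + 1) = -1 →
    ∃ j, (∀ i, k < i → i ≤ k + j → ε i * a i = -3) ∧ ε (k + j + 1) * a (k + j + 1) = -2 := by
  induction R with
  | nil => intro k n _ hb; simp [threesTwo] at hb
  | cons d R ih =>
    intro k n hm hb he
    obtain ⟨rfl, hm⟩ := hm
    simp only [threesTwo, Bool.or_eq_true, Bool.and_eq_true, decide_eq_true_eq] at hb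
    rcases hb with hb | ⟨⟨hb1, hb2⟩, hb3⟩
    · exact ⟨0, fun i _ _ => by omega, by rw [Nat.add_zero, he, hb]; rfl⟩
    · obtain ⟨j, hj1, hj2⟩ := ih hm hb3 hb2
      refine ⟨j + 1, fun i hi1 hi2 => ?_, ?_⟩
      · rcases eq_or_lt_of_le (Nat.succ_le_of_lt hi1) with rfl | hi
        · rw [he, hb1]; rfl
        · exact hj1 i hi (by omega)
      · rw [show k + (j + 1) + 1 = k + 1 + j + 1 by ring]; exact hj2

lemma not_illegalHere (h : IsAdjusted α a ε) {L R : List (ℤ × ℤ)} {k : ℕ} {m n : ℤ}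
    (hL : MatchL a ε k L m) (hR : MatchR a ε k R n) (hk : L.length < k) :
    illegalHere L m (ε (k + 1)) R n = false := by
  rw [← Bool.not_eq_true]
  intro hi
  rcases R with _ | ⟨d, R⟩
  · simp [illegalHere] at hi
  obtain ⟨rfl, hR⟩ := hR
  obtain ⟨k, rfl⟩ : ∃ j, k = j + 1 := ⟨k - 1, by omega⟩
  simp only [illegalHere, Bool.or_eq_true, Bool.and_eq_true, decide_eq_true_eq,
    List.all_eq_true] at hi
  rw [show k + 1 + 2 = k + 1 + 1 + 1 by rfl] at hi
  obtain ⟨h2, hi⟩ := hi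
  rcases hi with (⟨e1, e2⟩ | ⟨⟨e1, e2⟩, hb⟩) | ⟨e, hi⟩
  · rcases h.two_sign _ (by omega) h2 with e | e <;> omega
  · obtain ⟨j, hj1, hj2⟩ := exists_block hR hb e2
    exact h.no_block (k + 1 + 1) j (by omega) ⟨by rw [e1, h2]; rfl, hj1, hj2⟩
  · have key := (h.hull_left hL hk).bilinear (h.hull_right hR)
      ![![-1, 1000 * ε (k + 1 + 1), 0], ![-1000 * ε (k + 1 + 1), 1000, 0], 0] fun s hs t ht => by
        have := hi s hs t ht
        have h3 : (1000 * (ε (k + 1 + 1) * (s.p * t.q - t.p * s.q) - s.p * t.p) + s.q * t.q : ℝ)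
          ≤ 0 := by exact_mod_cast this
        simp [Fin.sum_univ_three]
        linarith
    simp [Fin.sum_univ_three] at key
    have b0 := h.back_pos k
    have t0 := h.tail_pos (k + 1 + 1)
    have q0 := mul_pos b0 t0
    rcases h.sign (k + 1 + 1) (by omega) with e1 | e1
    · have := h.neg_two (k + 1 + 1) (by omega) h2 (by omega)
      rw [show k + 1 + 1 - 1 = k + 1 by omega, div_sub_div _ _ t0.ne' b0.ne',
        lt_div_iff₀ (by positivity)] at this
      rw [e1] at key
      push_cast at key
      linarith
    · have := h.two_neg (k + 1 + 1) (by omega) h2 e1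
      rw [show k + 1 + 1 - 1 = k + 1 by omega, div_sub_div _ _ b0.ne' t0.ne',
        le_div_iff₀ (by positivity)] at this
      rw [e1] at key
      push_cast at key
      linarith

lemma not_illegalLeft (h : IsAdjusted α a ε) {n : ℤ} : ∀ {L R : List (ℤ × ℤ)} {k : ℕ} {m : ℤ},
    MatchL a ε k L m → MatchR a ε k R n → L.length < k →
    illegalLeft L m (ε (k + 1)) R n = false
  | [], R, k, m, hL, hR, hk => by rw [illegalLeft, h.not_illegalHere hL hR hk]; rfl
  | d :: L, R, 0, m, hL, hR, hk => by simp at hk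
  | d :: L, R, k + 1, m, hL, hR, hk => by
    rw [illegalLeft, h.not_illegalHere hL hR hk]
    obtain ⟨rfl, hL⟩ := hL
    exact h.not_illegalLeft (R := (a (k + 1), ε (k + 1 + 1)) :: R) hL ⟨rfl, hR⟩ (by simpa using hk)

lemma not_illegalRight (h : IsAdjusted α a ε) {m n : ℤ} : ∀ {R L : List (ℤ × ℤ)} {k : ℕ},
    MatchL a ε k L m → MatchR a ε k R n → L.length < k →
    illegalRight L m (ε (k + 1)) R n = false
  | [], L, k, hL, hR, hk => by rw [illegalRight]
  | d :: R, L, k, hL, hR, hk => by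
    rw [illegalRight, h.not_illegalHere hL hR hk]
    obtain ⟨rfl, hR⟩ := hR
    exact h.not_illegalRight (L := (a (k + 1), ε (k + 1)) :: L) ⟨rfl, hL⟩ hR (by simpa using hk)

end IsAdjusted

lemma MatchL.nil {a ε : ℕ → ℤ} (k : ℕ) : MatchL a ε k [] 0 := by
  cases k <;> exact Or.inl rfl

lemma MatchR.nil {a ε : ℕ → ℤ} (k : ℕ) : MatchR a ε k [] 0 := by
  rw [MatchR]; exact Or.inl rfl

lemma MatchL.snoc {a ε : ℕ → ℤ} {m : ℤ} (hs : ∀ i, 1 ≤ i → ε i = 1 ∨ ε i = -1) (hm : m ≠ 0) :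
    ∀ {L : List (ℤ × ℤ)} {k : ℕ}, MatchL a ε k L m → L.length < k →
    MatchL a ε k (L ++ [(m, 1)]) 0 ∨ MatchL a ε k (L ++ [(m, -1)]) 0 ∨ MatchL a ε k L (m + 2)
  | [], 0, _, hk => by simp at hk
  | [], k + 1, h, _ => by
    obtain ⟨h0, h1, h2⟩ := h.resolve_left hm
    rcases eq_or_ne (a (k + 1)) m with e | e
    · rcases hs (k + 1) (by omega) with s | s
      · left; rw [List.nil_append, ← e, ← s]; exact ⟨rfl, .nil _⟩
      · right; left; rw [List.nil_append, ← e, ← s]; exact ⟨rfl, .nil _⟩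
    · right; right; right; omega
  | d :: L, 0, _, hk => by simp at hk
  | d :: L, k + 1, h, hk => by
    rcases MatchL.snoc hs hm h.2 (by simpa using hk) with i | i | i
    · exact Or.inl ⟨h.1, i⟩
    · exact Or.inr (Or.inl ⟨h.1, i⟩)
    · exact Or.inr (Or.inr ⟨h.1, i⟩)

lemma MatchR.snoc {a ε : ℕ → ℤ} {m : ℤ} (hs : ∀ i, 1 ≤ i → ε i = 1 ∨ ε i = -1) (hm : m ≠ 0) :
    ∀ {R : List (ℤ × ℤ)} {k : ℕ}, MatchR a ε k R m →
    MatchR a ε k (R ++ [(m, 1)]) 0 ∨ MatchR a ε k (R ++ [(m, -1)]) 0 ∨ MatchR a ε k R (m + 2)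
  | [], k, h => by
    obtain ⟨h0, h1, h2⟩ := h.resolve_left hm
    rcases eq_or_ne (a (k + 1)) m with e | e
    · rcases hs (k + 2) (by omega) with s | s
      · left; rw [List.nil_append, ← e, ← s]; exact ⟨rfl, .nil _⟩
      · right; left; rw [List.nil_append, ← e, ← s]; exact ⟨rfl, .nil _⟩
    · right; right; right; omega
  | d :: R, k, h => by
    rcases MatchR.snoc hs hm h.2 with i | i | i
    · exact Or.inl ⟨h.1, i⟩
    · exact Or.inr (Or.inl ⟨h.1, i⟩)
    · exact Or.inr (Or.inr ⟨h.1, i⟩)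

lemma MatchL.two_or_three {a ε : ℕ → ℤ} (ha : ∀ i, 1 ≤ i → 2 ≤ a i) :
    ∀ {L : List (ℤ × ℤ)} {k : ℕ}, MatchL a ε k L 0 → L.length < k →
    MatchL a ε k L 2 ∨ MatchL a ε k L 3
  | [], 0, _, hk => by simp at hk
  | [], k + 1, h, _ => by
    have := ha (k + 1) (by omega)
    rcases Int.emod_two_eq_zero_or_one (a (k + 1)) with e | e
    · left; right; omega
    · right; right; omega
  | d :: L, 0, _, hk => by simp at hk
  | d :: L, k + 1, h, hk => by
    rcases MatchL.two_or_three ha h.2 (by simpa using hk) with i | i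
    · exact Or.inl ⟨h.1, i⟩
    · exact Or.inr ⟨h.1, i⟩

lemma MatchR.two_or_three {a ε : ℕ → ℤ} (ha : ∀ i, 1 ≤ i → 2 ≤ a i) :
    ∀ {R : List (ℤ × ℤ)} {k : ℕ}, MatchR a ε k R 0 → MatchR a ε k R 2 ∨ MatchR a ε k R 3
  | [], k, h => by
    have := ha (k + 1) (by omega)
    rcases Int.emod_two_eq_zero_or_one (a (k + 1)) with e | e
    · left; right; omega
    · right; right; omega
  | d :: R, k, h => by
    rcases MatchR.two_or_three ha h.2 with i | i
    · exact Or.inl ⟨h.1, i⟩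
    · exact Or.inr ⟨h.1, i⟩

/-- The vertex bound for the single vertex `v`. -/
def VertexBoundAt (α : ℝ) (a ε : ℕ → ℤ) (κ : ℝ) (k : ℕ) (v : ℤ × ℤ) : Prop :=
  0 ≤ 1 + v.1 * v.2 * back a ε k + v.1 * xi a ε k ∧
  0 ≤ 1 - ε (k + 1) * v.1 * v.2 * tail α a ε k - v.2 * eta α a ε k ∧
  κ * (1 + ε (k + 1) * tail α a ε k * back a ε k) ≤
    (1 + v.1 * v.2 * back a ε k + v.1 * xi a ε k) *
      (1 - ε (k + 1) * v.1 * v.2 * tail α a ε k - v.2 * eta α a ε k)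

/-- A window around the position `k` is one of the critical ones. -/
def Critical (a ε : ℕ → ℤ) (k : ℕ) (v : ℤ × ℤ) : Prop :=
  ∃ L R m n, L.length < k ∧ MatchL a ε k L m ∧ MatchR a ε k R n ∧
    isCritical L (ε (k + 1)) R v = true

lemma vertexBoundAt_of_check {α : ℝ} {a ε : ℕ → ℤ} {l r : List HPoint} {k : ℕ} {v : ℤ × ℤ}
    (hl : InHull l (back a ε k) (xi a ε k)) (hr : InHull r (tail α a ε k) (eta α a ε k))
    (hc : vertexCheck l (ε (k + 1)) r v = true) :
    VertexBoundAt α a ε (15899 / 100000) k v := by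
  simp only [vertexCheck, Bool.and_eq_true, List.all_eq_true, decide_eq_true_eq] at hc
  obtain ⟨⟨h1, h2⟩, h3⟩ := hc
  refine ⟨?_, ?_, ?_⟩
  · obtain ⟨Q, hQ, hl⟩ := hl
    have := hl.nonneg (A := 1) (B := v.1 * v.2) (C := v.1) fun s hs => by
      have : (0 : ℝ) ≤ (leftForm v s : ℤ) := by exact_mod_cast h1 s hs
      rw [leftForm] at this; push_cast at this; linarith
    refine le_of_mul_le_mul_left (a := Q) ?_ hQ
    linarith
  · obtain ⟨Q, hQ, hr⟩ := hr
    have := hr.nonneg (A := 1) (B := -ε (k + 1) * v.1 * v.2) (C := -v.2) fun s hs => by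
      have : (0 : ℝ) ≤ (rightForm (ε (k + 1)) v s : ℤ) := by exact_mod_cast h2 s hs
      rw [rightForm] at this; push_cast at this; linarith
    refine le_of_mul_le_mul_left (a := Q) ?_ hQ
    linarith
  · have key := hl.bilinear hr
      ![![100000 - 15899, 100000 * (-ε (k + 1) * v.1 * v.2), 100000 * (-v.2)],
        ![100000 * (v.1 * v.2), 100000 * (v.1 * v.2) * (-ε (k + 1) * v.1 * v.2) - 15899 * ε (k + 1),
          100000 * (v.1 * v.2) * (-v.2)],
        ![100000 * v.1, 100000 * v.1 * (-ε (k + 1) * v.1 * v.2), 100000 * v.1 * (-v.2)]]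
      fun s hs t ht => by
        have := h3 s hs t ht
        rw [leftForm, rightForm] at this
        have h4 : (15899 * (s.q * t.q + ε (k + 1) * s.p * t.p) : ℝ) ≤
          100000 * ((s.q + v.1 * v.2 * s.p + v.1 * s.x) *
            (t.q - ε (k + 1) * v.1 * v.2 * t.p - v.2 * t.x)) := by exact_mod_cast this
        simp [Fin.sum_univ_three]
        linarith
    simp [Fin.sum_univ_three] at key
    linarith

namespace IsAdjusted

variable {α : ℝ} {a ε : ℕ → ℤ}

/-- Each refinement uses one unit of fuel and lengthens the left part by at most one digit. The
condition on k therefore ensures that the window never reaches the start of the expansion. -/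
theorem search_sound (h : IsAdjusted α a ε) : ∀ (fuel : ℕ) {L R : List (ℤ × ℤ)} {m n : ℤ}
    {vs : List (ℤ × ℤ)} {k : ℕ}, search fuel L m (ε (k + 1)) R n vs = true →
    MatchL a ε k L m → MatchR a ε k R n → L.length + fuel < k → ∀ v ∈ vs,
    VertexBoundAt α a ε (15899 / 100000) k v ∨ Critical a ε k v
  | 0, L, R, m, n, vs, k, hs, _, _, _ => by simp [search] at hs
  | fuel + 1, L, R, m, n, vs, k, hs, hL, hR, hk => by
    intro v hv
    rw [search, h.not_illegalLeft hL hR (by omega), h.not_illegalRight hL hR (by omega),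
      Bool.false_or, Bool.false_or] at hs
    by_cases hgood : (isCritical L (ε (k + 1)) R v ||
        vertexCheck (leftHull L m) (ε (k + 1)) (rightHull R n) v) = true
    · rcases Bool.or_eq_true _ _ ▸ hgood with hc | hc
      · exact Or.inr ⟨L, R, m, n, by omega, hL, hR, hc⟩
      · exact Or.inl (vertexBoundAt_of_check (h.hull_left hL (by omega)) (h.hull_right hR) hc)
    · have hv' : v ∈ vs.filter (fun v => !(isCritical L (ε (k + 1)) R v ||
          vertexCheck (leftHull L m) (ε (k + 1)) (rightHull R n) v)) := by
        rw [List.mem_filter]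
        exact ⟨hv, by simpa using hgood⟩
      dsimp only at hs
      generalize vs.filter (fun v => !(isCritical L (ε (k + 1)) R v ||
          vertexCheck (leftHull L m) (ε (k + 1)) (rightHull R n) v)) = vs' at hs hv'
      rcases vs' with _ | ⟨v', vs'⟩
      · simp at hv'
      dsimp only at hs
      split_ifs at hs with c1 c2 c2 <;> simp only [Bool.and_eq_true] at hs
      · subst c2
        rcases hL.two_or_three h.two_le (by omega) with hL | hL
        · exact h.search_sound fuel hs.1 hL hR (by omega) v hv'
        · exact h.search_sound fuel hs.2 hL hR (by omega) v hv'
      · rcases hL.snoc h.sign c2 (by omega) with hL | hL | hL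
        · exact h.search_sound fuel hs.1.1 hL hR (by simp; omega) v hv'
        · exact h.search_sound fuel hs.1.2 hL hR (by simp; omega) v hv'
        · exact h.search_sound fuel hs.2 hL hR (by omega) v hv'
      · subst c2
        rcases hR.two_or_three h.two_le with hR | hR
        · exact h.search_sound fuel hs.1 hL hR (by omega) v hv'
        · exact h.search_sound fuel hs.2 hL hR (by omega) v hv'
      · rcases hR.snoc h.sign c2 with hR | hR | hR
        · exact h.search_sound fuel hs.1.1 hL hR (by omega) v hv'
        · exact h.search_sound fuel hs.1.2 hL hR (by omega) v hv'
        · exact h.search_sound fuel hs.2 hL hR (by omega) v hv'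

/-- Every vertex of a late cell satisfies the bound, unless the window is critical. -/
theorem vertexBoundAt_or_critical (h : IsAdjusted α a ε) {k : ℕ} (hk : 40 < k) {u w : ℤ}
    (hu : u = 1 ∨ u = -1) (hw : w = 1 ∨ w = -1) :
    VertexBoundAt α a ε (15899 / 100000) k (u, w) ∨ Critical a ε k (u, w) := by
  have hmem : (u, w) ∈ [((1 : ℤ), (1 : ℤ)), (1, -1), (-1, 1), (-1, -1)] := by
    rcases hu with rfl | rfl <;> rcases hw with rfl | rfl <;> simp
  rcases h.sign (k + 1) (by omega) with e | e
  · exact h.search_sound 40 (by rw [e]; exact search_pos) (.nil _)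
      (.nil _) (by simpa using hk) _ hmem
  · exact h.search_sound 40 (by rw [e]; exact search_neg) (.nil _)
      (.nil _) (by simpa using hk) _ hmem

end IsAdjusted

/-! ### The constants of the critical configuration -/

lemma sqrt_ten_bounds : 3.1622776 < √10 ∧ √10 < 3.1622777 := by
  constructor
  · rw [Real.lt_sqrt (by norm_num)]; norm_num
  · rw [Real.sqrt_lt' (by norm_num)]; norm_num

lemma sqrt_thirteen_bounds : 3.6055512 < √13 ∧ √13 < 3.6055513 := by
  constructor
  · rw [Real.lt_sqrt (by norm_num)]; norm_num
  · rw [Real.sqrt_lt' (by norm_num)]; norm_num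

lemma bound_den_pos : 0 < 31 - 2 * √10 - 3 * √13 := by
  have := sqrt_ten_bounds
  have := sqrt_thirteen_bounds
  linarith

lemma bound_pos : 0 < bound := by
  have := sqrt_ten_bounds
  have := sqrt_thirteen_bounds
  exact div_pos (mul_pos (by linarith) (by linarith)) bound_den_pos

lemma one_div_bound : 25.159 ≤ 1 / bound ∧ 1 / bound < 25.160 := by
  obtain ⟨r1, r2⟩ := sqrt_ten_bounds
  obtain ⟨s1, s2⟩ := sqrt_thirteen_bounds
  have hn : 0 < (√10 - 3) * (7 - √13) := mul_pos (by linarith) (by linarith)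
  rw [bound, one_div_div]
  constructor
  · rw [le_div_iff₀ hn]; nlinarith
  · rw [div_lt_iff₀ hn]; nlinarith

lemma bound_le : bound ≤ 15899 / 400000 := by
  obtain ⟨r1, r2⟩ := sqrt_ten_bounds
  obtain ⟨s1, s2⟩ := sqrt_thirteen_bounds
  rw [bound, div_le_iff₀ bound_den_pos]
  nlinarith

/-- The fixed point of the expansion `[0; 4, -2, 2, 2, -4, -2, 2, 2, …]`. -/
def critTail : ℝ := (4 - √10) / 3

lemma critTail_bounds : 0.27924 < critTail ∧ critTail < 0.279242 := by
  obtain ⟨r1, r2⟩ := sqrt_ten_bounds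
  constructor <;> rw [critTail] <;> linarith

/-- The extreme value of the left part of the critical product. -/
def critSlope : ℝ := 4 * bound / (1 - critTail)

lemma critSlope_mul : critSlope * (1 - critTail) = 4 * bound := by
  have := critTail_bounds
  rw [critSlope, div_mul_cancel₀ _ (by linarith)]

/-- `lineA` and `lineB` are chosen so that -x ≤ lineA + lineB·b is the condition 7 + 3b + x ≥
critSlope·(34 - 13·critTail + (13 - 5·critTail)·b), which is what `critical_product` needs of the
left side. -/
def lineA : ℝ := 7 - critSlope * (34 - 13 * critTail)

def lineB : ℝ := 3 - critSlope * (13 - 5 * critTail)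

/-- The fixed point of the expansion `[0; 3, 3, …]`. -/
def critBack : ℝ := (√13 - 3) / 2

lemma critSlope_mul_den : critSlope * ((31 - 2 * √10 - 3 * √13) * (√10 - 1)) =
    12 * ((√10 - 3) * (7 - √13)) := by
  have h1 := critSlope_mul
  have h2 : bound * (31 - 2 * √10 - 3 * √13) = (√10 - 3) * (7 - √13) := by
    rw [bound, div_mul_cancel₀ _ bound_den_pos.ne']
  rw [critTail] at h1
  linear_combination 3 * (31 - 2 * √10 - 3 * √13) * h1 + 12 * h2

/-- The line passes through the point belonging to 3, 3, 3, …, with b = critBack and -x = (√13 -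
1)/6. This incidence is the relation that determines `bound`. -/
lemma line_eq : lineA + lineB * critBack = (√13 - 1) / 6 := by
  have hr : √10 ^ 2 = 10 := Real.sq_sqrt (by norm_num)
  have hs : √13 ^ 2 = 13 := Real.sq_sqrt (by norm_num)
  have h2 : √10 - 1 ≠ 0 := by have := sqrt_ten_bounds; linarith
  have h := critSlope_mul_den
  rw [lineA, lineB, critTail, critBack]
  generalize critSlope = t at *
  generalize hR : √10 = r at *
  generalize hS : √13 = s at *
  have h1 : (31 - 2 * r - 3 * s) ≠ 0 := by
    have := bound_den_pos.ne'
    rwa [hR, hS] at this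
  refine mul_left_cancel₀ (mul_ne_zero h1 h2) ?_
  linear_combination (-(43 + 11 * r + 19 * s + 5 * r * s) / 6) * h -
    (956 + 304 * s - 60 * s ^ 2) / 6 * hr - (60 - 24 * r) / 6 * hs

lemma critSlope_bounds : 0.22058 < critSlope ∧ critSlope < 0.220586 := by
  have h1 := critSlope_mul_den
  obtain ⟨r1, r2⟩ := sqrt_ten_bounds
  obtain ⟨s1, s2⟩ := sqrt_thirteen_bounds
  have d1 : 29.9665 < (31 - 2 * √10 - 3 * √13) * (√10 - 1) := by nlinarith
  have d2 : (31 - 2 * √10 - 3 * √13) * (√10 - 1) < 29.9666 := by nlinarith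
  have n1 : 0.550842 < (√10 - 3) * (7 - √13) := by nlinarith
  have n2 : (√10 - 3) * (7 - √13) < 0.550844 := by nlinarith
  constructor <;> nlinarith

lemma line_bounds : 0.3008 < lineA ∧ lineA < 0.3011 ∧ 0.4403 < lineB ∧ lineB < 0.4405 := by
  obtain ⟨h1, h2⟩ := critSlope_bounds
  obtain ⟨h3, h4⟩ := critTail_bounds
  rw [lineA, lineB]
  refine ⟨?_, ?_, ?_, ?_⟩ <;> nlinarith

lemma critBack_eq : critBack * (3 + critBack) = 1 := by
  have hs : √13 ^ 2 = 13 := Real.sq_sqrt (by norm_num)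
  rw [critBack]; linear_combination hs / 4

/-- Under a digit 3, the second line of `BeforeThree` pulls back to -x = 10·lineA + 3·lineB - 4 +
(3·lineA + lineB - 1)·b. This identity says that the pulled-back line meets the first line at b =
critBack; `line_eq_two` says that it meets the second line there too. -/
lemma line_eq_one : 9 * lineA + 3 * lineB - 4 = (1 - 3 * lineA) * critBack := by
  have hs : √13 ^ 2 = 13 := Real.sq_sqrt (by norm_num)
  have h1 := line_eq
  have h2 := critBack_eq
  have h3 : critBack = (√13 - 3) / 2 := rfl
  have e : (9 + 3 * critBack) * (lineA + lineB * critBack) =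
      (9 + 3 * critBack) * ((√13 - 1) / 6) := by
    rw [h1]
  have e2 : (9 + 3 * critBack) * ((√13 - 1) / 6) = 4 + critBack := by
    rw [h3]; linear_combination hs / 4
  linear_combination e + e2 - 3 * lineB * h2

lemma critBack_bounds : 0.3027 < critBack ∧ critBack < 0.3028 := by
  obtain ⟨s1, s2⟩ := sqrt_thirteen_bounds
  constructor <;> rw [critBack] <;> linarith

lemma line_eq_two : 7 * lineA + 2 * lineB - 3 = (1 - 2 * lineA - lineB) * critBack := by
  have h1 := line_eq
  have h2 := critBack_eq
  have h3 : √13 = 2 * critBack + 3 := by rw [critBack]; ring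
  rw [h3] at h1
  have h4 : critBack ≠ 0 := by have := critBack_bounds; linarith
  refine mul_left_cancel₀ h4 ?_
  linear_combination (2 + critBack) * h1 + (2 * lineA - 2 / 3) * h2

/-! ### The left side of the critical vertex: what can precede a digit 3 -/

namespace IsAdjusted
variable {α : ℝ} {a ε : ℕ → ℤ}

/-- Bounds for `xi` in front of a partial quotient `+3`. -/
def BeforeThree (b x : ℝ) : Prop :=
  -x ≤ lineA + lineB * b ∧ -x ≤ 3 * lineA + lineB - 1 + lineA * b

lemma beforeThree_of_even {b x : ℝ} (hb : 0 ≤ b) (hb' : b ≤ 2 / 3) (hx : |x| ≤ b / 2) :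
    BeforeThree b x := by
  obtain ⟨h1, h2, h3, h4⟩ := line_bounds
  have := (abs_le.1 hx).1
  constructor <;> nlinarith

lemma beforeThree_of_five {b x : ℝ} (hb : 0 ≤ b) (hb' : b ≤ 2 / 9) (hx : -(3 / 2 * b) ≤ x) :
    BeforeThree b x := by
  obtain ⟨h1, h2, h3, h4⟩ := line_bounds
  constructor <;> nlinarith

/-- The second inequality is the pullback of the first under a digit 3, so the first one for the
image is immediate. The pullback of the second passes through the common point of both lines and
lies above the first line for b ≤ critBack and above the second for b ≥ critBack. -/
lemma BeforeThree.step {b x : ℝ} (h : BeforeThree b x) {b' x' : ℝ} (hb : b' * (3 + b) = 1)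
    (hb' : 0 ≤ b') (hx : x' = -(b' * (1 - x))) : BeforeThree b' x' := by
  obtain ⟨h1, h2, h3, h4⟩ := line_bounds
  have e1 := line_eq_one
  have e2 := line_eq_two
  obtain ⟨l1, l2⟩ := h
  rw [hx]
  constructor
  · nlinarith [mul_le_mul_of_nonneg_left l2 hb']
  · have : -x ≤ 10 * lineA + 3 * lineB - 4 + (3 * lineA + lineB - 1) * b := by
      rcases le_total b critBack with hc | hc
      · nlinarith
      · nlinarith
    nlinarith [mul_le_mul_of_nonneg_left this hb']

lemma beforeThree_of_neg {b x : ℝ} {b' x' : ℝ} (h : x ≤ 0.32 - 0.35 * b) (hb0 : 0 ≤ b)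
    (hb : b' * (3 - b) = 1) (hb' : 0 ≤ b') (hx : x' = -(b' * (1 + x))) : BeforeThree b' x' := by
  obtain ⟨h1, h2, h3, h4⟩ := line_bounds
  rw [hx]
  constructor
  · have : x ≤ 3 * lineA + lineB - 1 - lineA * b := by nlinarith
    nlinarith [mul_le_mul_of_nonneg_left this hb']
  · have : x ≤ 10 * lineA + 3 * lineB - 4 - (3 * lineA + lineB - 1) * b := by nlinarith
    nlinarith [mul_le_mul_of_nonneg_left this hb']

/-- The delicate case is a digit 2 before the -3, where ξ ≤ back/2 is too weak. There condition
(iii) bounds the reversed expansion so strongly that the preceding digit must also be 2, and then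
`back` and |ξ| are both smaller than in general. -/
lemma xi_le_of_neg_three (h : IsAdjusted α a ε) {m : ℕ} (h1 : a (m + 1) = 3) (h2 : ε (m + 1) = -1)
    (h3 : a (m + 2) = 3) (h4 : ε (m + 2) = 1) : xi a ε m ≤ 0.32 - 0.35 * back a ε m := by
  rcases m with _ | n
  · norm_num [xi, back]
  have hb0 := h.back_nonneg (n + 1)
  by_cases he : Even (a (n + 1))
  · have hx := (abs_le.1 (h.xi_even_bounds he)).2
    rcases eq_or_lt_of_le (h.two_le (n + 1) (by omega)) with h5 | h5
    · rcases n with _ | p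
      · have := h.first h5.symm
        have h2' : ε 2 = -1 := h2
        omega
      have e1 : ε (p + 2) = 1 := by
        rcases h.two_sign (p + 2) (by omega) h5.symm with h6 | h6
        · exact h6
        · rw [h2] at h6; omega
      have hn := h.neg_two (p + 2) (by omega) h5.symm h2
      have ht := h.tail_mul (p + 2)
      have ht' := h.tail_mul_le (p + 3)
      rw [h1, h4] at ht
      rw [h3] at ht'
      push_cast at ht ht'
      have hp := h.tail_pos (p + 2)
      have e2 : 1 / tail α a ε (p + 2) = 3 + tail α a ε (p + 3) := by
        rw [div_eq_iff hp.ne']; linarith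
      rw [e2, show p + 2 - 1 = p + 1 from rfl] at hn
      have hbp := h.back_pos p
      have hlt : 1 / back a ε (p + 1) < 2.4 := by linarith
      rw [div_lt_iff₀ hbp] at hlt
      have ha : a (p + 1) = 2 := by
        have := h.back_mul_le p
        have h7 := h.two_le (p + 1) (by omega)
        by_contra hne
        have h8 : (3 : ℝ) ≤ a (p + 1) := by exact_mod_cast (by omega : 3 ≤ a (p + 1))
        -- A digit ≥ 3 would give back ≤ 2/5, and 2.4 · 2/5 < 1.
        nlinarith
      have hxp : |xi a ε (p + 1)| ≤ 1 / 3 := by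
        have := h.xi_even_bounds (k := p) (by rw [ha]; decide)
        have := h.back_le (p + 1)
        linarith
      have hb := h.back_mul (p + 1)
      have hbn := h.back_pos (p + 1)
      rw [show p + 1 + 1 = p + 2 from rfl] at *
      rw [← h5, e1] at hb
      push_cast at hb
      have hxx : xi a ε (p + 2) = -(back a ε (p + 2) * xi a ε (p + 1)) := by
        rw [xi_even (k := p + 1) he, e1]; push_cast; ring
      rw [hxx]
      have := (abs_le.1 hxp).1
      have : back a ε (p + 2) ≤ 0.414 := by nlinarith
      nlinarith
    · have h4' : (4 : ℝ) ≤ a (n + 1) := by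
        have : 4 ≤ a (n + 1) := by
          obtain ⟨t, ht⟩ := he
          omega
        exact_mod_cast this
      have := h.back_mul_le n
      have : back a ε (n + 1) ≤ 2 / 7 := by nlinarith
      linarith
  · have h1 := h.xi_odd_bounds he
    have := h.back_le (n + 1)
    linarith [h1.1, h1.2]

/-- Along a run of digits +3 the region is preserved; every other predecessor lands in it directly
by the bounds on `xi`. -/
lemma beforeThree (h : IsAdjusted α a ε) : ∀ k, a (k + 1) = 3 → ε (k + 1) = 1 →
    BeforeThree (back a ε k) (xi a ε k) := by
  intro k
  induction k with
  | zero =>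
    intro _ _
    exact beforeThree_of_even (by simp [back]) (by norm_num [back]) (by simp [xi, back])
  | succ k ih =>
    intro h1 h2
    have hb := h.back_pos k
    by_cases he : Even (a (k + 1))
    · exact beforeThree_of_even hb.le (h.back_le _) (h.xi_even_bounds he)
    have h3 := h.three_le_of_odd (by omega) he
    have hm := h.back_mul k
    have hx := xi_odd (ε := ε) he
    by_cases h4 : a (k + 1) = 3
    · rw [h4] at hm
      rcases h.sign (k + 1) (by omega) with h5 | h5
      · rw [h5] at hm hx
        push_cast at hm hx
        exact (ih h4 h5).step (by linarith) hb.le (by rw [hx]; ring)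
      · rw [h5] at hm hx
        push_cast at hm hx
        exact beforeThree_of_neg (h.xi_le_of_neg_three h4 h5 h1 h2) (h.back_nonneg k)
          (by linarith) hb.le (by rw [hx]; ring)
    · have h5 : (5 : ℝ) ≤ a (k + 1) := by
        have : 5 ≤ a (k + 1) := by
          rw [Int.not_even_iff_odd] at he
          obtain ⟨t, ht⟩ := he
          omega
        exact_mod_cast this
      have := h.back_mul_le k
      exact beforeThree_of_five hb.le (by nlinarith) (h.xi_bounds (k + 1)).2.2

end IsAdjusted

/-! ### The right side of the critical vertex: the loop -4, -2, 2, 2 -/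

/-- Two continued fractions with the same leading digit satisfy α - β = ∓αβ(α' - β'), with α', β'
the next tails. Four such steps, compared with the periodic expansion, give the product of all the
tails as the contraction factor; the two plus and the two minus signs cancel. -/
lemma critTail_loop {α α₁ α₂ α₃ α₄ : ℝ} (h0 : α * (4 - α₁) = 1) (h1 : α₁ * (2 + α₂) = 1)
    (h2 : α₂ * (2 + α₃) = 1) (h3 : α₃ * (2 - α₄) = 1) :
    α - critTail = α * α₁ * α₂ * α₃ * (critTail * ((4 - √10) / 2) * ((√10 - 2) / 3) *
      ((√10 - 2) / 2)) * (α₄ - critTail) := by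
  have hr : √10 ^ 2 = 10 := Real.sq_sqrt (by norm_num)
  have k0 : critTail * (4 - (4 - √10) / 2) = 1 := by rw [critTail]; linear_combination -hr / 6
  have k1 : (4 - √10) / 2 * (2 + (√10 - 2) / 3) = 1 := by linear_combination -hr / 6
  have k2 : (√10 - 2) / 3 * (2 + (√10 - 2) / 2) = 1 := by linear_combination hr / 6
  have k3 : (√10 - 2) / 2 * (2 - critTail) = 1 := by rw [critTail]; linear_combination hr / 6
  generalize critTail = β at *
  generalize (4 - √10) / 2 = β₁ at *
  generalize (√10 - 2) / 3 = β₂ at *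
  generalize (√10 - 2) / 2 = β₃ at *
  have e3 : α₃ - β₃ = α₃ * β₃ * (α₄ - β) := by linear_combination β₃ * h3 - α₃ * k3
  have e2 : β₂ - α₂ = α₂ * β₂ * (α₃ - β₃) := by linear_combination α₂ * k2 - β₂ * h2
  have e1 : α₁ - β₁ = α₁ * β₁ * (β₂ - α₂) := by linear_combination β₁ * h1 - α₁ * k1
  have e0 : α - β = α * β * (α₁ - β₁) := by linear_combination β * h0 - α * k0
  rw [e0, e1, e2, e3]; ring

lemma lt_of_mul_eq_one {x d : ℝ} (h : x * d = 1) (hx : 0 < x) (v u : ℝ) (hd : d < u)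
    (hv : v * u ≤ 1) : v < x := by
  have hd0 : 0 < d := by by_contra hc; nlinarith
  by_contra hc
  nlinarith

lemma gt_of_mul_eq_one {x d : ℝ} (h : x * d = 1) (hx : 0 < x) (v u : ℝ) (hd : u < d)
    (hu : 0 < u) (hv : 1 ≤ v * u) : x < v := by
  by_contra hc
  nlinarith

lemma den_lt_of_mul_eq_one {x d : ℝ} (h : x * d = 1) (u v : ℝ) (hv : v < x) (hv0 : 0 < v)
    (hu : 1 ≤ v * u) : d < u := by
  have hu0 : 0 < u := by by_contra hc; nlinarith
  by_contra hc
  nlinarith [mul_lt_mul_of_pos_right hv hu0]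

lemma lt_den_of_mul_eq_one {x d : ℝ} (h : x * d = 1) (hx : 0 < x) (u v : ℝ) (hv : x < v)
    (hu : v * u ≤ 1) : u < d := by
  have hd0 : 0 < d := by by_contra hc; nlinarith
  by_contra hc
  nlinarith [mul_lt_mul_of_pos_right hv hd0]

lemma ten_mul_le_of_contraction {Q P e y s : ℝ} (q0 : 0 < Q) (hQ : Q ≤ 1) (hP0 : 0 ≤ P)
    (hP1 : P ≤ 0.1) (hy : 0 ≤ y) (hs : s = Q * P * e - Q * y) (hpos : 0 < s) :
    10 * s ≤ e - y := by
  have l1 : 0 < P * e - y := by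
    have : 0 < Q * (P * e - y) := by linarith
    exact (mul_pos_iff_of_pos_left q0).1 this
  have l2 : s ≤ P * e - y := by nlinarith
  have e0 : 0 ≤ e := by
    by_contra hc
    nlinarith
  have l3 : P * e ≤ 0.1 * e := mul_le_mul_of_nonneg_right hP1 e0
  linarith

lemma critTail_prod : 0 ≤ critTail * ((4 - √10) / 2) * ((√10 - 2) / 3) * ((√10 - 2) / 2) ∧
    critTail * ((4 - √10) / 2) * ((√10 - 2) / 3) * ((√10 - 2) / 2) ≤ 0.1 := by
  obtain ⟨s1, s2⟩ := sqrt_ten_bounds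
  have h0 := critTail_bounds
  refine ⟨mul_nonneg (mul_nonneg (mul_nonneg ?_ ?_) ?_) ?_, ?_⟩
  any_goals linarith
  have h1 : critTail * ((4 - √10) / 2) ≤ 0.12 := by nlinarith
  have h1' : 0 ≤ critTail * ((4 - √10) / 2) := mul_nonneg (by linarith) (by linarith)
  have h2 : critTail * ((4 - √10) / 2) * ((√10 - 2) / 3) ≤ 0.12 := by nlinarith
  have h2' : 0 ≤ critTail * ((4 - √10) / 2) * ((√10 - 2) / 3) := mul_nonneg h1' (by linarith)
  nlinarith

namespace IsAdjusted
variable {α : ℝ} {a ε : ℕ → ℤ}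

lemma digit_lt (h : IsAdjusted α a ε) {k : ℕ} {n : ℤ} (ht : 2 < tail α a ε k * (2 * n - 1)) :
    a (k + 1) < n := by
  by_contra hc
  have h1 : (n : ℝ) ≤ a (k + 1) := by exact_mod_cast not_lt.1 hc
  have := h.tail_mul_le k
  have := h.tail_pos k
  nlinarith

set_option maxHeartbeats 1000000 in
/-- If the bound of `tail_sub_eta_le` fails at `k`, the next partial quotients are
`4, -2, 2, 2, -4` and it fails by much more at `k + 4`. -/
lemma critical_loop (h : IsAdjusted α a ε) {k : ℕ} (hk : 1 ≤ k) (he : ε (k + 1) = -1)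
    (ha : a (k + 1) = 4) (hb : 0.38 ≤ back a ε k) (hv : critTail < tail α a ε k - eta α a ε k) :
    ε (k + 5) = -1 ∧ a (k + 5) = 4 ∧ 0.38 ≤ back a ε (k + 4) ∧
      10 * (tail α a ε k - eta α a ε k - critTail) ≤
        tail α a ε (k + 4) - eta α a ε (k + 4) - critTail := by
  obtain ⟨c1, c2⟩ := critTail_bounds
  have n0 := h.eta_nonneg k
  have n4 := h.eta_nonneg (k + 4)
  have p0 := h.tail_pos k
  have p1 := h.tail_pos (k + 1)
  have p2 := h.tail_pos (k + 2)
  have p3 := h.tail_pos (k + 3)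
  have p4 := h.tail_pos (k + 4)
  have m0 := h.tail_mul k
  have m1 := h.tail_mul (k + 1)
  have m2 := h.tail_mul (k + 2)
  have m3 := h.tail_mul (k + 3)
  have m4 := h.tail_mul (k + 4)
  simp only [add_assoc, Nat.reduceAdd] at m0 m1 m2 m3 m4
  have t0 : 0.27924 < tail α a ε k := by linarith
  have two : ∀ i, a (i + 1) < 3 → a (i + 1) = 2 := fun i hi => by
    have := h.two_le (i + 1) (by omega)
    omega
  have y0 := h.eta_even (k := k) (by rw [ha]; decide)
  rw [ha] at m0
  have e2 : ε (k + 2) = -1 := by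
    rcases h.sign (k + 2) (by omega) with e | e
    · rw [e] at m0; push_cast at m0; nlinarith
    · exact e
  rw [e2] at m0; push_cast at m0
  have m0' : tail α a ε k * (4 - tail α a ε (k + 1)) = 1 := by linarith
  have t1 : 0.4188 < tail α a ε (k + 1) := by
    have := den_lt_of_mul_eq_one m0' 3.5812 0.27924 t0 (by norm_num) (by norm_num)
    linarith
  have a2 : a (k + 2) = 2 := two (k + 1) (h.digit_lt (by push_cast; linarith))
  have y1 := h.eta_even (k := k + 1) (by rw [a2]; decide)
  have e3 : ε (k + 3) = 1 := by
    rcases h.two_sign (k + 2) (by omega) a2 with e | e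
    · omega
    · exact e
  rw [a2, e3] at m1; push_cast at m1
  have m1' : tail α a ε (k + 1) * (2 + tail α a ε (k + 2)) = 1 := by linarith
  have b1 := h.back_mul k
  have pb1 := h.back_pos k
  rw [ha, he] at b1; push_cast at b1
  -- Condition (ii) at this digit 2, together with the lower bound for `back`, bounds the tail
  -- behind it from below.
  have hn := h.two_neg (k + 2) (by omega) a2 e2
  have r1 : 1 / back a ε (k + 1) = 4 - back a ε k := by rw [div_eq_iff pb1.ne']; linarith
  rw [show k + 2 - 1 = k + 1 from rfl, r1] at hn
  have t2 : 0.3816 < tail α a ε (k + 2) := by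
    have : 1 / tail α a ε (k + 2) ≤ 2.62 := by linarith
    rw [div_le_iff₀ p2] at this
    linarith
  have t2' : tail α a ε (k + 2) < 0.388 := by
    have := den_lt_of_mul_eq_one m1' 2.388 0.4188 t1 (by norm_num) (by norm_num)
    linarith
  have t1' : tail α a ε (k + 1) < 0.41989 :=
    gt_of_mul_eq_one m1' p1 0.41989 2.3816 (by linarith) (by norm_num) (by norm_num)
  have t0' : tail α a ε k < 0.27933 :=
    gt_of_mul_eq_one m0' p0 0.27933 3.5801 (by linarith) (by norm_num) (by norm_num)
  -- The tail has now been squeezed so close to `critTail` that almost nothing is left for the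
  -- offset. Each odd digit considered below would make the offset much larger.
  have hη : eta α a ε k < 0.0001 := by linarith
  have a3' : a (k + 3) < 4 := h.digit_lt (k := k + 2) (by push_cast; linarith)
  have a3 : a (k + 3) = 2 := by
    refine two (k + 2) ?_
    by_contra hc
    have hc' : ¬ a (k + 3) < 3 := hc
    have a3 : a (k + 3) = 3 := by omega
    have := h.le_eta_odd (k := k + 2) (by rw [a3]; decide)
    have : 0.2 < eta α a ε (k + 2) := by linarith
    have h1 := mul_le_mul t1.le this.le (by norm_num) p1.le
    rw [add_assoc] at y1
    rw [← y1] at h1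
    have h2 := mul_le_mul t0.le h1 (by norm_num) p0.le
    rw [← y0] at h2
    linarith
  have y2 := h.eta_even (k := k + 2) (by rw [a3]; decide)
  rw [a3] at m2
  have e4 : ε (k + 4) = 1 := by
    rcases h.sign (k + 4) (by omega) with e | e
    · exact e
    · rw [e] at m2; push_cast at m2
      have := lt_den_of_mul_eq_one m2 p2 2 _ t2' (by norm_num)
      linarith
  rw [e4] at m2; push_cast at m2
  have m2' : tail α a ε (k + 2) * (2 + tail α a ε (k + 3)) = 1 := by linarith
  have t3 : 0.577 < tail α a ε (k + 3) := by
    have := lt_den_of_mul_eq_one m2' p2 2.577 0.388 t2' (by norm_num)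
    linarith
  have t3' : tail α a ε (k + 3) < 0.6206 := by
    have := den_lt_of_mul_eq_one m2' 2.6206 0.3816 t2 (by norm_num) (by norm_num)
    linarith
  have a4 : a (k + 4) = 2 := two (k + 3) (h.digit_lt (k := k + 3) (by push_cast; linarith))
  have y3 := h.eta_even (k := k + 3) (by rw [a4]; decide)
  rw [a4] at m3
  have e5 : ε (k + 5) = -1 := by
    rcases h.sign (k + 5) (by omega) with e | e
    · rw [e] at m3; push_cast at m3
      have := den_lt_of_mul_eq_one m3 2 _ t3 (by norm_num) (by norm_num)
      linarith
    · exact e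
  rw [e5] at m3; push_cast at m3
  have m3' : tail α a ε (k + 3) * (2 - tail α a ε (k + 4)) = 1 := by linarith
  have t4 : 0.26 < tail α a ε (k + 4) := by
    have := den_lt_of_mul_eq_one m3' 1.74 0.577 t3 (by norm_num) (by norm_num)
    linarith
  have b2 := h.back_mul (k + 1)
  have b3 := h.back_mul (k + 2)
  have b4 := h.back_mul (k + 3)
  have pb2 := h.back_pos (k + 1)
  have pb3 := h.back_pos (k + 2)
  have pb4 := h.back_pos (k + 3)
  simp only [add_assoc, Nat.reduceAdd] at b2 b3 b4 pb2 pb3 pb4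
  rw [a2, e2] at b2
  rw [a3, e3] at b3
  rw [a4, e4] at b4
  push_cast at b2 b3 b4
  have r2 : 0.276 < back a ε (k + 1) :=
    lt_of_mul_eq_one b1 pb1 0.276 3.621 (by linarith) (by norm_num)
  have r3 : 0.58 < back a ε (k + 2) :=
    lt_of_mul_eq_one b2 pb2 0.58 1.7241 (by linarith) (by norm_num)
  have r4 : back a ε (k + 3) < 0.39 :=
    gt_of_mul_eq_one b3 pb3 0.39 2.58 (by linarith) (by norm_num) (by norm_num)
  have r5 : 0.38 ≤ back a ε (k + 4) :=
    (lt_of_mul_eq_one b4 pb4 0.38 2.4 (by linarith) (by norm_num)).le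
  -- Condition (iii) at the last digit 2 bounds the next tail from above, which excludes the digit 2
  -- at k + 5; the offset excludes 3 and the lower bound on the tail excludes digits ≥ 5.
  have hn2 := h.neg_two (k + 4) (by omega) a4 e5
  have r6 : 1 / back a ε (k + 3) = 2 + back a ε (k + 2) := by
    rw [div_eq_iff pb3.ne']; linarith
  rw [show k + 4 - 1 = k + 3 from rfl, r6] at hn2
  have t4' : tail α a ε (k + 4) < 0.2794 := by
    have : 3.58 < 1 / tail α a ε (k + 4) := by linarith
    rw [lt_div_iff₀ p4] at this
    linarith
  have h01 := mul_le_mul t0.le t1.le (by norm_num) p0.le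
  have h02 := mul_le_mul h01 t2.le (by norm_num) (mul_pos p0 p1).le
  have h03 := mul_le_mul h02 t3.le (by norm_num) (mul_pos (mul_pos p0 p1) p2).le
  have hprod : 0.0257 < tail α a ε k * tail α a ε (k + 1) * tail α a ε (k + 2) *
      tail α a ε (k + 3) := by
    norm_num at h03 ⊢
    linarith
  have hηη : eta α a ε k = tail α a ε k * tail α a ε (k + 1) * tail α a ε (k + 2) *
      tail α a ε (k + 3) * eta α a ε (k + 4) := by
    rw [y0, y1, y2, y3]; ring
  have hloop := critTail_loop m0' m1' m2' m3'
  have a5 : a (k + 5) < 5 := by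
    refine h.digit_lt (k := k + 4) ?_
    push_cast; linarith
  have a5' : a (k + 5) ≠ 3 := by
    intro a5
    have := h.le_eta_odd (k := k + 4) (by rw [a5]; decide)
    have h1 : 0.14 ≤ eta α a ε (k + 4) := by linarith
    have h2 := mul_le_mul hprod.le h1 (by norm_num) (by linarith)
    rw [← hηη] at h2
    linarith
  have a5'' : a (k + 5) ≠ 2 := by
    intro a5
    rw [a5] at m4
    have := h.tail_le (k + 5)
    have := h.tail_pos (k + 5)
    have := lt_den_of_mul_eq_one m4 p4 3 _ t4' (by norm_num)
    rcases h.sign (k + 6) (by omega) with e | e <;> rw [e] at this <;> push_cast at this <;>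
      linarith
  refine ⟨e5, ?_, r5, ?_⟩
  · have := h.two_le (k + 5) (by omega)
    omega
  · have hQ : tail α a ε k * tail α a ε (k + 1) * tail α a ε (k + 2) * tail α a ε (k + 3) ≤ 1 :=
      mul_le_one₀ (mul_le_one₀ (mul_le_one₀ (h.tail_lt_one _) p1.le (h.tail_lt_one _)) p2.le
        (h.tail_lt_one _)) p3.le (h.tail_lt_one _)
    have := ten_mul_le_of_contraction (s := tail α a ε k - eta α a ε k - critTail)
      (e := tail α a ε (k + 4) - critTail) (by linarith) hQ critTail_prod.1 critTail_prod.2 n4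
      (by rw [← hloop, ← hηη]; ring) (by linarith)
    linarith

/-- A positive excess would grow tenfold with every block, while it is always less than 1; so the
excess is at most 10⁻ⁿ for every n. -/
lemma tail_sub_eta_le_add (h : IsAdjusted α a ε) (n : ℕ) : ∀ {k : ℕ}, 1 ≤ k → ε (k + 1) = -1 →
    a (k + 1) = 4 → 0.38 ≤ back a ε k →
    tail α a ε k - eta α a ε k ≤ critTail + (1 / 10) ^ n := by
  induction n with
  | zero =>
    intro k _ _ _ _
    have := h.tail_lt_one k
    have := h.eta_nonneg k
    have := critTail_bounds
    norm_num; linarith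
  | succ n ih =>
    intro k h1 h2 h3 h4
    by_contra! hc
    have hp : (0 : ℝ) < (1 / 10) ^ (n + 1) := by positivity
    obtain ⟨l1, l2, l3, l4⟩ := h.critical_loop h1 h2 h3 h4 (by linarith)
    have := ih (k := k + 4) (by omega) l1 l2 l3
    rw [pow_succ] at hc hp
    linarith

lemma tail_sub_eta_le (h : IsAdjusted α a ε) {k : ℕ} (hk : 1 ≤ k) (he : ε (k + 1) = -1)
    (ha : a (k + 1) = 4) (hb : 0.38 ≤ back a ε k) : tail α a ε k - eta α a ε k ≤ critTail := by
  have h1 : Tendsto (fun n : ℕ => critTail + (1 / 10 : ℝ) ^ n) atTop (𝓝 (critTail + 0)) :=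
    (tendsto_pow_atTop_nhds_zero_of_lt_one (by norm_num) (by norm_num)).const_add _
  rw [add_zero] at h1
  exact ge_of_tendsto' h1 fun n => h.tail_sub_eta_le_add n hk he ha hb

end IsAdjusted

/-! ### The critical vertex and the lower bound -/

namespace IsAdjusted
variable {α : ℝ} {a ε : ℕ → ℤ}

/-- The left factor is at least `critSlope` times the denominator taken at `critTail`. It remains to
compare right factors: above `critTail` the denominator decreases and the hypothesis bounds 1 - α +
η below, while below `critTail` one drops η and uses that (1 - α)/(34 - 13α + (13 - 5α)b) decreases
in α. -/
lemma critical_product {b x α η : ℝ} (hb : 0 ≤ b) (hη : 0 ≤ η)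
    (hx : -x ≤ lineA + lineB * b) (h : α - η ≤ critTail) :
    4 * bound * (34 - 13 * α + (13 - 5 * α) * b) ≤ (7 + 3 * b + x) * (1 - α + η) := by
  obtain ⟨s1, -⟩ := critSlope_bounds
  obtain ⟨c1, c2⟩ := critTail_bounds
  rw [← critSlope_mul]
  have hZ : critSlope * (34 - 13 * critTail + (13 - 5 * critTail) * b) ≤ 7 + 3 * b + x := by
    rw [lineA, lineB] at hx
    linarith
  have hT : 0 ≤ 34 - 13 * critTail + (13 - 5 * critTail) * b :=
    add_nonneg (by linarith) (mul_nonneg (by linarith) hb)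
  have hV : 0 ≤ 1 - α + η := by linarith
  refine le_trans ?_ (mul_le_mul_of_nonneg_right hZ hV)
  rw [mul_assoc, mul_assoc]
  refine mul_le_mul_of_nonneg_left ?_ (by linarith)
  rcases le_total critTail α with hc | hc
  · have h1 : 34 - 13 * α + (13 - 5 * α) * b ≤ 34 - 13 * critTail + (13 - 5 * critTail) * b := by
      nlinarith
    calc _ ≤ (1 - critTail) * (34 - 13 * critTail + (13 - 5 * critTail) * b) :=
          mul_le_mul_of_nonneg_left h1 (by linarith)
      _ ≤ _ := by
          rw [mul_comm]
          exact mul_le_mul_of_nonneg_left (by linarith) hT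
  · have h1 : (1 - critTail) * (34 - 13 * α + (13 - 5 * α) * b) ≤
        (34 - 13 * critTail + (13 - 5 * critTail) * b) * (1 - α) := by
      nlinarith [mul_nonneg (sub_nonneg.2 hc) (by linarith : 0 ≤ 21 + 8 * b)]
    refine h1.trans (mul_le_mul_of_nonneg_left (by linarith) hT)

/-- The recurrences through the digits 3, -2, 2, -3 are linear in homogeneous form. The common scale
G is the product of the four reversed expansions and cancels from the vertex bound. -/
lemma critical_forms (h : IsAdjusted α a ε) {k : ℕ} (a1 : a (k + 1) = 3)
    (e1 : ε (k + 1) = 1) (a2 : a (k + 2) = 2) (e2 : ε (k + 2) = -1) (a3 : a (k + 3) = 2)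
    (e3 : ε (k + 3) = 1) (a4 : a (k + 4) = 3) (e4 : ε (k + 4) = -1) :
    0.38 < back a ε (k + 4) ∧ ∃ G, 0 < G ∧
      1 - back a ε (k + 4) + xi a ε (k + 4) = G * (7 + 3 * back a ε k + xi a ε k) ∧
      ∀ t, 1 - t * back a ε (k + 4) = G * (34 - 13 * t + (13 - 5 * t) * back a ε k) := by
  have b1 := h.back_mul k
  have b2 := h.back_mul (k + 1)
  have b3 := h.back_mul (k + 2)
  have b4 := h.back_mul (k + 3)
  have p1 := h.back_pos k
  have p2 := h.back_pos (k + 1)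
  have p3 := h.back_pos (k + 2)
  have p4 := h.back_pos (k + 3)
  have x1 := xi_odd (ε := ε) (a := a) (k := k) (by rw [a1]; decide)
  have x2 := xi_even (ε := ε) (a := a) (k := k + 1) (by rw [a2]; decide)
  have x3 := xi_even (ε := ε) (a := a) (k := k + 2) (by rw [a3]; decide)
  have x4 := xi_odd (ε := ε) (a := a) (k := k + 3) (by rw [a4]; decide)
  have hB2 := h.back_le (k + 2)
  simp only [Nat.add_assoc, Nat.reduceAdd] at b1 b2 b3 b4 x1 x2 x3 x4 p1 p2 p3 p4
  rw [a1, e1] at b1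
  rw [a2, e2] at b2
  rw [a3, e3] at b3
  rw [a4, e4] at b4
  rw [e1] at x1
  rw [e2] at x2
  rw [e3] at x3
  rw [e4] at x4
  push_cast at b1 b2 b3 b4 x1 x2 x3 x4
  rw [x3, x2, x1] at x4
  have hB3 : 0.374 < back a ε (k + 3) :=
    lt_of_mul_eq_one b3 p3 0.374 2.67 (by linarith) (by norm_num)
  have hB4 : 0.38 < back a ε (k + 4) :=
    lt_of_mul_eq_one b4 p4 0.38 2.63 (by linarith) (by norm_num)
  refine ⟨hB4, back a ε (k + 4) * back a ε (k + 3) * back a ε (k + 2) * back a ε (k + 1),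
    mul_pos (mul_pos (mul_pos p4 p3) p2) p1, ?_, fun t => ?_⟩
  · rw [x4]
    linear_combination -b4 - back a ε (k + 4) * b3 - back a ε (k + 4) * back a ε (k + 3) * b2 -
      3 * back a ε (k + 4) * back a ε (k + 3) * back a ε (k + 2) * b1
  · linear_combination -b4 - (3 - t) * back a ε (k + 4) * b3 -
      (5 - 2 * t) * back a ε (k + 4) * back a ε (k + 3) * b2 -
      (13 - 5 * t) * back a ε (k + 4) * back a ε (k + 3) * back a ε (k + 2) * b1

lemma vertexBoundAt_critical (h : IsAdjusted α a ε) {k : ℕ} (a1 : a (k + 1) = 3)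
    (e1 : ε (k + 1) = 1) (a2 : a (k + 2) = 2) (e2 : ε (k + 2) = -1) (a3 : a (k + 3) = 2)
    (e3 : ε (k + 3) = 1) (a4 : a (k + 4) = 3) (e4 : ε (k + 4) = -1) (a5 : a (k + 5) = 4)
    (e5 : ε (k + 5) = -1) : VertexBoundAt α a ε (4 * bound) (k + 4) (1, -1) := by
  obtain ⟨hB, G, hG, hU, hS⟩ := h.critical_forms a1 e1 a2 e2 a3 e3 a4 e4
  have hη := h.eta_nonneg (k + 4)
  have hα := h.tail_lt_one (k + 4)
  have hx := h.abs_xi_le k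
  have b0 := h.back_nonneg k
  have key := critical_product b0 hη (h.beforeThree k a1 e1).1
    (h.tail_sub_eta_le (k := k + 4) (by omega) e5 a5 hB.le)
  rw [VertexBoundAt]
  simp only [Nat.add_assoc, Nat.reduceAdd]
  rw [e5]
  push_cast
  have hU' : 1 + 1 * -1 * back a ε (k + 4) + 1 * xi a ε (k + 4) =
      G * (7 + 3 * back a ε k + xi a ε k) := by linarith
  have hS' : 1 + -1 * tail α a ε (k + 4) * back a ε (k + 4) =
      G * (34 - 13 * tail α a ε (k + 4) + (13 - 5 * tail α a ε (k + 4)) * back a ε k) := by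
    rw [← hS]; ring
  rw [hU', hS']
  refine ⟨mul_nonneg hG.le (by linarith [(abs_le.1 hx).1]), by linarith, ?_⟩
  have := mul_le_mul_of_nonneg_left key hG.le
  linarith

/-- The two vertices are the same grid point seen from neighbouring cells. Its distances change by
the factors `back` and `tail`, and the normalised areas change accordingly. `vertexBoundAt_of_two`
is the same step through a digit 2. -/
lemma vertexBoundAt_of_neg_three (h : IsAdjusted α a ε) {k : ℕ} {κ : ℝ} (a1 : a (k + 1) = 3)
    (e1 : ε (k + 1) = -1) (e2 : ε (k + 2) = -1) (hv : VertexBoundAt α a ε κ (k + 1) (1, -1)) :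
    VertexBoundAt α a ε κ k (-1, 1) := by
  have b1 := h.back_mul k
  have p1 := h.back_pos k
  have t1 := h.tail_mul k
  have q1 := h.tail_pos k
  have x1 := xi_odd (ε := ε) (a := a) (k := k) (by rw [a1]; decide)
  have y1 := h.eta_odd (k := k) (by rw [a1]; decide)
  obtain ⟨v1, v2, v3⟩ := hv
  simp only [Nat.add_assoc, Nat.reduceAdd] at *
  rw [VertexBoundAt]
  rw [a1, e1] at b1
  rw [a1, e2] at t1
  rw [e1] at x1
  rw [e2] at v2 v3
  rw [e1]
  push_cast at *
  have hU : 1 + 1 * -1 * back a ε (k + 1) + 1 * xi a ε (k + 1) =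
      back a ε (k + 1) * (1 + -1 * 1 * back a ε k + -1 * xi a ε k) := by
    rw [x1]; linear_combination -b1
  have hV : 1 - -1 * -1 * 1 * tail α a ε k - 1 * eta α a ε k =
      tail α a ε k * (1 - -1 * 1 * -1 * tail α a ε (k + 1) - -1 * eta α a ε (k + 1)) := by
    rw [y1]; linear_combination -t1
  have hS : back a ε (k + 1) * (1 + -1 * tail α a ε k * back a ε k) =
      tail α a ε k * (1 + -1 * tail α a ε (k + 1) * back a ε (k + 1)) := by
    linear_combination tail α a ε k * b1 - back a ε (k + 1) * t1
  rw [hU] at v1 v3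
  refine ⟨(mul_nonneg_iff_of_pos_left p1).1 v1, hV ▸ mul_nonneg q1.le v2, ?_⟩
  refine le_of_mul_le_mul_left ?_ p1
  rw [hV]
  calc _ = tail α a ε k * (κ * (1 + -1 * tail α a ε (k + 1) * back a ε (k + 1))) := by
        linear_combination κ * hS
    _ ≤ _ := mul_le_mul_of_nonneg_left v3 q1.le
    _ = _ := by ring

lemma vertexBoundAt_of_two (h : IsAdjusted α a ε) {k : ℕ} {κ : ℝ} (a1 : a (k + 1) = 2)
    (e1 : ε (k + 1) = 1) (e2 : ε (k + 2) = -1) (hv : VertexBoundAt α a ε κ (k + 1) (-1, 1)) :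
    VertexBoundAt α a ε κ k (1, 1) := by
  have b1 := h.back_mul k
  have p1 := h.back_pos k
  have t1 := h.tail_mul k
  have q1 := h.tail_pos k
  have x1 := xi_even (ε := ε) (a := a) (k := k) (by rw [a1]; decide)
  have y1 := h.eta_even (k := k) (by rw [a1]; decide)
  obtain ⟨v1, v2, v3⟩ := hv
  simp only [Nat.add_assoc, Nat.reduceAdd] at *
  rw [VertexBoundAt]
  rw [a1, e1] at b1
  rw [a1, e2] at t1
  rw [e1] at x1
  rw [e2] at v2 v3
  rw [e1]
  push_cast at *
  have hU : 1 + -1 * 1 * back a ε (k + 1) + -1 * xi a ε (k + 1) =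
      back a ε (k + 1) * (1 + 1 * 1 * back a ε k + 1 * xi a ε k) := by
    rw [x1]; linear_combination -b1
  have hV : 1 - 1 * 1 * 1 * tail α a ε k - 1 * eta α a ε k =
      tail α a ε k * (1 - -1 * -1 * 1 * tail α a ε (k + 1) - 1 * eta α a ε (k + 1)) := by
    rw [y1]; linear_combination -t1
  have hS : back a ε (k + 1) * (1 + 1 * tail α a ε k * back a ε k) =
      tail α a ε k * (1 + -1 * tail α a ε (k + 1) * back a ε (k + 1)) := by
    linear_combination tail α a ε k * b1 - back a ε (k + 1) * t1
  rw [hU] at v1 v3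
  refine ⟨(mul_nonneg_iff_of_pos_left p1).1 v1, hV ▸ mul_nonneg q1.le v2, ?_⟩
  refine le_of_mul_le_mul_left ?_ p1
  rw [hV]
  calc _ = tail α a ε k * (κ * (1 + -1 * tail α a ε (k + 1) * back a ε (k + 1))) := by
        linear_combination κ * hS
    _ ≤ _ := mul_le_mul_of_nonneg_left v3 q1.le
    _ = _ := by ring

lemma vertexBoundAt_of_critical (h : IsAdjusted α a ε) {k : ℕ} {v : ℤ × ℤ}
    (hc : Critical a ε k v) : VertexBoundAt α a ε (4 * bound) k v := by
  obtain ⟨L, R, m, n, hk, hL, hR, hcrit⟩ := hc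
  unfold isCritical at hcrit
  split at hcrit
  · simp only [List.length_cons] at hk
    obtain ⟨k, rfl⟩ : ∃ j, k = j + 4 := ⟨k - 4, by omega⟩
    simp only [MatchL, MatchR, Prod.mk.injEq] at hL hR
    simp only [Bool.and_eq_true, decide_eq_true_eq] at hcrit
    obtain ⟨⟨a4, e4⟩, ⟨a3, e3⟩, ⟨a2, e2⟩, ⟨a1, e1⟩, -⟩ := hL
    obtain ⟨⟨a5, -⟩, -⟩ := hR
    rw [hcrit.2]
    exact h.vertexBoundAt_critical a1.symm e1.symm a2.symm e2.symm a3.symm e3.symm a4.symm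
      e4.symm a5.symm hcrit.1
  · simp only [List.length_cons] at hk
    obtain ⟨k, rfl⟩ : ∃ j, k = j + 3 := ⟨k - 3, by omega⟩
    simp only [MatchL, MatchR, Prod.mk.injEq] at hL hR
    simp only [Bool.and_eq_true, decide_eq_true_eq] at hcrit
    obtain ⟨⟨a3, e3⟩, ⟨a2, e2⟩, ⟨a1, e1⟩, -⟩ := hL
    obtain ⟨⟨a4, e5⟩, ⟨a5, -⟩, -⟩ := hR
    rw [hcrit.2]
    exact h.vertexBoundAt_of_neg_three a4.symm hcrit.1 e5.symm
      (h.vertexBoundAt_critical a1.symm e1.symm a2.symm e2.symm a3.symm e3.symm a4.symm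
      hcrit.1 a5.symm e5.symm)
  · simp only [List.length_cons] at hk
    obtain ⟨k, rfl⟩ : ∃ j, k = j + 2 := ⟨k - 2, by omega⟩
    simp only [MatchL, MatchR, Prod.mk.injEq] at hL hR
    simp only [Bool.and_eq_true, decide_eq_true_eq] at hcrit
    obtain ⟨⟨a2, e2⟩, ⟨a1, e1⟩, -⟩ := hL
    obtain ⟨⟨a3, e4⟩, ⟨a4, e5⟩, ⟨a5, -⟩, -⟩ := hR
    rw [hcrit.2]
    exact h.vertexBoundAt_of_two a3.symm hcrit.1 e4.symm
      (h.vertexBoundAt_of_neg_three a4.symm e4.symm e5.symm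
      (h.vertexBoundAt_critical a1.symm e1.symm a2.symm e2.symm a3.symm hcrit.1 a4.symm
      e4.symm a5.symm e5.symm))
  · exact absurd hcrit (by simp)

lemma vertexBound (h : IsAdjusted α a ε) {k : ℕ} (hk : 41 ≤ k) :
    VertexBound α a ε (4 * bound) k := by
  intro u w hu hw
  rcases h.vertexBoundAt_or_critical (by omega : 40 < k) hu hw with hv | hv
  · obtain ⟨v1, v2, v3⟩ := hv
    refine ⟨v1, v2, le_trans (mul_le_mul_of_nonneg_right ?_ ?_) v3⟩
    · linarith [bound_le]
    · have h1 := h.tail_mul_back_le k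
      rcases h.sign (k + 1) (by omega) with e | e <;> rw [e] <;> push_cast <;>
        linarith [h1.1, h1.2]
  · exact h.vertexBoundAt_of_critical hv

theorem main (h : IsAdjusted α a ε) :
    gammaStar α a ε ∉ lattice α ∧ (bound : EReal) ≤ M α (gammaStar α a ε) :=
  h.main_of_vertexBound bound_pos (by linarith [bound_le]) (K := 41) fun _ hk => h.vertexBound hk

end IsAdjusted

/-! ### Existence of an adjusted expansion for every irrational number -/

/-- |q_k α - p_k| is a product of tails, hence at most 1, so the error of the k-th convergent is at
most 1/q_k. -/
lemma IsTails.tendsto {a ε : ℕ → ℤ} {A : ℕ → ℝ} (h : IsTails a ε A) {α : ℝ}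
    (h0 : α = a 0 + ε 1 * A 0) :
    Tendsto (fun i => (num a ε i : ℝ) / (den a ε i : ℝ)) atTop (𝓝 α) := by
  have hd : ∀ k, (0 : ℝ) < den a ε k := fun k => by
    exact_mod_cast (den_pos_lt h.sign h.two_le k).1
  have h1 : Tendsto (fun k => 1 / (den a ε k : ℝ)) atTop (𝓝 0) :=
    tendsto_const_nhds.div_atTop (tendsto_den h.sign h.two_le)
  rw [tendsto_iff_dist_tendsto_zero]
  refine squeeze_zero (fun _ => dist_nonneg) (fun k => ?_) h1
  rw [dist_comm, Real.dist_eq, le_div_iff₀ (hd k), ← abs_of_pos (hd k), ← abs_mul,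
    abs_of_pos (hd k), sub_mul, div_mul_cancel₀ _ (hd k).ne', mul_comm α, h.delta h0 k, abs_mul]
  have h2 : |(sgn ε (k + 1) : ℝ)| = 1 := by
    rcases sgn_sign h.sign (k + 1) with e | e <;> rw [e] <;> simp
  rw [h2, one_mul, Finset.abs_prod]
  exact Finset.prod_le_one (fun _ _ => abs_nonneg _) fun i _ => by
    rw [abs_of_pos (h.pos i)]; exact h.le_one i

/-- If the fractional part is `f`, then `1 / (1 - f) = 2 + 1 / skipValue f`. -/
def skipValue (f : ℝ) : ℝ := (1 - f) / (2 * f - 1)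

/-- The function decreases on f > 1/2, and by φ² = φ + 1 it takes the value φ at f = φ - 1. -/
lemma skipValue_le {f : ℝ} (h : Real.goldenRatio - 1 ≤ f) : skipValue f ≤ Real.goldenRatio := by
  have h1 := Real.goldenRatio_sq
  have h2 := Real.one_lt_goldenRatio
  have h3 : 3 / 2 < Real.goldenRatio := by nlinarith
  rw [skipValue, div_le_iff₀ (by linarith)]
  nlinarith

/-- The expansion chosen by rounding `1 / A n` to the nearest integer, except that it is rounded
down if this is justified by a comparison with the reversed expansion. -/
structure IsRounded (a ε : ℕ → ℤ) (A : ℕ → ℝ) : Prop where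
  pos : 0 < A 0
  lt_half : A 0 < 1 / 2
  sign : ε 1 = 1 ∨ ε 1 = -1
  step : ∀ n, ∃ f : ℝ, 0 < f ∧ f < 1 ∧
    ((1 / A n = a (n + 1) + f ∧ ε (n + 2) = 1 ∧ A (n + 1) = f ∧
      (f < 1 / 2 ∨ 1 / 2 < f ∧ Real.goldenRatio < skipValue f ∧
        a (n + 1) + ε (n + 1) * back a ε n < skipValue f)) ∨
    (1 / A n = a (n + 1) - 1 + f ∧ ε (n + 2) = -1 ∧ A (n + 1) = 1 - f ∧ 1 / 2 < f ∧
      (skipValue f ≤ Real.goldenRatio ∨ skipValue f ≤ a (n + 1) - 1 + ε (n + 1) * back a ε n)))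

namespace IsRounded
variable {a ε : ℕ → ℤ} {A : ℕ → ℝ}

lemma sign_succ (h : IsRounded a ε A) (n : ℕ) : ε (n + 1) = 1 ∨ ε (n + 1) = -1 := by
  rcases n with _ | n
  · exact h.sign
  · obtain ⟨f, -, -, ⟨-, e, -⟩ | ⟨-, e, -⟩⟩ := h.step n
    · exact Or.inl e
    · exact Or.inr e

lemma pos_lt_one (h : IsRounded a ε A) (n : ℕ) : 0 < A n ∧ A n < 1 := by
  rcases n with _ | n
  · exact ⟨h.pos, by linarith [h.lt_half]⟩
  · obtain ⟨f, f0, f1, ⟨-, -, e, -⟩ | ⟨-, -, e, -⟩⟩ := h.step n <;> rw [e] <;>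
      constructor <;> linarith

lemma one_lt_inv (h : IsRounded a ε A) (n : ℕ) : 1 < 1 / A n := by
  obtain ⟨h0, h1⟩ := h.pos_lt_one n
  rw [lt_div_iff₀ h0]; linarith

/-- After a large tail, the expansion rounds up, to `2`. -/
lemma after_skip (h : IsRounded a ε A) {n : ℕ} (hn : 1 / 2 < A n) :
    ∃ m f, n = m + 1 ∧ 1 / 2 < f ∧ f < 1 ∧ A n = f ∧ ε (n + 1) = 1 ∧
      Real.goldenRatio < skipValue f ∧ a n + ε n * back a ε m < skipValue f := by
  rcases n with _ | n
  · linarith [h.lt_half]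
  obtain ⟨f, f0, f1, ⟨-, e, hA, hf⟩ | ⟨-, -, hA, hf, -⟩⟩ := h.step n
  · refine ⟨n, f, rfl, by linarith, f1, hA, e, ?_⟩
    rcases hf with hf | hf
    · linarith
    · exact hf.2
  · linarith

/-- If f > 1/2 is the tail, rounding 1/f down would give the digit 1 with fractional part above φ -
1, which `skipValue_le` forbids. After rounding up, the next tail is 2 - 1/f, whose inverse is 1 +
skipValue f > 1 + φ. -/
lemma skip_ceil (h : IsRounded a ε A) {n : ℕ} (hn : 1 / 2 < A n) :
    a (n + 1) = 2 ∧ ε (n + 2) = -1 ∧ 1 + Real.goldenRatio < 1 / A (n + 1) ∧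
      A (n + 1) = 2 - 1 / A n := by
  obtain ⟨m, f, rfl, f2, f1, hA, -, hReal.goldenRatio, -⟩ := h.after_skip hn
  have h1 := Real.goldenRatio_sq
  have h2 := Real.one_lt_goldenRatio
  have h3 := h.one_lt_inv (m + 1)
  have h4 : 1 / A (m + 1) < 2 := by rw [div_lt_iff₀ (by linarith)]; linarith
  have h5 : (2 - 1 / A (m + 1)) * (1 + Real.goldenRatio) < 1 := by
    rw [hA]
    rw [skipValue, lt_div_iff₀ (by linarith)] at hReal.goldenRatio
    have : 2 - 1 / f = (2 * f - 1) / f := by field_simp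
    rw [this, div_mul_eq_mul_div, div_lt_one (by linarith)]
    nlinarith
  have h6 : 2 - 1 / A (m + 1) < 2 - Real.goldenRatio := by nlinarith
  obtain ⟨g, g0, g1, ⟨e1, e, hA', hg⟩ | ⟨e1, e, hA', hg, -⟩⟩ := h.step (m + 1)
  · have ha : a (m + 1 + 1) = 1 := by
      have l1 : (0 : ℝ) < a (m + 1 + 1) := by linarith
      have l2 : (a (m + 1 + 1) : ℝ) < 2 := by linarith
      have l1' : 0 < a (m + 1 + 1) := by exact_mod_cast l1
      have l2' : a (m + 1 + 1) < 2 := by exact_mod_cast l2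
      omega
    rw [ha] at e1
    push_cast at e1
    have hg' : Real.goldenRatio - 1 ≤ g := by linarith
    rcases hg with hg | hg
    · nlinarith
    · linarith [hg.2.1, skipValue_le hg']
  · have ha : a (m + 1 + 1) = 2 := by
      have l1 : (1 : ℝ) < a (m + 1 + 1) := by linarith
      have l2 : (a (m + 1 + 1) : ℝ) < 3 := by linarith
      have l1' : 1 < a (m + 1 + 1) := by exact_mod_cast l1
      have l2' : a (m + 1 + 1) < 3 := by exact_mod_cast l2
      omega
    rw [ha] at e1
    push_cast at e1
    refine ⟨ha, e, ?_, by linarith⟩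
    rw [hA', lt_div_iff₀ (by linarith), mul_comm]
    have : 1 - g = 2 - 1 / A (m + 1) := by linarith
    rw [this]; exact h5

/-- 1 + φ is a fixed point of x ↦ 1/(3 - x), so the inequality persists along a run of -3. While it
holds the next digit cannot be 2, which is the source of condition (iv). -/
lemma run_step (h : IsRounded a ε A) {n : ℕ} (hn : 1 + Real.goldenRatio < 1 / A n) :
    3 ≤ a (n + 1) ∧ (a (n + 1) = 3 → ε (n + 2) = -1 → 1 + Real.goldenRatio < 1 / A (n + 1)) := by
  have h1 := Real.goldenRatio_sq
  have h2 := Real.one_lt_goldenRatio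
  have h3 : 3 / 2 < Real.goldenRatio := by nlinarith
  obtain ⟨g, g0, g1, ⟨e1, e, hA', hg⟩ | ⟨e1, e, hA', hg, -⟩⟩ := h.step n
  · refine ⟨?_, fun _ e' => by omega⟩
    by_contra hc
    have hc' : (a (n + 1) : ℝ) ≤ 2 := by exact_mod_cast (by omega : a (n + 1) ≤ 2)
    have hg' : Real.goldenRatio - 1 ≤ g := by linarith
    rcases hg with hg | hg
    · linarith
    · linarith [hg.2.1, skipValue_le hg']
  · have l1 : (2 : ℝ) < a (n + 1) := by linarith
    refine ⟨by exact_mod_cast l1, fun ha _ => ?_⟩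
    rw [ha] at e1
    push_cast at e1
    rw [hA', lt_div_iff₀ (by linarith)]
    nlinarith

lemma two_le (h : IsRounded a ε A) (n : ℕ) : 2 ≤ a (n + 1) := by
  obtain ⟨p0, p1⟩ := h.pos_lt_one n
  rcases lt_or_ge (1 / 2) (A n) with hn | hn
  · exact (h.skip_ceil hn).1.ge
  · have h2 : 2 ≤ 1 / A n := by rw [le_div_iff₀ p0]; linarith
    obtain ⟨g, g0, g1, ⟨e1, -⟩ | ⟨e1, -⟩⟩ := h.step n
    · have l1 : (1 : ℝ) < a (n + 1) := by linarith
      exact_mod_cast l1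
    · have l1 : (2 : ℝ) < a (n + 1) := by linarith
      have : 2 < a (n + 1) := by exact_mod_cast l1
      omega

lemma large_of_neg_two (h : IsRounded a ε A) {n : ℕ} (ha : a (n + 1) = 2) (he : ε (n + 2) = -1) :
    1 / 2 < A n := by
  obtain ⟨p0, p1⟩ := h.pos_lt_one n
  obtain ⟨g, g0, g1, ⟨e1, e, -⟩ | ⟨e1, -⟩⟩ := h.step n
  · omega
  · rw [ha] at e1
    push_cast at e1
    have : 1 / A n < 2 := by linarith
    rw [div_lt_iff₀ p0] at this
    linarith

lemma isTails (h : IsRounded a ε A) : IsTails a ε A where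
  sign i hi := by
    obtain ⟨n, rfl⟩ : ∃ n, i = n + 1 := ⟨i - 1, by omega⟩
    exact h.sign_succ n
  two_le i hi := by
    obtain ⟨n, rfl⟩ : ∃ n, i = n + 1 := ⟨i - 1, by omega⟩
    exact h.two_le n
  pos k := (h.pos_lt_one k).1
  le_one k := (h.pos_lt_one k).2.le
  eqn k := by
    obtain ⟨p0, -⟩ := h.pos_lt_one k
    have : 1 / A k = a (k + 1) + ε (k + 2) * A (k + 1) := by
      obtain ⟨g, g0, g1, ⟨e1, e, hA, -⟩ | ⟨e1, e, hA, -⟩⟩ := h.step k <;> rw [e1, e, hA] <;>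
        push_cast <;> ring
    rw [← this, mul_one_div_cancel p0.ne']

lemma isAdjusted (h : IsRounded a ε A) {α : ℝ} (hα : Irrational α) (h0 : α = a 0 + ε 1 * A 0) :
    IsAdjusted α a ε where
  irrational := hα
  sign := h.isTails.sign
  two_le := h.isTails.two_le
  expansion := h.isTails.tendsto h0
  half := by
    have := h.pos
    have := h.lt_half
    rw [h0]
    rcases h.sign with e | e <;> rw [e] <;> push_cast <;> rw [abs_lt] <;> constructor <;> linarith
  two_sign i hi ha := by
    obtain ⟨n, rfl⟩ : ∃ n, i = n + 1 := ⟨i - 1, by omega⟩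
    rcases h.sign_succ (n + 1) with e | e
    · exact Or.inr e
    · obtain ⟨m, f, rfl, -, -, -, e1, -⟩ := h.after_skip (h.large_of_neg_two ha e)
      exact Or.inl e1
  two_neg i hi ha he := by
    obtain ⟨n, rfl⟩ : ∃ n, i = n + 2 := ⟨i - 2, by omega⟩
    rw [h.isTails.tail_eq h0]
    obtain ⟨f, f0, f1, ⟨-, e, -⟩ | ⟨-, -, hA, hf, hU⟩⟩ := h.step n
    · omega
    have hb : 1 / back a ε (n + 1) = a (n + 1) + ε (n + 1) * back a ε n := one_div_one_div _
    rw [show n + 2 - 1 = n + 1 from rfl, hb]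
    obtain ⟨g, g0, g1, ⟨e1, -, hA', hg⟩ | ⟨e1, e, -⟩⟩ := h.step (n + 1)
    · rw [show n + 1 + 1 = n + 2 from rfl] at *
      rw [ha, hA] at e1
      push_cast at e1
      have e2 : 1 / g = skipValue f := by
        have : g = (2 * f - 1) / (1 - f) := by
          rw [eq_div_iff (by linarith)]
          field_simp [(by linarith : 1 - f ≠ 0)] at e1
          linarith
        rw [this, one_div_div, skipValue]
      rw [hA', e2]
      -- If the rounding up was due to the golden ratio alone, then g ≥ φ - 1 and the next step
      -- could not round down. Hence the comparison with the reversed expansion holds, and it is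
      -- condition (ii).
      rcases hU with hU | hU
      · exfalso
        have hg' : Real.goldenRatio - 1 ≤ g := by
          rw [← e2, div_le_iff₀ g0] at hU
          have h1 := Real.goldenRatio_sq
          nlinarith [Real.goldenRatio_pos]
        have h1 := Real.goldenRatio_sq
        have h2 := Real.one_lt_goldenRatio
        have h3 : 3 / 2 < Real.goldenRatio := by nlinarith
        rcases hg with hg | hg
        · linarith
        · linarith [hg.2.1, skipValue_le hg']
      · linarith
    · exfalso
      have := h.large_of_neg_two (n := n + 1) ha e
      linarith
  neg_two i hi ha he := by
    obtain ⟨n, rfl⟩ : ∃ n, i = n + 2 := ⟨i - 2, by omega⟩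
    rw [h.isTails.tail_eq h0]
    have hl := h.large_of_neg_two (n := n + 1) ha he
    obtain ⟨m, f, hm, f2, f1, hA, -, -, hX⟩ := h.after_skip hl
    obtain rfl : n = m := by omega
    have hA' := (h.skip_ceil hl).2.2.2
    have hb : 1 / back a ε (n + 1) = a (n + 1) + ε (n + 1) * back a ε n := one_div_one_div _
    rw [show n + 1 + 1 = n + 2 from rfl] at *
    rw [show n + 2 - 1 = n + 1 from rfl, hb, hA', hA]
    have : 1 / (2 - 1 / f) = 1 + skipValue f := by
      have h1 : 2 * f - 1 ≠ 0 := by linarith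
      have h2 : 2 - 1 / f = (2 * f - 1) / f := by field_simp
      rw [h2, one_div_div, skipValue, div_eq_iff h1, add_mul, div_mul_cancel₀ _ h1]
      ring
    rw [this]; linarith
  no_block i k hi := by
    rintro ⟨h1, h2, h3⟩
    obtain ⟨n, rfl⟩ : ∃ n, i = n + 1 := ⟨i - 1, by omega⟩
    have hpos : ∀ j, 2 ≤ a (j + 1) := h.two_le
    have key : ∀ j, j ≤ k → 1 + Real.goldenRatio < 1 / A (n + 1 + j) := by
      have neg : ∀ j, j ≤ k → ε (n + 2 + j) = -1 := by
        intro j hj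
        have h5 := hpos (n + 1 + j)
        rw [show n + 1 + j + 1 = n + 2 + j by ring] at h5
        rcases h.sign_succ (n + 1 + j) with e | e <;>
          rw [show n + 1 + j + 1 = n + 2 + j by ring] at e
        · exfalso
          rcases eq_or_lt_of_le hj with rfl | hj
          · rw [show n + 1 + j + 1 = n + 2 + j by ring, e] at h3
            omega
          · have := h2 (n + 2 + j) (by omega) (by omega)
            rw [e] at this
            omega
        · exact e
      intro j
      induction j with
      | zero =>
        intro _
        have h4 := hpos n
        have ha : a (n + 1) = 2 := by
          rcases h.sign_succ n with e | e <;> rw [e] at h1 <;> omega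
        exact (h.skip_ceil (h.large_of_neg_two ha (neg 0 (by omega)))).2.2.1
      | succ j ih =>
        intro hj
        have h5 := h2 (n + 2 + j) (by omega) (by omega)
        have h6 := neg j (by omega)
        have h7 := neg (j + 1) hj
        rw [h6] at h5
        refine (h.run_step (ih (by omega))).2 ?_ ?_
        · rw [show n + 1 + j + 1 = n + 2 + j by ring]; omega
        · rw [← h7]; congr 1; omega
    have h4 := (h.run_step (key k le_rfl)).1
    rcases h.sign_succ (n + 1 + k) with e | e <;> rw [e] at h3 <;> omega

end IsRounded

/-- One step: `(A, ε, β)` with the tail `A`, its sign `ε` and the reversed expansion `β`. -/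
def RoundsDown (s : ℝ × ℤ × ℝ) : Prop :=
  Int.fract (1 / s.1) < 1 / 2 ∨ Real.goldenRatio < skipValue (Int.fract (1 / s.1)) ∧
    ⌊1 / s.1⌋ + s.2.1 * s.2.2 < skipValue (Int.fract (1 / s.1))

open Classical in
def roundDigit (s : ℝ × ℤ × ℝ) : ℤ := if RoundsDown s then ⌊1 / s.1⌋ else ⌊1 / s.1⌋ + 1

open Classical in
def roundStep (s : ℝ × ℤ × ℝ) : ℝ × ℤ × ℝ :=
  (if RoundsDown s then Int.fract (1 / s.1) else 1 - Int.fract (1 / s.1),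
    if RoundsDown s then 1 else -1, 1 / (roundDigit s + s.2.1 * s.2.2))

def roundState (α : ℝ) : ℕ → ℝ × ℤ × ℝ
  | 0 => (|α - round α|, if (round α : ℝ) < α then 1 else -1, 0)
  | n + 1 => roundStep (roundState α n)

def roundPart (α : ℝ) : ℕ → ℤ
  | 0 => round α
  | n + 1 => roundDigit (roundState α n)

def roundSign (α : ℝ) : ℕ → ℤ
  | 0 => 1
  | n + 1 => (roundState α n).2.1

lemma back_roundPart (α : ℝ) : ∀ n, back (roundPart α) (roundSign α) n = (roundState α n).2.2
  | 0 => rfl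
  | n + 1 => by
    rw [back, back_roundPart α n]; rfl

lemma irrational_roundState {α : ℝ} (h : Irrational α) : ∀ n, Irrational (roundState α n).1
  | 0 => by
    have : Irrational (α - round α) := h.sub_intCast _
    simp only [roundState]
    rcases abs_choice (α - round α) with e | e <;> rw [e]
    · exact this
    · exact this.neg
  | n + 1 => by
    have h1 : Irrational (Int.fract (1 / (roundState α n).1)) := by
      rw [Int.fract, one_div]
      exact (irrational_roundState h n).inv.sub_intCast _
    simp only [roundState, roundStep]
    split_ifs
    · exact h1
    · exact_mod_cast h1.intCast_sub 1

lemma isRounded {α : ℝ} (h : Irrational α) :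
    IsRounded (roundPart α) (roundSign α) (fun n => (roundState α n).1) where
  pos := abs_pos.2 (h.sub_intCast _).ne_zero
  lt_half := by
    refine lt_of_le_of_ne (abs_sub_round α) fun e => ?_
    have h1 : Irrational (|α - round α|) := irrational_roundState h 0
    have h2 : |α - round α| = 1 / 2 := e
    rw [h2] at h1
    exact h1 ⟨1 / 2, by norm_num⟩
  sign := by
    simp only [roundSign, roundState]
    split_ifs <;> simp
  step n := by
    have h1 := (irrational_roundState h n).inv
    rw [← one_div] at h1
    have h2 : Irrational (Int.fract (1 / (roundState α n).1)) := h1.sub_intCast _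
    have h3 := Int.floor_add_fract (1 / (roundState α n).1)
    rw [back_roundPart]
    refine ⟨Int.fract (1 / (roundState α n).1), lt_of_le_of_ne (Int.fract_nonneg _) h2.ne_zero.symm,
      Int.fract_lt_one _, ?_⟩
    -- Irrationality of the tails rules out ties in the rounding.
    have h4 : Int.fract (1 / (roundState α n).1) ≠ 1 / 2 := fun e => h2 ⟨1 / 2, by rw [e]; norm_num⟩
    by_cases hd : RoundsDown (roundState α n)
    · left
      have e1 : roundPart α (n + 1) = ⌊1 / (roundState α n).1⌋ := by
        simp only [roundPart, roundDigit, if_pos hd]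
      refine ⟨?_, ?_, ?_, ?_⟩
      · rw [e1]; exact h3.symm
      · simp only [roundSign, roundState, roundStep, if_pos hd]
      · simp only [roundState, roundStep, if_pos hd]
      · rw [e1]
        rcases lt_or_gt_of_ne h4 with h5 | h5
        · exact Or.inl h5
        · rcases hd with hd | hd
          · linarith
          · exact Or.inr ⟨h5, hd⟩
    · right
      have e1 : roundPart α (n + 1) = ⌊1 / (roundState α n).1⌋ + 1 := by
        simp only [roundPart, roundDigit, if_neg hd]
      refine ⟨?_, ?_, ?_, ?_⟩
      · rw [e1]; push_cast; linarith
      · simp only [roundSign, roundState, roundStep, if_neg hd]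
      · simp only [roundState, roundStep, if_neg hd]
      · rw [e1]
        simp only [RoundsDown, not_or, not_and_or, not_lt] at hd
        refine ⟨lt_of_le_of_ne hd.1 h4.symm, ?_⟩
        push_cast
        rcases hd.2 with hd | hd
        · exact Or.inl hd
        · right; rw [add_sub_cancel_right]; exact hd

/-- Every irrational number has an adjusted nearest integer expansion. -/
theorem exists_isAdjusted {α : ℝ} (h : Irrational α) : ∃ a ε, IsAdjusted α a ε := by
  refine ⟨_, _, (isRounded h).isAdjusted h ?_⟩
  simp only [roundPart, roundSign, roundState]
  split_ifs with hc
  · rw [abs_of_pos (by linarith)]; push_cast; ring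
  · rw [abs_of_nonpos (by linarith)]; push_cast; ring

theorem bound_le_rho {α : ℝ} (h : Irrational α) : (bound : EReal) ≤ rho α := by
  obtain ⟨a, ε, ha⟩ := exists_isAdjusted h
  exact ha.main.2.trans (le_iSup₂ (f := fun γ (_ : γ ∈ (lattice α)ᶜ) => M α γ) _ ha.main.1)

/-! ### Expansions with prescribed partial quotients -/

/-- The continued fractions `[0; a (k + 1), ε (k + 2) * a (k + 2), …]` cut off after `n` terms. -/
def finTail (a ε : ℕ → ℤ) : ℕ → ℕ → ℝ
  | 0, _ => 0
  | n + 1, k => 1 / (a (k + 1) + ε (k + 2) * finTail a ε n (k + 1))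

lemma one_le_den_finTail {a ε : ℕ → ℤ} (hs : ∀ i, 1 ≤ i → ε i = 1 ∨ ε i = -1)
    (ha : ∀ i, 1 ≤ i → 2 ≤ a i) {x : ℝ} (h0 : 0 ≤ x) (h1 : x ≤ 1) (k : ℕ) :
    1 ≤ a (k + 1) + ε (k + 2) * x := by
  have h2 : (2 : ℝ) ≤ a (k + 1) := by exact_mod_cast ha (k + 1) (by omega)
  rcases hs (k + 2) (by omega) with e | e <;> rw [e] <;> push_cast <;> linarith

lemma finTail_mem {a ε : ℕ → ℤ} (hs : ∀ i, 1 ≤ i → ε i = 1 ∨ ε i = -1)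
    (ha : ∀ i, 1 ≤ i → 2 ≤ a i) : ∀ n k, 0 ≤ finTail a ε n k ∧ finTail a ε n k ≤ 1
  | 0, _ => ⟨le_rfl, zero_le_one⟩
  | n + 1, k => by
    obtain ⟨h0, h1⟩ := finTail_mem hs ha n (k + 1)
    have := one_le_den_finTail hs ha h0 h1 k
    rw [finTail]
    exact ⟨by positivity, (div_le_one (by linarith)).2 this⟩

/-- Every sequence of partial quotients has tails. -/
theorem exists_isTails {a ε : ℕ → ℤ} (hs : ∀ i, 1 ≤ i → ε i = 1 ∨ ε i = -1)
    (ha : ∀ i, 1 ≤ i → 2 ≤ a i) : ∃ A, IsTails a ε A := by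
  -- Tails come from compactness of [0, 1]^ℕ: the sequences that satisfy the first n equations form
  -- a decreasing family of nonempty compact sets, the finite continued fractions being witnesses.
  set S : ℕ → Set (ℕ → ℝ) := fun n => (Set.univ.pi fun _ => Set.Icc 0 1) ∩
    {x | ∀ k < n, x k * (a (k + 1) + ε (k + 2) * x (k + 1)) = 1} with hS
  have hclosed : ∀ n, IsClosed {x : ℕ → ℝ | ∀ k < n,
      x k * (a (k + 1) + ε (k + 2) * x (k + 1)) = 1} := by
    intro n
    simp only [Set.ofPred_forall]
    refine isClosed_iInter fun k => isClosed_iInter fun _ => isClosed_eq ?_ continuous_const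
    fun_prop
  have hcomp : IsCompact (Set.univ.pi fun _ : ℕ => Set.Icc (0 : ℝ) 1) :=
    isCompact_univ_pi fun _ => isCompact_Icc
  obtain ⟨A, hA⟩ := IsCompact.nonempty_iInter_of_sequence_nonempty_isCompact_isClosed S
    (fun n x hx => ⟨hx.1, fun k hk => hx.2 k (by omega)⟩)
    (fun n => ⟨fun k => finTail a ε (n - k) k, fun k _ => finTail_mem hs ha _ _, fun k hk => by
      have h1 : n - k = (n - (k + 1)) + 1 := by omega
      obtain ⟨h2, h3⟩ := finTail_mem hs ha (n - (k + 1)) (k + 1)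
      have h4 := one_le_den_finTail hs ha h2 h3 k
      simp only [h1, finTail]
      exact one_div_mul_cancel (by linarith)⟩)
    (hcomp.inter_right (hclosed 0)) (fun n => hcomp.isClosed.inter (hclosed n))
  have h0 : ∀ k, 0 ≤ A k ∧ A k ≤ 1 := fun k => (Set.mem_iInter.1 hA 0).1 k trivial
  have he : ∀ k, A k * (a (k + 1) + ε (k + 2) * A (k + 1)) = 1 := fun k =>
    (Set.mem_iInter.1 hA (k + 1)).2 k (by omega)
  refine ⟨A, hs, ha, fun k => lt_of_le_of_ne (h0 k).1 fun e => ?_, fun k => (h0 k).2, he⟩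
  have := he k
  rw [← e, zero_mul] at this
  exact zero_ne_one this

/-- For rational α the numbers q_k α - p_k have bounded denominator. As products of tails they are
nonzero and tend to 0, a contradiction. -/
lemma IsTails.irrational {a ε : ℕ → ℤ} {A : ℕ → ℝ} (h : IsTails a ε A) {α : ℝ}
    (h0 : α = a 0 + ε 1 * A 0) (hA : ∀ k, A k ≤ 2 / 3) : Irrational α := by
  rintro ⟨r, hr⟩
  have hd : (0 : ℝ) < r.den := by exact_mod_cast r.den_pos
  have hn : α * r.den = r.num := by
    rw [← hr]; exact_mod_cast Rat.mul_den_eq_num r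
  obtain ⟨k, hk⟩ := exists_pow_lt_of_lt_one (one_div_pos.2 hd) (by norm_num : (2 / 3 : ℝ) < 1)
  have h1 := h.delta h0 k
  set P := ∏ i ∈ Finset.range (k + 1), A i with hP
  have hP0 : 0 < P := Finset.prod_pos fun i _ => h.pos i
  have hP1 : P ≤ (2 / 3) ^ (k + 1) := by
    calc P ≤ ∏ _i ∈ Finset.range (k + 1), (2 / 3 : ℝ) :=
          Finset.prod_le_prod (fun i _ => (h.pos i).le) fun i _ => hA i
      _ = _ := by rw [Finset.prod_const, Finset.card_range]
  have hP2 : P * r.den < 1 := by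
    rw [lt_div_iff₀ hd] at hk
    rw [pow_succ] at hP1
    have : (0 : ℝ) < (2 / 3) ^ k := by positivity
    nlinarith
  have h2 : ((den a ε k * r.num - num a ε k * r.den : ℤ) : ℝ) = sgn ε (k + 1) * (P * r.den) := by
    push_cast
    linear_combination (r.den : ℝ) * h1 - (den a ε k : ℝ) * hn
  have h3 : |((den a ε k * r.num - num a ε k * r.den : ℤ) : ℝ)| = P * r.den := by
    rw [h2, abs_mul, abs_of_pos (mul_pos hP0 hd)]
    rcases sgn_sign h.sign (k + 1) with e | e <;> rw [e] <;> simp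
  have h4 : (0 : ℝ) < ((|den a ε k * r.num - num a ε k * r.den| : ℤ) : ℝ) := by
    push_cast at h3 ⊢
    rw [h3]; exact mul_pos hP0 hd
  have h5 : ((|den a ε k * r.num - num a ε k * r.den| : ℤ) : ℝ) < 1 := by
    push_cast at h3 ⊢
    rw [h3]; exact hP2
  have h6 : 0 < |den a ε k * r.num - num a ε k * r.den| := by exact_mod_cast h4
  have h7 : |den a ε k * r.num - num a ε k * r.den| < 1 := by exact_mod_cast h5
  omega

/-- Stated without `IsAdjusted`, because it serves to prove that an expansion is adjusted. -/
lemma back_mem {a ε : ℕ → ℤ} (hs : ∀ i, 1 ≤ i → ε i = 1 ∨ ε i = -1)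
    (ha : ∀ i, 1 ≤ i → 2 ≤ a i) (k : ℕ) : 0 ≤ back a ε k ∧ back a ε k ≤ 1 ∧
      0 < back a ε (k + 1) ∧ back a ε (k + 1) * (a (k + 1) + ε (k + 1) * back a ε k) = 1 := by
  have key : ∀ k, 0 ≤ back a ε k → back a ε k ≤ 1 →
      1 ≤ (a (k + 1) : ℝ) + ε (k + 1) * back a ε k := fun k h0 h1 => by
    have h2 : (2 : ℝ) ≤ a (k + 1) := by exact_mod_cast ha (k + 1) (by omega)
    rcases hs (k + 1) (by omega) with e | e <;> rw [e] <;> push_cast <;> linarith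
  have h1 : 0 ≤ back a ε k ∧ back a ε k ≤ 1 := by
    induction k with
    | zero => simp [back]
    | succ k ih =>
      have := key k ih.1 ih.2
      rw [back]
      exact ⟨by positivity, (div_le_one (by linarith)).2 this⟩
  have h2 := key k h1.1 h1.2
  refine ⟨h1.1, h1.2, ?_, ?_⟩
  · rw [back]; positivity
  · rw [back]; exact one_div_mul_cancel (by linarith)

/-- The partial quotients and signs of a sequence of signed partial quotients. -/
def absDigit (z : ℕ → ℤ) : ℕ → ℤ
  | 0 => 0
  | j + 1 => |z j|

def signDigit (z : ℕ → ℤ) : ℕ → ℤ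
  | 0 => 1
  | j + 1 => if 0 ≤ z j then 1 else -1

/-! ### The periodic sequences are adjusted -/

/-- The local structure of the sequences with period `block k`. -/
structure IsPattern (z : ℕ → ℤ) : Prop where
  mem : ∀ j, z j = 3 ∨ z j = -2 ∨ z j = 2 ∨ z j = -3 ∨ z j = -4
  zero : z 0 = 3
  after_neg_two : ∀ j, z j = -2 → z (j + 1) = 2
  after_neg_three : ∀ j, z j = -3 → z (j + 1) = -4
  after_neg_four : ∀ j, z j = -4 →
    z (j + 1) = -2 ∧ z (j + 2) = 2 ∧ z (j + 3) = 2 ∧ (z (j + 4) = -4 ∨ z (j + 4) = 3)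
  before_neg_four : ∀ j, z j = -4 → ∃ i, (j = i + 1 ∧ z i = -3) ∨ (j = i + 4 ∧ z i = -4)
  before_neg_two : ∀ j, z j = -2 → ∃ i, j = i + 1 ∧ (z i = 3 ∧ z (i + 3) = -3 ∨ z i = -4)
  before_neg_three : ∀ j, z j = -3 → ∃ i, j = i + 3 ∧ z i = 3 ∧ z (i + 1) = -2 ∧ z (i + 2) = 2
  before_three : ∀ j, z (j + 1) = 3 → z j = 3 ∨ z j = 2
  after_two : ∀ j, z j = 2 → z (j + 1) ≠ -2

namespace IsPattern
variable {z : ℕ → ℤ} {A : ℕ → ℝ}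

lemma sign (z : ℕ → ℤ) (i : ℕ) (_ : 1 ≤ i) : signDigit z i = 1 ∨ signDigit z i = -1 := by
  rcases i with _ | i
  · omega
  · simp only [signDigit]; split_ifs <;> simp

lemma two_le (h : IsPattern z) (i : ℕ) (hi : 1 ≤ i) : 2 ≤ absDigit z i := by
  rcases i with _ | i
  · omega
  · simp only [absDigit]
    rcases h.mem i with e | e | e | e | e <;> rw [e] <;> decide

lemma sign_mul_abs (z : ℕ → ℤ) (j : ℕ) : signDigit z (j + 1) * absDigit z (j + 1) = z j := by
  simp only [signDigit, absDigit]
  split_ifs with h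
  · rw [abs_of_nonneg h, one_mul]
  · rw [abs_of_neg (not_le.1 h)]; ring

lemma tail_pos_step (hA : IsTails (absDigit z) (signDigit z) A) {j : ℕ} {m n : ℤ} (hm : z j = m)
    (hn : z (j + 1) = n) (hn0 : 0 ≤ n) : A j * (|m| + A (j + 1)) = 1 := by
  have := hA.eqn j
  simp only [absDigit, signDigit, hm, hn, if_pos hn0] at this
  simpa using this

lemma tail_neg_step (hA : IsTails (absDigit z) (signDigit z) A) {j : ℕ} {m n : ℤ} (hm : z j = m)
    (hn : z (j + 1) = n) (hn0 : n < 0) : A j * (|m| - A (j + 1)) = 1 := by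
  have := hA.eqn j
  simp only [absDigit, signDigit, hm, hn, if_neg (not_le.2 hn0)] at this
  rw [sub_eq_add_neg]
  simpa using this

lemma back_pos_step (h : IsPattern z) {j : ℕ} {m : ℤ} (hm : z j = m) (h0 : 0 ≤ m) :
    back (absDigit z) (signDigit z) (j + 1) * (|m| + back (absDigit z) (signDigit z) j) = 1 := by
  have := (back_mem (sign z) h.two_le j).2.2.2
  simp only [absDigit, signDigit, hm, if_pos h0] at this
  simpa using this

lemma back_neg_step (h : IsPattern z) {j : ℕ} {m : ℤ} (hm : z j = m) (h0 : m < 0) :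
    back (absDigit z) (signDigit z) (j + 1) * (|m| - back (absDigit z) (signDigit z) j) = 1 := by
  have := (back_mem (sign z) h.two_le j).2.2.2
  simp only [absDigit, signDigit, hm, if_neg (not_le.2 h0)] at this
  rw [sub_eq_add_neg]
  simpa using this

lemma tail_le_half_of_ge (hA : IsTails (absDigit z) (signDigit z) A) {j : ℕ} (hj : 3 ≤ |z j|) :
    A j ≤ 1 / 2 := by
  have h1 := hA.eqn j
  have h2 := hA.pos j
  have h3 := hA.pos (j + 1)
  have h4 := hA.le_one (j + 1)
  have h5 : (3 : ℝ) ≤ absDigit z (j + 1) := by exact_mod_cast hj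
  rcases sign z (j + 2) (by omega) with e | e <;> rw [e] at h1 <;> push_cast at h1 <;> nlinarith

lemma tail_le (h : IsPattern z) (hA : IsTails (absDigit z) (signDigit z) A) (j : ℕ) :
    A j ≤ 2 / 3 := by
  have h2 := hA.pos j
  have h3 := hA.pos (j + 1)
  rcases h.mem j with e | e | e | e | e
  · linarith [tail_le_half_of_ge hA (j := j) (by rw [e]; decide)]
  · have h1 := tail_pos_step hA e (h.after_neg_two j e) (by norm_num)
    norm_num at h1; nlinarith
  · rcases h.mem (j + 1) with e' | e' | e' | e' | e'
    · have h1 := tail_pos_step hA e e' (by norm_num)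
      norm_num at h1; nlinarith
    · exact absurd e' (h.after_two j e)
    · have h1 := tail_pos_step hA e e' (by norm_num)
      norm_num at h1; nlinarith
    · have h1 := tail_neg_step hA e e' (by norm_num)
      have := tail_le_half_of_ge hA (j := j + 1) (by rw [e']; decide)
      norm_num at h1; nlinarith
    · have h1 := tail_neg_step hA e e' (by norm_num)
      have := tail_le_half_of_ge hA (j := j + 1) (by rw [e']; decide)
      norm_num at h1; nlinarith
  · linarith [tail_le_half_of_ge hA (j := j) (by rw [e]; decide)]
  · linarith [tail_le_half_of_ge hA (j := j) (by rw [e]; decide)]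

/-- If -4 follows the block again, the loop contracts the excess by a factor of at least ten; if 3
follows, the tail is already below `critTail`. -/
lemma tail_le_critTail_add (h : IsPattern z) (hA : IsTails (absDigit z) (signDigit z) A) (n : ℕ) :
    ∀ j, z j = -4 → A j ≤ critTail + (1 / 10) ^ n := by
  induction n with
  | zero =>
    intro j _
    have := hA.le_one j
    have := critTail_bounds
    norm_num; linarith
  | succ n ih =>
    intro j hj
    have c := critTail_bounds
    obtain ⟨d1, d2, d3, d4⟩ := h.after_neg_four j hj
    have m0 := tail_neg_step hA hj d1 (by norm_num)
    have m1 := tail_pos_step hA d1 d2 (by norm_num)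
    have m2 := tail_pos_step hA d2 d3 (by norm_num)
    have p0 := hA.pos j
    have p1 := hA.pos (j + 1)
    have p2 := hA.pos (j + 2)
    have p3 := hA.pos (j + 3)
    have p4 := hA.pos (j + 4)
    simp only [Nat.add_assoc, Nat.reduceAdd] at m1 m2
    norm_num at m0 m1 m2
    rcases d4 with d4 | d4
    · have m3 := tail_neg_step hA d3 d4 (by norm_num)
      simp only [Nat.add_assoc, Nat.reduceAdd] at m3
      norm_num at m3
      have hl := critTail_loop m0 m1 m2 m3
      have hi := ih (j + 4) d4
      set P := critTail * ((4 - √10) / 2) * ((√10 - 2) / 3) * ((√10 - 2) / 2) with hP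
      have hQ : A j * A (j + 1) * A (j + 2) * A (j + 3) ≤ 1 :=
        mul_le_one₀ (mul_le_one₀ (mul_le_one₀ (hA.le_one _) p1.le (hA.le_one _)) p2.le
          (hA.le_one _)) p3.le (hA.le_one _)
      set Q := A j * A (j + 1) * A (j + 2) * A (j + 3)
      have hQ0 : 0 < Q := mul_pos (mul_pos (mul_pos p0 p1) p2) p3
      have hPQ : Q * P ≤ 1 / 10 := by
        have := critTail_prod.1
        have := critTail_prod.2
        nlinarith
      have hPQ0 : 0 ≤ Q * P := mul_nonneg hQ0.le critTail_prod.1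
      have hp : (0 : ℝ) < (1 / 10) ^ n := by positivity
      have : A (j + 4) - critTail ≤ (1 / 10) ^ n := by linarith
      rw [pow_succ]
      nlinarith
    · have m3 := tail_pos_step hA d3 d4 (by norm_num)
      simp only [Nat.add_assoc, Nat.reduceAdd] at m3
      norm_num at m3
      have hp : (0 : ℝ) < (1 / 10) ^ (n + 1) := by positivity
      have l3 := gt_of_mul_eq_one m3 p3 0.5001 1.9999 (by linarith) (by norm_num) (by norm_num)
      have l2 := lt_of_mul_eq_one m2 p2 0.3999 2.5002 (by linarith) (by norm_num)
      have l1 := gt_of_mul_eq_one m1 p1 0.4168 2.3998 (by linarith) (by norm_num) (by norm_num)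
      have l0 := gt_of_mul_eq_one m0 p0 0.2792 3.5831 (by linarith) (by norm_num) (by norm_num)
      linarith

lemma tail_le_critTail (h : IsPattern z) (hA : IsTails (absDigit z) (signDigit z) A) {j : ℕ}
    (hj : z j = -4) : A j ≤ critTail := by
  have h1 : Tendsto (fun n : ℕ => critTail + (1 / 10 : ℝ) ^ n) atTop (𝓝 (critTail + 0)) :=
    (tendsto_pow_atTop_nhds_zero_of_lt_one (by norm_num) (by norm_num)).const_add _
  rw [add_zero] at h1
  exact ge_of_tendsto' h1 fun n => h.tail_le_critTail_add hA n j hj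

/-- Comparison with the reversed periodic expansion: passing through the four digits changes the
sign of the deviation twice, so the strict inequality is reproduced, and the value after two digits
is obtained on the way. -/
lemma back_loop (h : IsPattern z) {j : ℕ} (hj : z j = -4)
    (hb : back (absDigit z) (signDigit z) j < (4 - √10) / 2) :
    back (absDigit z) (signDigit z) (j + 2) < (√10 - 2) / 2 ∧
      back (absDigit z) (signDigit z) (j + 4) < (4 - √10) / 2 := by
  have hr : √10 ^ 2 = 10 := Real.sq_sqrt (by norm_num)
  obtain ⟨r1, r2⟩ := sqrt_ten_bounds
  obtain ⟨d1, d2, d3, -⟩ := h.after_neg_four j hj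
  have b1 := h.back_neg_step hj (by norm_num)
  have b2 := h.back_neg_step d1 (by norm_num)
  have b3 := h.back_pos_step d2 (by norm_num)
  have b4 := h.back_pos_step d3 (by norm_num)
  have p1 := (back_mem (sign z) h.two_le j).2.2.1
  have p2 := (back_mem (sign z) h.two_le (j + 1)).2.2.1
  have p3 := (back_mem (sign z) h.two_le (j + 2)).2.2.1
  have p4 := (back_mem (sign z) h.two_le (j + 3)).2.2.1
  simp only [Nat.add_assoc, Nat.reduceAdd] at b2 b3 b4 p2 p3 p4
  norm_num at b1 b2 b3 b4
  generalize back (absDigit z) (signDigit z) j = B at *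
  generalize back (absDigit z) (signDigit z) (j + 1) = B1 at *
  generalize back (absDigit z) (signDigit z) (j + 2) = B2 at *
  generalize back (absDigit z) (signDigit z) (j + 3) = B3 at *
  generalize back (absDigit z) (signDigit z) (j + 4) = B4 at *
  generalize √10 = r at *
  have e1 : (4 - r) / 3 - B1 = B1 * ((4 - r) / 3) * ((4 - r) / 2 - B) := by
    linear_combination -(4 - r) / 3 * b1 - B1 / 6 * hr
  have e2 : (r - 2) / 2 - B2 = B2 * ((r - 2) / 2) * ((4 - r) / 3 - B1) := by
    linear_combination -(r - 2) / 2 * b2 + B2 / 6 * hr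
  have e3 : B3 - (r - 2) / 3 = B3 * ((r - 2) / 3) * ((r - 2) / 2 - B2) := by
    linear_combination (r - 2) / 3 * b3 - B3 / 6 * hr
  have e4 : (4 - r) / 2 - B4 = B4 * ((4 - r) / 2) * (B3 - (r - 2) / 3) := by
    linear_combination -(4 - r) / 2 * b4 - B4 / 6 * hr
  have l1 : 0 < (4 - r) / 3 - B1 := by
    rw [e1]; exact mul_pos (mul_pos p1 (by linarith)) (by linarith)
  have l2 : 0 < (r - 2) / 2 - B2 := by
    rw [e2]; exact mul_pos (mul_pos p2 (by linarith)) (by linarith)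
  have l3 : 0 < B3 - (r - 2) / 3 := by
    rw [e3]; exact mul_pos (mul_pos p3 (by linarith)) (by linarith)
  have l4 : 0 < (4 - r) / 2 - B4 := by
    rw [e4]; exact mul_pos (mul_pos p4 (by linarith)) (by linarith)
  constructor <;> linarith

lemma back_lt (h : IsPattern z) (j : ℕ) : z j = -4 →
    back (absDigit z) (signDigit z) j < (4 - √10) / 2 := by
  induction j using Nat.strong_induction_on with
  | _ j ih =>
    intro hj
    obtain ⟨r1, r2⟩ := sqrt_ten_bounds
    obtain ⟨i, ⟨rfl, hi⟩ | ⟨rfl, hi⟩⟩ := h.before_neg_four j hj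
    · obtain ⟨l, rfl, -, -, hl⟩ := h.before_neg_three i hi
      have b1 := h.back_pos_step hl (by norm_num)
      have b2 := h.back_neg_step hi (by norm_num)
      have p0 := (back_mem (sign z) h.two_le (l + 2)).1
      have p1 := (back_mem (sign z) h.two_le (l + 2)).2.2.1
      have p2 := (back_mem (sign z) h.two_le (l + 3)).2.2.1
      simp only [Nat.add_assoc, Nat.reduceAdd] at b1 b2 p1 p2 ⊢
      norm_num at b1 b2
      have l1 := gt_of_mul_eq_one b1 p1 0.5001 1.9999 (by linarith) (by norm_num) (by norm_num)
      have l2 := gt_of_mul_eq_one b2 p2 0.4001 2.4999 (by linarith) (by norm_num) (by norm_num)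
      linarith
    · exact (h.back_loop hi (ih i (by omega) hi)).2

/-- Inside the loops the conditions (ii) and (iii) are tight in the limit. For (ii) the bounds used
are (4 - √10)/2 and (√10 - 2)/2, with sum exactly 1; for (iii) they are (4 + √10)/2 and 2 + (√10 -
2)/2, with difference exactly 1. The strict bound from `back_lt` and `back_loop` secures the strict
inequality in (iii). -/
theorem isAdjusted (h : IsPattern z) (hA : IsTails (absDigit z) (signDigit z) A) :
    IsAdjusted (A 0) (absDigit z) (signDigit z) := by
  have h0 : A 0 = (absDigit z 0 : ℝ) + signDigit z 1 * A 0 := by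
    simp [absDigit, signDigit, h.zero]
  have ht := hA.tail_eq h0
  have hinv : ∀ {x y : ℝ}, 0 < x → x * y = 1 → 1 / x = y := fun hx hxy => by
    rw [div_eq_iff hx.ne']; linarith
  have hnext : ∀ {j}, signDigit z (j + 1) = -1 → z j = -2 ∨ z j = -3 ∨ z j = -4 := by
    intro j hj
    simp only [signDigit] at hj
    rcases h.mem j with e | e | e | e | e <;> simp [e] at hj ⊢
  have htwo : ∀ {j}, absDigit z (j + 1) = 2 → z j = 2 ∨ z j = -2 := by
    intro j hj
    simp only [absDigit] at hj
    rcases h.mem j with e | e | e | e | e <;> simp [e] at hj ⊢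
  obtain ⟨r1, r2⟩ := sqrt_ten_bounds
  have hr : √10 ^ 2 = 10 := Real.sq_sqrt (by norm_num)
  obtain ⟨c1, c2⟩ := critTail_bounds
  refine ⟨hA.irrational h0 (h.tail_le hA), sign z, h.two_le, hA.tendsto h0, ?_, ?_, ?_, ?_, ?_⟩
  · have h1 := hA.eqn 0
    have h2 := hA.pos 0
    have h3 := h.tail_le hA 1
    have h4 := hA.pos 1
    have h5 : (absDigit z 1 : ℝ) = 3 := by simp [absDigit, h.zero]
    rw [zero_add, h5] at h1
    have h6 : (absDigit z 0 : ℝ) = 0 := by simp [absDigit]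
    rw [h6, sub_zero, abs_of_pos h2]
    rcases sign z 2 (by omega) with e | e <;> rw [e] at h1 <;> push_cast at h1 <;> nlinarith
  · intro i hi ha
    obtain ⟨j, rfl⟩ : ∃ j, i = j + 1 := ⟨i - 1, by omega⟩
    rcases htwo ha with e | e
    · left; simp [signDigit, e]
    · right; simp [signDigit, h.after_neg_two j e]
  · intro i hi ha hs
    obtain ⟨j, rfl⟩ : ∃ j, i = j + 1 := ⟨i - 1, by omega⟩
    have hj : z j = -2 := by
      rcases htwo ha with e | e
      · simp [signDigit, e] at hs
      · exact e
    obtain ⟨i, rfl, hi'⟩ := h.before_neg_two j hj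
    have hz2 := h.after_neg_two _ hj
    rw [ht, show i + 1 + 1 - 1 = i + 1 from rfl]
    have p1 := (back_mem (sign z) h.two_le i).2.2.1
    have q2 := hA.pos (i + 2)
    have q3 := hA.pos (i + 3)
    rcases hi' with ⟨d0, d3⟩ | d0
    · have b := h.back_pos_step d0 (by norm_num)
      have t := tail_neg_step hA hz2 d3 (by norm_num)
      rw [hinv p1 b, hinv q2 t]
      have := (back_mem (sign z) h.two_le i).1
      norm_num
      linarith
    · obtain ⟨d1, d2, d3, d4⟩ := h.after_neg_four i d0
      have b := h.back_neg_step d0 (by norm_num)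
      have t := tail_pos_step hA d2 d3 (by norm_num)
      rw [hinv p1 b, hinv q2 t]
      have hb := h.back_lt i d0
      have ht3 : A (i + 3) ≤ (√10 - 2) / 2 := by
        rcases d4 with d4 | d4
        · have t3 := tail_neg_step hA d3 d4 (by norm_num)
          have t4 := h.tail_le_critTail hA d4
          simp only [Nat.add_assoc, Nat.reduceAdd] at t3
          norm_num at t3
          have : 1 ≤ (√10 - 2) / 2 * (2 - A (i + 4)) := by
            have : (√10 - 2) / 2 * (2 - critTail) = 1 := by
              rw [critTail]; linear_combination hr / 6
            nlinarith
          by_contra hc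
          nlinarith
        · have t3 := tail_pos_step hA d3 d4 (by norm_num)
          have := hA.pos (i + 4)
          simp only [Nat.add_assoc, Nat.reduceAdd] at t3
          norm_num at t3
          nlinarith
      norm_num
      linarith
  · intro i hi ha hs
    obtain ⟨j, rfl⟩ : ∃ j, i = j + 1 := ⟨i - 1, by omega⟩
    have hj : z j = 2 := by
      rcases htwo ha with e | e
      · exact e
      · simp [signDigit, h.after_neg_two j e] at hs
    rw [ht, show j + 1 - 1 = j from rfl]
    have q1 := hA.pos (j + 1)
    rcases hnext hs with d | d | d
    · exact absurd d (h.after_two j hj)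
    · obtain ⟨i, hij, d0, d1, d2⟩ := h.before_neg_three _ d
      obtain rfl : j = i + 2 := by omega
      have d4 := h.after_neg_three _ d
      have t := tail_neg_step hA d d4 (by norm_num)
      have t4 := h.tail_le_critTail hA d4
      have b1 := h.back_pos_step d0 (by norm_num)
      have b2 := h.back_neg_step d1 (by norm_num)
      have p1 := (back_mem (sign z) h.two_le i).2.2.1
      have p2 := (back_mem (sign z) h.two_le (i + 1)).2.2.1
      rw [hinv q1 t, hinv p2 b2]
      have hb : back (absDigit z) (signDigit z) i ≤ 1 / 2 := by
        rcases i with _ | i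
        · simp [back]
        · have p0 := (back_mem (sign z) h.two_le i).2.2.1
          have p00 := (back_mem (sign z) h.two_le i).1
          rcases h.before_three i d0 with e | e
          · have b := h.back_pos_step e (by norm_num)
            norm_num at b; nlinarith
          · have b := h.back_pos_step e (by norm_num)
            norm_num at b; nlinarith
      norm_num at b1
      have l1 := lt_of_mul_eq_one b1 p1 0.285 3.5001 (by linarith) (by norm_num)
      norm_num
      linarith
    · obtain ⟨i, ⟨hij, d0⟩ | ⟨hij, d0⟩⟩ := h.before_neg_four _ d
      · obtain rfl : j = i := by omega
        omega
      · obtain rfl : j = i + 3 := by omega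
        obtain ⟨d1, d2, d3, -⟩ := h.after_neg_four i d0
        have b := h.back_pos_step d2 (by norm_num)
        have p3 := (back_mem (sign z) h.two_le (i + 2)).2.2.1
        rw [hinv p3 b]
        have hb := (h.back_loop d0 (h.back_lt i d0)).1
        have t := h.tail_le_critTail hA d
        have : (4 + √10) / 2 ≤ 1 / A (i + 3 + 1) := by
          rw [le_div_iff₀ q1]
          have : (4 + √10) / 2 * critTail = 1 := by rw [critTail]; linear_combination -hr / 6
          nlinarith
        rw [one_div] at this
        norm_num
        linarith
  · rintro i k hi ⟨h1, h2, h3⟩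
    obtain ⟨j, rfl⟩ : ∃ j, i = j + 1 := ⟨i - 1, by omega⟩
    rw [sign_mul_abs] at h1
    rw [show j + 1 + k + 1 = (j + k + 1) + 1 by ring, sign_mul_abs] at h3
    rcases k with _ | k
    · exact h.after_two j h1 h3
    · have e := h2 (j + 2) (by omega) (by omega)
      rw [sign_mul_abs] at e
      have e' := h.after_neg_three _ e
      rcases k with _ | k
      · rw [show j + (0 + 1) + 1 = j + 1 + 1 by ring] at h3
        omega
      · have e := h2 (j + 3) (by omega) (by omega)
        rw [sign_mul_abs] at e
        rw [show j + 1 + 1 = j + 2 by ring] at e'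
        omega

end IsPattern

/-! ### The digits of the period -/

/-- The entries of `block k`. -/
def blockDigit (k p : ℕ) : ℤ :=
  if p < k then 3 else if p = k then -2 else if p = k + 1 then 2 else if p = k + 2 then -3
  else if (p - (k + 3)) % 4 = 0 then -4 else if (p - (k + 3)) % 4 = 1 then -2 else 2

lemma length_block (k : ℕ) : (block k).length = 5 * k + 3 := by
  simp [block]; ring

lemma getD_flatten_replicate (l : List ℤ) (hl : l.length = 4) : ∀ k p, p < 4 * k →
    (List.replicate k l).flatten.getD p 0 = l.getD (p % 4) 0
  | 0, p, h => by omega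
  | k + 1, p, h => by
    rw [List.replicate_succ, List.flatten_cons]
    rcases lt_or_ge p 4 with hp | hp
    · rw [List.getD_append _ _ _ _ (by omega), Nat.mod_eq_of_lt hp]
    · rw [List.getD_append_right _ _ _ _ (by omega), hl,
        getD_flatten_replicate l hl k (p - 4) (by omega)]
      congr 1; omega

lemma getD_block {k p : ℕ} (hp : p < 5 * k + 3) : (block k).getD p 0 = blockDigit k p := by
  rw [block, List.append_assoc, blockDigit]
  rcases lt_or_ge p k with h | h
  · rw [List.getD_append _ _ _ _ (by simpa using h), if_pos h,
      List.getD_eq_getElem _ _ (by simpa using h)]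
    simp
  · rw [List.getD_append_right _ _ _ _ (by simpa using h), if_neg (by omega), List.length_replicate]
    rcases lt_or_ge p (k + 3) with h3 | h3
    · rw [List.getD_append _ _ _ _ (by simp; omega)]
      obtain rfl | rfl | rfl : p = k ∨ p = k + 1 ∨ p = k + 2 := by omega
      · simp
      · simp
      · simp
    · rw [List.getD_append_right _ _ _ _ (by simp; omega), if_neg (by omega), if_neg (by omega),
        if_neg (by omega), getD_flatten_replicate _ rfl _ _ (by simp; omega)]
      have e : p - k - [(-2 : ℤ), 2, -3].length = p - (k + 3) := by simp; omega
      rw [e]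
      have h4 := Nat.mod_lt (p - (k + 3)) (by norm_num : 0 < 4)
      interval_cases (p - (k + 3)) % 4 <;> simp

lemma blockDigit_eq_three {k p : ℕ} : blockDigit k p = 3 ↔ p < k := by
  rw [blockDigit]; split_ifs <;> norm_num <;> omega

lemma blockDigit_eq_neg_two {k p : ℕ} : blockDigit k p = -2 ↔
    p = k ∨ (k + 3 ≤ p ∧ (p - (k + 3)) % 4 = 1) := by
  rw [blockDigit]; split_ifs <;> norm_num <;> omega

lemma blockDigit_eq_two {k p : ℕ} : blockDigit k p = 2 ↔
    p = k + 1 ∨ (k + 3 ≤ p ∧ 2 ≤ (p - (k + 3)) % 4) := by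
  rw [blockDigit]; split_ifs <;> norm_num <;> omega

lemma blockDigit_eq_neg_three {k p : ℕ} : blockDigit k p = -3 ↔ p = k + 2 := by
  rw [blockDigit]; split_ifs <;> norm_num <;> omega

lemma blockDigit_eq_neg_four {k p : ℕ} : blockDigit k p = -4 ↔
    k + 3 ≤ p ∧ (p - (k + 3)) % 4 = 0 := by
  rw [blockDigit]; split_ifs <;> norm_num <;> omega

lemma succ_mod_cases {L : ℕ} (hL : 0 < L) (j : ℕ) :
    ((j + 1) % L = j % L + 1 ∧ j % L + 1 < L) ∨ ((j + 1) % L = 0 ∧ j % L + 1 = L) := by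
  have h := Nat.mod_lt j hL
  rcases eq_or_lt_of_le (Nat.succ_le_of_lt h) with e | e
  · right
    refine ⟨?_, e⟩
    rw [← Nat.mod_add_mod, show j % L + 1 = L from e, Nat.mod_self]
  · left
    refine ⟨?_, e⟩
    rw [← Nat.mod_eq_of_lt (a := j % L + 1) e, Nat.mod_add_mod]

lemma isPattern_block {k : ℕ} (hk : 1 ≤ k) : IsPattern fun j => blockDigit k (j % (5 * k + 3)) := by
  have hs := succ_mod_cases (L := 5 * k + 3) (by omega)
  have hlt : ∀ j, j % (5 * k + 3) < 5 * k + 3 := fun j => Nat.mod_lt _ (by omega)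
  have hle : ∀ j, j % (5 * k + 3) ≤ j := fun j => Nat.mod_le _ _
  have hsucc : ∀ j, 1 ≤ j → ∃ i, j = i + 1 := fun j h => ⟨j - 1, by omega⟩
  constructor
  · intro j
    simp only [blockDigit_eq_three, blockDigit_eq_neg_two, blockDigit_eq_two,
      blockDigit_eq_neg_three, blockDigit_eq_neg_four]
    have := hlt j
    omega
  · simp only [Nat.zero_mod, blockDigit_eq_three]; omega
  · intro j
    simp only [blockDigit_eq_neg_two, blockDigit_eq_two]
    have := hlt j
    have := hs j
    omega
  · intro j
    simp only [blockDigit_eq_neg_three, blockDigit_eq_neg_four]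
    have := hlt j
    have := hs j
    omega
  · intro j
    simp only [blockDigit_eq_three, blockDigit_eq_neg_two, blockDigit_eq_two,
      blockDigit_eq_neg_four]
    have := hlt j
    have h1 := hs j
    have h2 := hs (j + 1)
    have h3 := hs (j + 2)
    have h4 := hs (j + 3)
    simp only [Nat.add_assoc, Nat.reduceAdd] at h2 h3 h4
    intro h
    refine ⟨?_, ?_, ?_, ?_⟩ <;> omega
  · intro j h
    rw [blockDigit_eq_neg_four] at h
    have := hle j
    rcases lt_or_ge (j % (5 * k + 3)) (k + 4) with h0 | h0
    · obtain ⟨i, rfl⟩ := hsucc j (by omega)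
      refine ⟨i, Or.inl ⟨rfl, ?_⟩⟩
      rw [blockDigit_eq_neg_three]
      have := hs i
      omega
    · obtain ⟨i, rfl⟩ : ∃ i, j = i + 4 := ⟨j - 4, by omega⟩
      refine ⟨i, Or.inr ⟨rfl, ?_⟩⟩
      rw [blockDigit_eq_neg_four]
      have h1 := hs i
      have h2 := hs (i + 1)
      have h3 := hs (i + 2)
      have h4 := hs (i + 3)
      simp only [Nat.add_assoc, Nat.reduceAdd] at h2 h3 h4
      omega
  · intro j h
    rw [blockDigit_eq_neg_two] at h
    have := hle j
    obtain ⟨i, rfl⟩ := hsucc j (by omega)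
    refine ⟨i, rfl, ?_⟩
    simp only [blockDigit_eq_neg_four, blockDigit_eq_three, blockDigit_eq_neg_three]
    have h1 := hs i
    have h2 := hs (i + 1)
    have h3 := hs (i + 2)
    have := hlt i
    simp only [Nat.add_assoc, Nat.reduceAdd] at h2 h3
    omega
  · intro j h
    rw [blockDigit_eq_neg_three] at h
    have := hle j
    obtain ⟨i, rfl⟩ : ∃ i, j = i + 3 := ⟨j - 3, by omega⟩
    refine ⟨i, rfl, ?_⟩
    simp only [blockDigit_eq_two, blockDigit_eq_three, blockDigit_eq_neg_two]
    have h1 := hs i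
    have h2 := hs (i + 1)
    have h3 := hs (i + 2)
    have := hlt i
    simp only [Nat.add_assoc, Nat.reduceAdd] at h2 h3
    refine ⟨?_, ?_, ?_⟩ <;> omega
  · intro j
    simp only [blockDigit_eq_two, blockDigit_eq_three]
    have h1 := hs j
    have := hlt j
    omega
  · intro j
    simp only [ne_eq, blockDigit_eq_two, blockDigit_eq_neg_two]
    have h1 := hs j
    have := hlt j
    omega

/-- There are adjusted nearest integer expansions with the period `block k`. -/
theorem exists_periodic {k : ℕ} (hk : 1 ≤ k) :
    ∃ α a ε, IsAdjusted α a ε ∧ PeriodicFrom 0 (block k) a ε := by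
  have h := isPattern_block hk
  obtain ⟨A, hA⟩ := exists_isTails (IsPattern.sign _) h.two_le
  refine ⟨A 0, _, _, h.isAdjusted hA, fun j => ?_⟩
  rw [show 0 + 1 + j = j + 1 by ring, IsPattern.sign_mul_abs, length_block,
    getD_block (Nat.mod_lt _ (by omega))]

/-! ### The bound is approached -/

/-- The normalised product of distances at the critical vertex. -/
def criticalValue (p : ℝ × ℝ × ℝ × ℝ) : ℝ :=
  (7 + 3 * p.1 + p.2.1) * (1 - p.2.2.1 + p.2.2.2) /
    (34 - 13 * p.2.2.1 + (13 - 5 * p.2.2.1) * p.1)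

lemma critical_den_pos {b t : ℝ} (hb : 0 ≤ b) (ht : t ≤ 1) : 0 < 34 - 13 * t + (13 - 5 * t) * b :=
  add_pos_of_pos_of_nonneg (by linarith) (mul_nonneg (by linarith) hb)

/-- The limit of `xi` along the partial quotients `3, 3, …`. -/
def critXi : ℝ := -((√13 - 1) / 6)

lemma critXi_bounds : -0.4343 < critXi ∧ critXi < -0.4342 := by
  obtain ⟨s1, s2⟩ := sqrt_thirteen_bounds
  constructor <;> rw [critXi] <;> linarith

lemma critXi_eq : critXi = -(critBack * (1 - critXi)) := by
  have hs : √13 ^ 2 = 13 := Real.sq_sqrt (by norm_num)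
  rw [critXi, critBack]; linear_combination hs / 12

/-- At the limit point both extremal inequalities are equalities and the offset `eta` vanishes; by
`line_eq` the product is then exactly four times the constant. -/
lemma criticalValue_crit : criticalValue (critBack, critXi, critTail, 0) = 4 * bound := by
  obtain ⟨b1, -⟩ := critBack_bounds
  obtain ⟨-, c2⟩ := critTail_bounds
  have hd := critical_den_pos (b := critBack) (t := critTail) (by linarith) (by linarith)
  have h1 := line_eq
  rw [lineA, lineB] at h1
  rw [criticalValue, div_eq_iff hd.ne', ← critSlope_mul, critXi]
  linear_combination (1 - critTail) * h1

lemma exists_ball {δ : ℝ} (hδ : 0 < δ) : ∃ r > 0, ∀ b x t y : ℝ, |b - critBack| < r →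
    |x - critXi| < r → |t - critTail| < r → |y| < r →
      criticalValue (b, x, t, y) < 4 * bound + δ := by
  obtain ⟨b1, -⟩ := critBack_bounds
  obtain ⟨-, c2⟩ := critTail_bounds
  have hd := critical_den_pos (b := critBack) (t := critTail) (by linarith) (by linarith)
  have hc : ContinuousAt criticalValue (critBack, critXi, critTail, 0) := by
    unfold criticalValue
    exact ContinuousAt.div (by fun_prop) (by fun_prop) hd.ne'
  have := (tendsto_order.1 hc).2 (4 * bound + δ) (by rw [criticalValue_crit]; linarith)
  obtain ⟨r, hr, h⟩ := Metric.eventually_nhds_iff.1 this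
  refine ⟨r, hr, fun b x t y h1 h2 h3 h4 => h ?_⟩
  simp only [Prod.dist_eq, Real.dist_eq, sub_zero]
  exact max_lt h1 (max_lt h2 (max_lt h3 h4))

namespace IsAdjusted
variable {α : ℝ} {a ε : ℕ → ℤ}

/-- `back` contracts by about 0.1 and `xi` by 1/3, but the change of `back` also enters `xi`, with a
factor below 1.44. In the sum of the two deviations everything stays below 1/2. -/
lemma back_three_contraction (h : IsAdjusted α a ε) {j : ℕ} (ha : a (j + 1) = 3)
    (he : ε (j + 1) = 1) :
    |back a ε (j + 1) - critBack| + |xi a ε (j + 1) - critXi| ≤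
      (|back a ε j - critBack| + |xi a ε j - critXi|) / 2 := by
  have e1 := h.back_mul j
  have p1 := h.back_pos j
  have p0 := h.back_nonneg j
  have x1 := xi_odd (ε := ε) (a := a) (k := j) (by rw [ha]; decide)
  rw [ha, he] at e1
  rw [he] at x1
  push_cast at e1 x1
  have c := critBack_eq
  have cx := critXi_eq
  obtain ⟨c1, c2⟩ := critBack_bounds
  obtain ⟨d1, d2⟩ := critXi_bounds
  have hb : back a ε (j + 1) ≤ 1 / 3 := by nlinarith
  set b := back a ε j
  set b' := back a ε (j + 1)
  set x := xi a ε j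
  have f1 : b' - critBack = -(b' * critBack) * (b - critBack) := by
    linear_combination critBack * e1 - b' * c
  have f2 : xi a ε (j + 1) - critXi = b' * (x - critXi) - (1 - critXi) * (b' - critBack) := by
    rw [x1]; linear_combination -cx
  have g1 : |b' - critBack| ≤ 0.101 * |b - critBack| := by
    rw [f1, abs_mul, abs_neg, abs_of_nonneg (by positivity)]
    refine mul_le_mul_of_nonneg_right ?_ (abs_nonneg _)
    nlinarith
  have g2 : |xi a ε (j + 1) - critXi| ≤ 1 / 3 * |x - critXi| + 1.4343 * |b' - critBack| := by
    rw [f2]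
    refine (abs_sub _ _).trans (add_le_add ?_ ?_)
    · rw [abs_mul, abs_of_pos p1]
      exact mul_le_mul_of_nonneg_right hb (abs_nonneg _)
    · rw [abs_mul, abs_of_pos (by linarith : 0 < 1 - critXi)]
      exact mul_le_mul_of_nonneg_right (by linarith) (abs_nonneg _)
  have := abs_nonneg (b - critBack)
  have := abs_nonneg (x - critXi)
  linarith

lemma back_threes (h : IsAdjusted α a ε) {j : ℕ} : ∀ i : ℕ,
    (∀ l < i, a (j + l + 1) = 3 ∧ ε (j + l + 1) = 1) →
    |back a ε (j + i) - critBack| + |xi a ε (j + i) - critXi| ≤ 2 * (1 / 2) ^ i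
  | 0, _ => by
    obtain ⟨c1, c2⟩ := critBack_bounds
    obtain ⟨d1, d2⟩ := critXi_bounds
    have h1 := h.back_nonneg j
    have h2 := h.back_le j
    obtain ⟨h3, h4⟩ := abs_le.1 (h.abs_xi_le j)
    have f1 : |back a ε j - critBack| ≤ 1 := abs_le.2 ⟨by linarith, by linarith⟩
    have f2 : |xi a ε j - critXi| ≤ 1 := abs_le.2 ⟨by linarith, by linarith⟩
    norm_num; linarith
  | i + 1, hi => by
    have h1 := h.back_threes i fun l hl => hi l (by omega)
    obtain ⟨h2, h3⟩ := hi i (by omega)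
    have h4 := h.back_three_contraction h2 h3
    rw [pow_succ, ← add_assoc]
    linarith

/-- The signed partial quotients `-4, -2, 2, 2` occur to the right of the position `m`, followed
by a negative one. -/
def IsLoop (a ε : ℕ → ℤ) (m : ℕ) : Prop :=
  a (m + 1) = 4 ∧ a (m + 2) = 2 ∧ ε (m + 2) = -1 ∧ a (m + 3) = 2 ∧ ε (m + 3) = 1 ∧
    a (m + 4) = 2 ∧ ε (m + 4) = 1 ∧ ε (m + 5) = -1

/-- All four digits are even, so the offset is multiplied by the product of four tails, each at most
2/3; the deviation of the tail gains a further small factor from `critTail_loop`. -/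
lemma tail_loop (h : IsAdjusted α a ε) {m : ℕ} (hm : IsLoop a ε m) :
    |tail α a ε m - critTail| ≤ 1 / 2 * |tail α a ε (m + 4) - critTail| ∧
      eta α a ε m ≤ 1 / 2 * eta α a ε (m + 4) := by
  obtain ⟨a1, a2, e2, a3, e3, a4, e4, e5⟩ := hm
  have m0 := h.tail_mul m
  have m1 := h.tail_mul (m + 1)
  have m2 := h.tail_mul (m + 2)
  have m3 := h.tail_mul (m + 3)
  have y0 := h.eta_even (k := m) (by rw [a1]; decide)
  have y1 := h.eta_even (k := m + 1) (by rw [a2]; decide)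
  have y2 := h.eta_even (k := m + 2) (by rw [a3]; decide)
  have y3 := h.eta_even (k := m + 3) (by rw [a4]; decide)
  simp only [Nat.add_assoc, Nat.reduceAdd] at m0 m1 m2 m3 y0 y1 y2 y3
  rw [a1, e2] at m0
  rw [a2, e3] at m1
  rw [a3, e4] at m2
  rw [a4, e5] at m3
  push_cast at m0 m1 m2 m3
  have hl := critTail_loop (α := tail α a ε m) (α₁ := tail α a ε (m + 1))
    (α₂ := tail α a ε (m + 2)) (α₃ := tail α a ε (m + 3)) (α₄ := tail α a ε (m + 4))
    (by linarith) (by linarith) (by linarith) (by linarith)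
  obtain ⟨P0, P1⟩ := critTail_prod
  set P := critTail * ((4 - √10) / 2) * ((√10 - 2) / 3) * ((√10 - 2) / 2)
  have p0 := h.tail_pos m
  have p1 := h.tail_pos (m + 1)
  have p2 := h.tail_pos (m + 2)
  have p3 := h.tail_pos (m + 3)
  have q01 := mul_le_mul (h.tail_le m) (h.tail_le (m + 1)) p1.le (by norm_num)
  have q02 := mul_le_mul q01 (h.tail_le (m + 2)) p2.le (by norm_num)
  have q03 := mul_le_mul q02 (h.tail_le (m + 3)) p3.le (by norm_num)
  have hQ0 : 0 < tail α a ε m * tail α a ε (m + 1) * tail α a ε (m + 2) * tail α a ε (m + 3) :=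
    mul_pos (mul_pos (mul_pos p0 p1) p2) p3
  have hy : eta α a ε m = tail α a ε m * tail α a ε (m + 1) * tail α a ε (m + 2) *
      tail α a ε (m + 3) * eta α a ε (m + 4) := by
    rw [y0, y1, y2, y3]; ring
  set Q := tail α a ε m * tail α a ε (m + 1) * tail α a ε (m + 2) * tail α a ε (m + 3)
  norm_num at q03
  constructor
  · rw [hl, abs_mul, abs_of_nonneg (mul_nonneg hQ0.le P0)]
    refine mul_le_mul_of_nonneg_right ?_ (abs_nonneg _)
    nlinarith
  · rw [hy]
    exact mul_le_mul_of_nonneg_right (by linarith) (h.eta_nonneg _)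

lemma tail_loops (h : IsAdjusted α a ε) : ∀ (i m : ℕ), (∀ l < i, IsLoop a ε (m + 4 * l)) →
    |tail α a ε m - critTail| ≤ (1 / 2) ^ i ∧ eta α a ε m ≤ (1 / 2) ^ i
  | 0, m, _ => by
    obtain ⟨c1, c2⟩ := critTail_bounds
    have h1 := h.tail_pos m
    have h2 := h.tail_le m
    have h3 := h.eta_le m
    refine ⟨abs_le.2 ⟨?_, ?_⟩, ?_⟩ <;> norm_num <;> linarith
  | i + 1, m, hi => by
    obtain ⟨h1, h2⟩ := h.tail_loops i (m + 4) fun l hl => by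
      have := hi (l + 1) (by omega)
      rwa [show m + 4 + 4 * l = m + 4 * (l + 1) by ring]
    obtain ⟨h3, h4⟩ := h.tail_loop (m := m) (hi 0 (by omega))
    rw [pow_succ]
    constructor <;> linarith

/-- Every pair of odd coordinates belongs to a grid point. -/
lemma exists_coord (h : IsAdjusted α a ε) : ∀ (m : ℕ) {p q : ℤ}, Odd p → Odd q →
    ∃ u w, Odd u ∧ Odd w ∧ coord a ε u w m = (p, q)
  | 0, p, q, hp, hq => ⟨p, q, hp, hq, rfl⟩
  | m + 1, p, q, hp, hq => by
    have hs := mul_self_sign (h.sign (m + 1) (by omega))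
    have he : Odd (ε (m + 1)) := by
      rcases h.sign (m + 1) (by omega) with e | e <;> rw [e] <;> decide
    by_cases hev : Even (a (m + 1))
    · obtain ⟨u, w, hu, hw, hc⟩ := h.exists_coord m
        (p := ε (m + 1) * (-a (m + 1) * p - q)) (q := -p)
        (he.mul ((hev.neg.mul_right _).sub_odd hq)) hp.neg
      refine ⟨u, w, hu, hw, ?_⟩
      rw [coord, if_pos hev, hc]
      ext
      · simp
      · simp only; linear_combination (a (m + 1) * p + q) * hs
    · have ho := Int.not_even_iff_odd.1 hev
      obtain ⟨u, w, hu, hw, hc⟩ := h.exists_coord m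
        (p := ε (m + 1) * (q - 1 + a (m + 1) * p)) (q := p)
        (he.mul ((hq.sub_odd odd_one).add_odd (ho.mul hp))) hp
      refine ⟨u, w, hu, hw, ?_⟩
      rw [coord, if_neg hev, hc]
      ext
      · rfl
      · simp only; linear_combination (q - 1 + a (m + 1) * p) * hs

lemma distInt_le (x : ℝ) (m : ℤ) : distInt x ≤ |x - m| := round_le x m

/-- The value of `|n| ‖n α - γ‖` at the point with coordinates `(1, -1)` in the `m`-th cell. -/
lemma exists_small (h : IsAdjusted α a ε) {m : ℕ} (hm : 41 ≤ m) (he : ε (m + 1) = -1) :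
    ∃ n : ℤ, 0.04 * den a ε m ≤ 2 * |(n : ℝ)| + 1 ∧
      |(n : ℝ)| * distInt (n * α - gammaStar α a ε) ≤
        ((1 - back a ε m + xi a ε m) * (1 - tail α a ε m + eta α a ε m) /
          (1 - tail α a ε m * back a ε m) + 2 * gap α a ε m) / 4 := by
  obtain ⟨u, w, ⟨n, hn⟩, ⟨l, hl⟩, hc⟩ := h.exists_coord m (p := 1) (q := -1) odd_one (by decide)
  obtain ⟨h1, h2⟩ := h.coord_abs u w m
  rw [hc] at h1 h2
  rw [he] at h2
  push_cast at h1 h2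
  obtain ⟨v1, v2, v3⟩ := h.vertexBound hm 1 (-1) (Or.inl rfl) (Or.inr rfl)
  rw [he] at v2 v3
  push_cast at v1 v2 v3
  have hd := h.den_pos m
  have hg := h.gap_pos m
  have hdg := (h.den_mul_gap m).1
  rw [he] at hdg
  push_cast at hdg
  have hα := h.tail_pos m
  have hα' := h.tail_le m
  have hη := h.eta_nonneg m
  have hη' := h.eta_le m
  have htb := h.tail_mul_back_le m
  have hb := bound_pos
  have hbd := one_div_bound.2
  rw [div_lt_iff₀ hb] at hbd
  set U := 1 - back a ε m + xi a ε m with hU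
  set V := 1 - tail α a ε m + eta α a ε m with hV
  set S := 1 - tail α a ε m * back a ε m with hS
  have hS0 : 5 / 9 ≤ S := by linarith [htb.2]
  have v3' : 4 * bound * S ≤ U * V := by
    have e1 : 1 + -1 * tail α a ε m * back a ε m = S := by rw [hS]; ring
    have e2 : 1 + 1 * -1 * back a ε m + 1 * xi a ε m = U := by rw [hU]; ring
    have e3 : 1 - -1 * 1 * -1 * tail α a ε m - -1 * eta α a ε m = V := by rw [hV]; ring
    rwa [e1, e2, e3] at v3
  have hV0 : 0 ≤ V := by linarith
  have hV1 : V ≤ 2 := by linarith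
  have hUV : 0.08 ≤ U * V := by nlinarith
  have hU0 : 0.04 ≤ U := by nlinarith
  have k1 : |(u : ℝ)| = den a ε m * U := by
    rw [← h1, abs_of_nonneg (by linarith), hU]; ring
  have k2 : |(w : ℝ) - ε 1 * tail α a ε 0 * u - eta α a ε 0| = gap α a ε m * V := by
    rw [← h2, ← abs_neg, abs_of_nonneg (by linarith), hV]; ring
  have hu : (u : ℝ) = 2 * (n + 1 : ℤ) - 1 := by rw [hn]; push_cast; ring
  have hw : (w : ℝ) = 2 * l + 1 := by rw [hl]; push_cast; ring
  have k3 : |(w : ℝ) - ε 1 * tail α a ε 0 * u - eta α a ε 0| =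
      2 * |(n + 1 : ℤ) * α - gammaStar α a ε - (l + (n + 1) * a 0 : ℤ)| := by
    have e0 : (ε 1 : ℝ) * tail α a ε 0 = α - a 0 := by
      have ee : (ε 1 : ℝ) * ε 1 = 1 := by exact_mod_cast mul_self_sign (h.sign 1 le_rfl)
      rw [tail, ← mul_assoc, ee, one_mul]
    rw [e0, hu, hw, h.gammaStar_eq, ← abs_neg, ← abs_two (α := ℝ), ← abs_mul]
    congr 1
    push_cast; ring
  have k4 := distInt_le ((n + 1 : ℤ) * α - gammaStar α a ε) (l + (n + 1) * a 0)
  have k5 : |((n + 1 : ℤ) : ℝ)| ≤ (|(u : ℝ)| + 1) / 2 := by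
    have : ((n + 1 : ℤ) : ℝ) = (u + 1) / 2 := by linarith
    rw [this, abs_div, abs_two]
    have := abs_add_le (u : ℝ) 1
    rw [abs_one] at this
    linarith
  refine ⟨n + 1, ?_, ?_⟩
  · have : |(u : ℝ)| ≤ 2 * |((n + 1 : ℤ) : ℝ)| + 1 := by
      rw [hu]
      have := abs_sub (2 * ((n + 1 : ℤ) : ℝ)) 1
      rwa [abs_one, abs_mul, abs_two] at this
    rw [k1] at this
    nlinarith
  · have k6 : distInt ((n + 1 : ℤ) * α - gammaStar α a ε) ≤ gap α a ε m * V / 2 := by linarith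
    calc _ ≤ (|(u : ℝ)| + 1) / 2 * (gap α a ε m * V / 2) :=
          mul_le_mul k5 k6 (abs_nonneg _) (by positivity)
      _ = ((den a ε m * gap α a ε m) * (U * V) + gap α a ε m * V) / 4 := by rw [k1]; ring
      _ ≤ _ := by
          have : den a ε m * gap α a ε m = 1 / S := by
            rw [eq_div_iff (by linarith), ← hdg, hS]; ring
          rw [this, one_div_mul_eq_div]
          have := mul_le_mul_of_nonneg_left hV1 hg.le
          linarith

/-- Small values in infinitely many cells bound the limit inferior only if they come from infinitely
many n; the growth of q_m together with the lower bound for |n| in `exists_small` guarantees this.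
-/
lemma M_le_of_frequently (h : IsAdjusted α a ε) {c : ℝ}
    (hc : ∀ m₀, ∃ m, m₀ ≤ m ∧ 41 ≤ m ∧ ε (m + 1) = -1 ∧
      ((1 - back a ε m + xi a ε m) * (1 - tail α a ε m + eta α a ε m) /
          (1 - tail α a ε m * back a ε m) + 2 * gap α a ε m) / 4 ≤ c) :
    M α (gammaStar α a ε) ≤ (c : EReal) := by
  refine liminf_le_of_frequently_le' (Filter.frequently_cofinite_iff_infinite.2 ?_)
  refine Set.Infinite.of_image Int.natAbs (Set.infinite_of_forall_exists_gt fun N => ?_)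
  obtain ⟨m₁, hm₁⟩ := (tendsto_atTop.1 (tendsto_den h.sign h.two_le)
    (25 * (2 * N + 3))).exists_forall_of_atTop
  obtain ⟨m, hm, h41, he, hle⟩ := hc m₁
  obtain ⟨n, hn, hn'⟩ := h.exists_small h41 he
  refine ⟨n.natAbs, ⟨n, ?_, rfl⟩, ?_⟩
  · exact EReal.coe_le_coe_iff.2 (hn'.trans hle)
  · have h1 := hm₁ m hm
    have h2 : (N : ℝ) < |(n : ℝ)| := by linarith
    rw [← Int.cast_abs, Int.abs_eq_natAbs] at h2
    exact_mod_cast h2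

/-- The partial quotients of an expansion with period `block k`. -/
lemma digit_eq (h : IsAdjusted α a ε) {k N : ℕ} (hp : PeriodicFrom N (block k) a ε) (t : ℕ) {p : ℕ}
    (hlt : p < 5 * k + 3) {v : ℤ} (hv : blockDigit k p = v) {i : ℕ}
    (hi : i = N + 1 + ((5 * k + 3) * t + p)) :
    a i = |v| ∧ ε i = if 0 ≤ v then 1 else -1 := by
  have h1 := hp ((5 * k + 3) * t + p)
  rw [length_block, Nat.mul_add_mod, Nat.mod_eq_of_lt hlt, getD_block hlt, hv, ← hi] at h1
  have h2 := h.two_le i (by omega)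
  rcases h.sign i (by omega) with e | e <;> rw [e] at h1 ⊢
  · have h3 : v = a i := by omega
    rw [h3, abs_of_nonneg (by omega), if_pos (by omega)]
    exact ⟨rfl, rfl⟩
  · have h3 : v = -a i := by omega
    rw [h3, abs_neg, abs_of_nonneg (by omega), if_neg (by omega)]
    exact ⟨rfl, rfl⟩

lemma M_lt_of_periodic (h : IsAdjusted α a ε) {δ r : ℝ} (hδ : 0 < δ)
    (hr : ∀ b x t y : ℝ, |b - critBack| < r → |x - critXi| < r → |t - critTail| < r → |y| < r →
      criticalValue (b, x, t, y) < 4 * bound + δ) {k N : ℕ} (hk : 2 * (1 / 2) ^ k < r)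
    (hp : PeriodicFrom N (block (k + 1)) a ε) :
    M α (gammaStar α a ε) < ((bound + δ : ℝ) : EReal) := by
  have hM : M α (gammaStar α a ε) ≤ ((bound + δ / 2 : ℝ) : EReal) := by
    refine h.M_le_of_frequently fun m₀ => ?_
    obtain ⟨m₁, hm₁⟩ := ((tendsto_order.1 h.tendsto_gap).2 (δ / 4)
      (by linarith)).exists_forall_of_atTop
    set t := m₀ + m₁ + 41
    set j := N + (5 * (k + 1) + 3) * t with hj
    have htj : t ≤ j := by
      have : 1 * t ≤ (5 * (k + 1) + 3) * t := Nat.mul_le_mul_right _ (by omega)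
      omega
    have dig := fun (p : ℕ) (hlt : p < 5 * (k + 1) + 3) (v : ℤ)
      (hv : blockDigit (k + 1) p = v) (i : ℕ) (hi : i = j + 1 + p) =>
        h.digit_eq hp t hlt hv (i := i) (by omega)
    have three := dig k (by omega) 3 (blockDigit_eq_three.2 (by omega)) (j + k + 1) (by omega)
    have d2 := dig (k + 1) (by omega) (-2) (blockDigit_eq_neg_two.2 (by omega)) (j + k + 2)
      (by omega)
    have d3 := dig (k + 2) (by omega) 2 (blockDigit_eq_two.2 (by omega)) (j + k + 3) (by omega)
    have d4 := dig (k + 3) (by omega) (-3) (blockDigit_eq_neg_three.2 (by omega)) (j + k + 4)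
      (by omega)
    have d5 := dig (k + 4) (by omega) (-4) (blockDigit_eq_neg_four.2 (by omega)) (j + k + 5)
      (by omega)
    norm_num at three d2 d3 d4 d5
    obtain ⟨-, G, hG, hU, hS⟩ := h.critical_forms (k := j + k) three.1 three.2 d2.1 d2.2 d3.1 d3.2
      d4.1 d4.2
    -- Of the k + 1 threes the last belongs to the critical window, which leaves k for the
    -- convergence. Of the k + 1 loops the last is not followed by -4, which leaves k as well.
    have hback := h.back_threes (j := j) k fun l hl => by
      have := dig l (by omega) 3 (blockDigit_eq_three.2 (by omega)) (j + l + 1) (by omega)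
      norm_num at this
      exact this
    have hloop := h.tail_loops k (j + k + 4) fun l hl => by
      have e1 := dig (k + 4 + 4 * l) (by omega) (-4) (blockDigit_eq_neg_four.2 (by omega))
        (j + k + 4 + 4 * l + 1) (by omega)
      have e2 := dig (k + 5 + 4 * l) (by omega) (-2) (blockDigit_eq_neg_two.2 (by omega))
        (j + k + 4 + 4 * l + 2) (by omega)
      have e3 := dig (k + 6 + 4 * l) (by omega) 2 (blockDigit_eq_two.2 (by omega))
        (j + k + 4 + 4 * l + 3) (by omega)
      have e4 := dig (k + 7 + 4 * l) (by omega) 2 (blockDigit_eq_two.2 (by omega))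
        (j + k + 4 + 4 * l + 4) (by omega)
      have e5 := dig (k + 8 + 4 * l) (by omega) (-4) (blockDigit_eq_neg_four.2 (by omega))
        (j + k + 4 + 4 * l + 5) (by omega)
      norm_num at e1 e2 e3 e4 e5
      exact ⟨e1.1, e2.1, e2.2, e3.1, e3.2, e4.1, e4.2, e5.2⟩
    have hpow : (0 : ℝ) < (1 / 2) ^ k := by positivity
    have hval := hr (back a ε (j + k)) (xi a ε (j + k)) (tail α a ε (j + k + 4))
      (eta α a ε (j + k + 4)) (by linarith [hback, abs_nonneg (xi a ε (j + k) - critXi)])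
      (by linarith [hback, abs_nonneg (back a ε (j + k) - critBack)]) (by linarith [hloop.1])
      (by rw [abs_of_nonneg (h.eta_nonneg _)]; linarith [hloop.2])
    refine ⟨j + k + 4, by omega, by omega, d5.2, ?_⟩
    have hgap := hm₁ (j + k + 4) (by omega)
    rw [hU, hS, mul_assoc, mul_div_mul_left _ _ hG.ne']
    rw [criticalValue] at hval
    linarith
  exact hM.trans_lt (EReal.coe_lt_coe_iff.2 (by linarith))

end IsAdjusted

theorem exists_near_bound {δ : ℝ} (hδ : 0 < δ) : ∃ K : ℕ, ∀ k, K ≤ k → ∀ (α : ℝ) (a ε : ℕ → ℤ)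
    (N : ℕ), IsAdjusted α a ε → PeriodicFrom N (block k) a ε →
      M α (gammaStar α a ε) < ((bound + δ : ℝ) : EReal) := by
  obtain ⟨r, hr, hball⟩ := exists_ball hδ
  obtain ⟨n, hn⟩ := exists_pow_lt_of_lt_one (half_pos hr) (by norm_num : (1 / 2 : ℝ) < 1)
  refine ⟨n + 1, fun k hk α a ε N h hp => ?_⟩
  obtain ⟨l, rfl⟩ : ∃ l, k = l + 1 := ⟨k - 1, by omega⟩
  refine h.M_lt_of_periodic hδ hball ?_ hp
  have : (1 / 2 : ℝ) ^ l ≤ (1 / 2) ^ n :=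
    pow_le_pow_of_le_one (by norm_num) (by norm_num) (by omega)
  linarith

end Inhom

end

theorem theorem3 :
    -- the value of the constant
    (25.159 ≤ 1 / Inhom.bound ∧ 1 / Inhom.bound < 25.160) ∧
    -- the lower bound for every adjusted nearest integer expansion
    (∀ (α : ℝ) (a ε : ℕ → ℤ), Inhom.IsAdjusted α a ε →
      Summable (Inhom.gammaTerm α a ε) ∧
      Inhom.gammaStar α a ε ∉ Inhom.lattice α ∧
      (Inhom.bound : EReal) ≤ Inhom.M α (Inhom.gammaStar α a ε)) ∧
    -- the lower bound for every irrational number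
    (∀ α : ℝ, Irrational α → (Inhom.bound : EReal) ≤ Inhom.rho α) ∧
    -- the expansions with the stated periods exist
    (∀ k : ℕ, 1 ≤ k → ∃ (α : ℝ) (a ε : ℕ → ℤ),
      Inhom.IsAdjusted α a ε ∧ Inhom.PeriodicFrom 0 (Inhom.block k) a ε) ∧
    -- and they come arbitrarily close to the bound
    (∀ δ : ℝ, 0 < δ → ∃ K : ℕ, ∀ k : ℕ, K ≤ k → ∀ (α : ℝ) (a ε : ℕ → ℤ) (N : ℕ),
      Inhom.IsAdjusted α a ε → Inhom.PeriodicFrom N (Inhom.block k) a ε →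
      Inhom.M α (Inhom.gammaStar α a ε) < ((Inhom.bound + δ : ℝ) : EReal)) := by
  exact ⟨Inhom.one_div_bound, fun _ _ _ h => ⟨h.hasSum_gammaTerm.summable, h.main⟩,
    fun _ h => Inhom.bound_le_rho h, fun _ hk => Inhom.exists_periodic hk,
    fun _ hδ => Inhom.exists_near_bound hδ⟩
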